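/- Let $G=(V,E,m,\mu)$ be a weighted graph: $(V,E)$ is a connected, undirected, locally finite graph, $m:V\to(0,\infty)$ is a vertex weight and $\mu:E\to(0,\infty)$, $\{x,y\}\mapsto\mu_{xy}=\mu_{yx}$, is an edge weight. For $f,g:V\to\mathbb R$ put $$\Delta f(x)=\frac1{m(x)}\sum_{y\sim x}\mu_{xy}(f(y)-f(x)),\qquad \Gamma(f,g)=\tfrac12\big(\Delta(fg)-f\Delta g-g\Delta f\big),$$ $$\Gamma(f)=\Gamma(f,f),\qquad \Gamma_2(f)=\tfrac12\Delta\Gamma(f)-\Gamma(f,\Delta f).$$ $G$ satisfies $\mathrm{CD}(0,\infty)$ if $\Gamma_2(f)(x)\ge 0$ for all $f:V\to\mathbb R$ and all $x\in V$. $G$ is complete if there is a non-decreasing sequence $(\eta_k)_{k\ge1}$ of finitely supported non-negative functions on $V$ with $\eta_k\to 1$ pointwise and $\Gamma(\eta_k)\le\frac1k$ for every $k$. Let $C_0(V)$ be the set of finitely supported functions $V\to\mathbb R$. Let $Q(f,g)=\frac12\sum_{x,y\in V:\,x\sim y}\mu_{xy}(f(y)-f(x))(g(y)-g(x))$, with domain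 $D(Q)\subset\ell^2(V,m)$ the completion of $C_0(V)$ under the norm $\big(\|f\|_{\ell^2(V,m)}^2+Q(f,f)\big)^{1/2}$. Let $\mathcal L$ be the generator of $Q$, that is, $f\in D(\mathcal L)$ and $\mathcal Lf=g\in\ell^2(V,m)$ if and only if $f\in D(Q)$ and $Q(f,h)=-\langle g,h\rangle_{\ell^2(V,m)}$ for all $h\in D(Q)$. Let $P_t=e^{t\mathcal L}$ be the corresponding $C_0$-semigroup on $\ell^2(V,m)$, i.e. the $C_0$-semigroup with infinitesimal generator $\mathcal L$. Assume (A), i.e. that at least one of the following holds: - $(A_1)$ $\Delta$ is bounded on $\ell^2(V,m)$, i.e. $\sup_{x\in V}\frac1{m(x)}\sum_{y\sim x}\mu_{xy}<\infty$; - $(A_2)$ $G$ is complete and $\inf_{x\in V}m(x)>0$. Then the semigroup $P_t$ exists, and the following are equivalent: (a) $G$ satisfies $\mathrm{CD}(0,\infty)$; (b) $\Gamma(P_tf)\le P_t(\Gamma(f))$ for all $f\in C_0(V)$ and $t>0$; (c) $P_t(f^2)-(P_tf)^2\le 2t\,P_t(\Gamma(f))$ for all $f\in C_0(V)$ and $t>0$;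 (d) $2t\,\Gamma(P_tf)\le P_t(f^2)-(P_tf)^2$ for all $f\in C_0(V)$ and $t>0$. The inequalities in (b)-(d) hold pointwise on $V$. -/

import Mathlib

open MeasureTheory Filter Topology
open scoped NNReal ENNReal

/-- A weighted graph `(V, E, m, μ)`: a connected, locally finite, undirected graph with positive
vertex weights `m` and positive symmetric edge weights `μ`, extended by zero to the pairs
of vertices that are not neighbors. -/
structure WeightedGraph (V : Type*) where
  /-- the underlying combinatorial graph -/
  graph : SimpleGraph V
  connected : graph.Connected
  locallyFinite : ∀ x, (graph.neighborSet x).Finite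
  /-- the vertex weight -/
  m : V → ℝ
  m_pos : ∀ x, 0 < m x
  /-- the edge weight -/
  μ : V → V → ℝ
  μ_symm : ∀ x y, μ x y = μ y x
  μ_pos : ∀ x y, graph.Adj x y → 0 < μ x y
  μ_eq_zero : ∀ x y, ¬ graph.Adj x y → μ x y = 0

/-- A `C₀`-semigroup (strongly continuous semigroup) of bounded operators. -/
structure IsC0Semigroup {H : Type*} [NormedAddCommGroup H] [NormedSpace ℝ H]
    (P : ℝ≥0 → H →L[ℝ] H) : Prop where
  zero : P 0 = ContinuousLinearMap.id ℝ H
  add : ∀ s t, P (s + t) = (P s).comp (P t)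
  tendsto_zero : ∀ f, Tendsto (fun t => P t f) (𝓝 0) (𝓝 f)

/-- `f` lies in the domain of the infinitesimal generator of `P`, and the generator
maps `f` to `g`. -/
def HasInfinitesimalGenerator {H : Type*} [NormedAddCommGroup H] [NormedSpace ℝ H]
    (P : ℝ≥0 → H →L[ℝ] H) (f g : H) : Prop :=
  Tendsto (fun t : ℝ≥0 => (t : ℝ)⁻¹ • (P t f - f)) (𝓝[>] 0) (𝓝 g)

namespace WeightedGraph

variable {V : Type*} (G : WeightedGraph V)

/-- The finite set of neighbors of a vertex. -/
noncomputable def nbrs (x : V) : Finset V := (G.locallyFinite x).toFinset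

/-- The Laplacian `Δ f (x) = (1 / m x) ∑_{y ∼ x} μ_{xy} (f y - f x)`. -/
noncomputable def laplacian (f : V → ℝ) (x : V) : ℝ :=
  1 / G.m x * ∑ y ∈ G.nbrs x, G.μ x y * (f y - f x)

/-- The carré du champ operator `Γ(f, g)`. -/
noncomputable def Gamma (f g : V → ℝ) (x : V) : ℝ :=
  1 / 2 * (G.laplacian (f * g) x - f x * G.laplacian g x - g x * G.laplacian f x)

/-- The iterated operator `Γ₂(f) = ½ Δ Γ(f) - Γ(f, Δ f)`. -/
noncomputable def Gamma2 (f : V → ℝ) (x : V) : ℝ :=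
  1 / 2 * G.laplacian (G.Gamma f f) x - G.Gamma f (G.laplacian f) x

/-- The curvature dimension condition `CD(K, n)`, for `K ∈ ℝ` and `n ∈ (0, ∞]`
(so `1 / n = 0` when `n = ∞`). -/
def CD (K : ℝ) (n : ℝ≥0∞) : Prop :=
  ∀ (f : V → ℝ) (x : V),
    n⁻¹.toReal * G.laplacian f x ^ 2 + K * G.Gamma f f x ≤ G.Gamma2 f x

/-- Boundedness of the Laplacian: `sup_x (1 / m x) ∑_{y ∼ x} μ_{xy} < ∞`. -/
def BoundedLaplacian : Prop :=
  BddAbove (Set.range fun x => 1 / G.m x * ∑ y ∈ G.nbrs x, G.μ x y)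

/-- Completeness of a weighted graph: there are finitely supported `0 ≤ η₁ ≤ η₂ ≤ …` that converge
to `1` pointwise, with `Γ(η_k) ≤ 1 / k` (the sequence is indexed from `0` here). -/
def Complete : Prop :=
  ∃ η : ℕ → V → ℝ, Monotone η ∧ (∀ k, (η k).support.Finite) ∧ (∀ k x, 0 ≤ η k x) ∧
    (∀ x, Tendsto (fun k => η k x) atTop (𝓝 1)) ∧
    ∀ (k : ℕ) (x : V), G.Gamma (η k) (η k) x ≤ 1 / ((k : ℝ) + 1)

/-- The vertex weight is non-degenerate: `inf_x m x > 0`. -/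
def NonDegenerate : Prop := ∃ c : ℝ, 0 < c ∧ ∀ x, c ≤ G.m x

/-- Assumption (A): the Laplacian is bounded, or the graph is complete with non-degenerate `m`. -/
def AssumptionA : Prop := G.BoundedLaplacian ∨ (G.Complete ∧ G.NonDegenerate)

/-- The measure on the discrete space `V` in which the point `x` has mass `m x`. -/
noncomputable def measure : @Measure V ⊤ :=
  @Measure.sum V V ⊤ fun x => ENNReal.ofReal (G.m x) • @Measure.dirac V ⊤ x

/-- The real Hilbert space `ℓ²(V, m)`. The only null set is the empty set (`ae_iff` below), so an
element of this space is a function on `V`. -/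
noncomputable abbrev L2 : Type _ := Lp ℝ 2 G.measure

/-- The squared form norm `‖u‖² + ½ ∑_{x,y} μ_{xy} (u y - u x)²`, possibly infinite. The norm
is that of `ℓ²(V, m)`; the sum runs over ordered pairs of vertices. -/
noncomputable def formNormSq (u : V → ℝ) : ℝ≥0∞ :=
  eLpNorm u 2 G.measure ^ 2 +
    1 / 2 * ∑' p : V × V, ENNReal.ofReal (G.μ p.1 p.2 * (u p.2 - u p.1) ^ 2)

/-- The form domain `D(Q)`: the completion of the finitely supported functions under the form norm,
realized in `ℓ²(V, m)` as the set of limits of finitely supported functions. -/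
def formDomain : Set G.L2 :=
  {f | ∃ φ : ℕ → V → ℝ, (∀ n, (φ n).support.Finite) ∧
    Tendsto (fun n => G.formNormSq ((f : V → ℝ) - φ n)) atTop (𝓝 0)}

/-- The Dirichlet form `Q(f, g) = ½ ∑_{x,y} μ_{xy} (f y - f x) (g y - g x)`. The
sum converges absolutely for `f, g ∈ D(Q)`. -/
noncomputable def form (f g : V → ℝ) : ℝ :=
  1 / 2 * ∑' p : V × V, G.μ p.1 p.2 * (f p.2 - f p.1) * (g p.2 - g p.1)

/-- The graph of the generator `𝓛` of the Dirichlet form: `f ∈ D(𝓛)` and `𝓛 f = g` if and only if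
`f ∈ D(Q)` and `Q(f, h) = -⟨g, h⟩` for all `h ∈ D(Q)`. -/
def IsFormGenerator (f g : G.L2) : Prop :=
  f ∈ G.formDomain ∧ ∀ h ∈ G.formDomain, G.form f h = - inner ℝ g h

/-- `P` is the `C₀`-semigroup `e^{t𝓛}` on `ℓ²(V, m)`: the `C₀`-semigroup whose infinitesimal
generator, with its domain, is `𝓛`. -/
def IsHeatSemigroup (P : ℝ≥0 → G.L2 →L[ℝ] G.L2) : Prop :=
  IsC0Semigroup P ∧ ∀ f g, HasInfinitesimalGenerator P f g ↔ G.IsFormGenerator f g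

open Classical in
/-- The semigroup `P_t = e^{t𝓛}` on `ℓ²(V, m)`. A `C₀`-semigroup is determined by its
generator, so this is the only semigroup that satisfies `IsHeatSemigroup`. -/
noncomputable def heatSemigroup : ℝ≥0 → G.L2 →L[ℝ] G.L2 :=
  if h : ∃ P, G.IsHeatSemigroup P then h.choose else 0

open Classical in
/-- `P_t f` as a function on `V`, for a function `f` in `ℓ²(V, m)` (and `0` for other `f`). -/
noncomputable def heat (t : ℝ≥0) (f : V → ℝ) : V → ℝ :=
  if h : MemLp f 2 G.measure then G.heatSemigroup t (h.toLp f) else 0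

/-- Every vertex has positive mass, so "almost everywhere" means "everywhere". -/
theorem ae_iff (p : V → Prop) : (∀ᵐ x ∂G.measure, p x) ↔ ∀ x, p x := by
  let _ : MeasurableSpace V := ⊤
  have hms : ∀ s : Set V, MeasurableSet s := fun s => MeasurableSpace.measurableSet_top
  rw [MeasureTheory.ae_iff, measure, Measure.sum_apply _ (hms _), ENNReal.tsum_eq_zero]
  refine forall_congr' fun x => ?_
  rw [Measure.smul_apply, Measure.dirac_apply' _ (hms _)]
  by_cases hx : p x <;> simp [hx, G.m_pos x]

/-- Finitely supported functions lie in `ℓ²(V, m)`. -/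
theorem memLp_of_finite_support {f : V → ℝ} (hf : f.support.Finite) : MemLp f 2 G.measure := by
  let _ : MeasurableSpace V := ⊤
  have hms : ∀ s : Set V, MeasurableSet s := fun s => MeasurableSpace.measurableSet_top
  have hmass : ∀ x : V, G.measure {x} ≠ ∞ := by
    intro x
    rw [measure, Measure.sum_apply _ (hms _), tsum_eq_single x]
    · simp
    · intro y hy
      rw [Measure.smul_apply, Measure.dirac_apply' _ (hms _)]
      simp [hy]
  have hsum : f = ∑ x ∈ hf.toFinset, ({x} : Set V).indicator (fun _ => f x) := by
    funext y
    rw [Finset.sum_apply]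
    by_cases hy : y ∈ hf.toFinset
    · rw [Finset.sum_eq_single y]
      · simp
      · intro b _ hb
        simp [Ne.symm hb]
      · intro h; exact absurd hy h
    · rw [Finset.sum_eq_zero]
      · simpa using hy
      · intro b hb
        have : y ≠ b := fun h => hy (h ▸ hb)
        simp [this]
  rw [hsum]
  exact memLp_finsetSum' _ fun x _ => memLp_indicator_const 2 (hms _) _ (Or.inr (hmass x))

/-- If `f` has finite support, then so has `Γ(f)`. -/
theorem finite_support_Gamma {f : V → ℝ} (hf : f.support.Finite) :
    (G.Gamma f f).support.Finite := by
  refine (hf.union (hf.biUnion fun y _ => G.locallyFinite y)).subset fun x hx => ?_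
  by_contra h
  simp only [Set.mem_union, Set.mem_iUnion, not_or, not_exists] at h
  have hx0 : f x = 0 := by simpa using h.1
  have hy0 : ∀ y ∈ G.nbrs x, f y = 0 := by
    intro y hy
    by_contra hne
    have hxy : G.graph.Adj x y := by simpa [nbrs] using hy
    exact h.2 y hne hxy.symm
  apply hx
  have : ∑ y ∈ G.nbrs x, G.μ x y * ((f * f) y - (f * f) x) = 0 :=
    Finset.sum_eq_zero fun y hy => by simp [hx0, hy0 y hy]
  simp [Gamma, laplacian, hx0] at this ⊢
  simp [this]

end WeightedGraph

/-! ### Strong convergence of contractions, tested on a dense set. -/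

section DenseConvergence

variable {H : Type*} [NormedAddCommGroup H] [NormedSpace ℝ H] {ι : Type*} {l : Filter ι}

/-! Existence of `P_t`: the generator of `Q` is m-dissipative, its resolvent equation being solved
by Lax–Milgram on the form domain, and the Hille–Yosida theorem (`IsMDissipative.exists_semigroup`)
produces the semigroup. The generator acts as `Δ`, so `P_t f` solves the heat equation pointwise for
finitely supported `f`.

(a) implies the rest by Bakry–Émery interpolation. Put `ψ = δ_x / m(x)`. Formally, `φ(s) =
⟨Γ(P_{t-s} f), P_s ψ⟩` has `φ' = 2⟨Γ₂(P_{t-s} f), P_s ψ⟩ ≥ 0`, since `P_s ψ ≥ 0`, and `χ(s) =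
⟨(P_{t-s} f)², P_s ψ⟩` has `χ' = 2φ`. Here `φ` runs from `Γ(P_t f)(x)` to `P_t(Γ f)(x)` and `χ` from
`(P_t f)²(x)` to `P_t(f²)(x)`. So `φ(0) ≤ φ(t)` is (b), and `2t φ(0) ≤ χ(t) - χ(0) ≤ 2t φ(t)`
contains (d) and (c).

The formal point is the symmetry `⟨Δv, g⟩ = ⟨v, Δg⟩` for `g = Γ(P_{t-s} f)`, which is not known to
lie in the domain. All sums are therefore weighted by `η_k²`, with `η_k` finitely supported and
`Γ(η_k) ≤ δ_k² → 0`. By `abs_sum_sq_mul_laplacian_sub_le` the error is `O(δ_k)` once the weighted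
norms and energies of `v` and `g` are bounded independently of `k`. For this `g` the energy bound is
the Caccioppoli inequality `pairSum_sq_mul_Gamma_sub_sq_le`. It rests on the curvature condition
itself and on a uniform bound for `Γ(P_t f)`, supplied by (A).

Conversely, `Γ₂(f)(x)` is local, so finitely supported `f` suffice. Expanding at `t = 0`, the
leading coefficient of (b) (first order), and of (c) and (d) (second order), is a positive multiple
of `Γ₂(f)(x)`. -/

theorem tendsto_apply_of_dense {T : ι → H →L[ℝ] H} (hT : ∀ i, ‖T i‖ ≤ 1)
    {S : H →L[ℝ] H} (hS : ‖S‖ ≤ 1) {D : Set H} (hD : Dense D)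
    (h : ∀ f ∈ D, Tendsto (fun i => T i f) l (𝓝 (S f))) (f : H) :
    Tendsto (fun i => T i f) l (𝓝 (S f)) := by
  rw [Metric.tendsto_nhds]
  intro ε hε
  obtain ⟨d, hd, hdf⟩ := hD.exists_dist_lt f (by positivity : 0 < ε / 3)
  filter_upwards [Metric.tendsto_nhds.1 (h d hd) (ε / 3) (by positivity)] with i hi
  have h1 : dist (T i f) (T i d) ≤ dist f d := by
    rw [dist_eq_norm, dist_eq_norm, ← map_sub]
    exact (T i).le_of_opNorm_le (hT i) _ |>.trans (by rw [one_mul])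
  have h2 : dist (S d) (S f) ≤ dist f d := by
    rw [dist_comm, dist_eq_norm, dist_eq_norm, ← map_sub]
    exact S.le_of_opNorm_le hS _ |>.trans (by rw [one_mul])
  have := dist_triangle4 (T i f) (T i d) (S d) (S f)
  linarith

theorem cauchySeq_apply_of_dense {T : ℕ → H →L[ℝ] H} (hT : ∀ i, ‖T i‖ ≤ 1)
    {D : Set H} (hD : Dense D) (h : ∀ f ∈ D, CauchySeq fun i => T i f) (f : H) :
    CauchySeq fun i => T i f := by
  rw [Metric.cauchySeq_iff]
  intro ε hε
  obtain ⟨d, hd, hdf⟩ := hD.exists_dist_lt f (by positivity : 0 < ε / 3)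
  obtain ⟨N, hN⟩ := Metric.cauchySeq_iff.1 (h d hd) (ε / 3) (by positivity)
  refine ⟨N, fun m hm n hn => ?_⟩
  have hle : ∀ i, dist (T i f) (T i d) ≤ dist f d := fun i => by
    rw [dist_eq_norm, dist_eq_norm, ← map_sub]
    exact (T i).le_of_opNorm_le (hT i) _ |>.trans (by rw [one_mul])
  have h1 := hle m
  have h2 := hle n
  rw [dist_comm] at h2
  have := dist_triangle4 (T m f) (T m d) (T n d) (T n f)
  have := hN m hm n hn
  linarith

end DenseConvergence

/-! ### Calculus of abstract C₀-semigroups. -/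

namespace IsC0Semigroup

variable {H : Type*} [NormedAddCommGroup H] [NormedSpace ℝ H]
  {P : ℝ≥0 → H →L[ℝ] H}


theorem hasInfinitesimalGenerator_apply (hP : IsC0Semigroup P) {f g : H}
    (h : HasInfinitesimalGenerator P f g) (t : ℝ≥0) :
    HasInfinitesimalGenerator P (P t f) (P t g) := by
  have := ((P t).continuous.tendsto g).comp h
  refine this.congr fun s => ?_
  have hcomm : P s (P t f) = P t (P s f) := by
    rw [← ContinuousLinearMap.comp_apply, ← hP.add, add_comm, hP.add,
      ContinuousLinearMap.comp_apply]
  simp [hcomm]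

theorem hasDerivWithinAt_Ici (hP : IsC0Semigroup P) {f g : H}
    (h : HasInfinitesimalGenerator P f g) {t : ℝ} (ht : 0 ≤ t) :
    HasDerivWithinAt (fun s : ℝ => P s.toNNReal f) (P t.toNNReal g) (Set.Ici t) t := by
  rw [hasDerivWithinAt_iff_tendsto_slope, Set.Ici_sdiff_left]
  have hsub : Tendsto (fun s : ℝ => (s - t).toNNReal) (𝓝[>] t) (𝓝[>] 0) := by
    refine tendsto_nhdsWithin_iff.2 ⟨?_, ?_⟩
    · have : Continuous fun s : ℝ => (s - t).toNNReal := by fun_prop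
      simpa using (this.tendsto t).mono_left nhdsWithin_le_nhds
    · filter_upwards [self_mem_nhdsWithin] with s hs
      simpa using hs
  refine ((hP.hasInfinitesimalGenerator_apply h t.toNNReal).comp hsub).congr' ?_
  filter_upwards [self_mem_nhdsWithin] with s hs
  have hs' : t < s := hs
  have h1 : s.toNNReal = (s - t).toNNReal + t.toNNReal := by
    rw [← Real.toNNReal_add (by linarith) ht]; congr 1; ring
  have h2 : ((s - t).toNNReal : ℝ) = s - t := Real.coe_toNNReal _ (by linarith)
  simp only [Function.comp, slope, vsub_eq_sub, h2]
  rw [h1, hP.add, ContinuousLinearMap.comp_apply]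

variable [CompleteSpace H]

/-- Otherwise `‖P t_n‖ > n` along some `t_n → 0`. Each orbit `P t_n f` converges and so is bounded,
against Banach–Steinhaus. -/
theorem exists_norm_le_near_zero (hP : IsC0Semigroup P) :
    ∃ δ : ℝ≥0, 0 < δ ∧ ∃ M : ℝ, ∀ t ≤ δ, ‖P t‖ ≤ M := by
  by_contra! hcon
  have hpos : ∀ n : ℕ, (0 : ℝ≥0) < 1 / (n + 1) := fun n => by positivity
  choose t ht hM using fun n : ℕ => hcon (1 / ((n : ℝ≥0) + 1)) (hpos n) n
  have ht0 : Tendsto t atTop (𝓝 0) :=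
    tendsto_of_tendsto_of_tendsto_of_le_of_le tendsto_const_nhds
      (tendsto_one_div_add_atTop_nhds_zero_nat (𝕜 := ℝ≥0)) (fun _ => zero_le) ht
  obtain ⟨C, hC⟩ := banach_steinhaus (g := fun n => P (t n)) fun f => by
    obtain ⟨C, hC⟩ := (((hP.tendsto_zero f).comp ht0).norm).bddAbove_range
    exact ⟨C, fun n => hC ⟨n, rfl⟩⟩
  obtain ⟨n, hn⟩ := exists_nat_gt C
  exact absurd (hC n) (not_le.2 (hn.trans (hM n)))

theorem exists_norm_le (hP : IsC0Semigroup P) (T : ℝ≥0) :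
    ∃ M : ℝ, 0 ≤ M ∧ ∀ t ≤ T, ‖P t‖ ≤ M := by
  obtain ⟨δ, hδ, M, hM⟩ := hP.exists_norm_le_near_zero
  have key : ∀ n : ℕ, ∃ M : ℝ, ∀ t ≤ n * δ, ‖P t‖ ≤ M := by
    intro n
    induction n with
    | zero => exact ⟨M, fun t ht => hM t (ht.trans (by simp))⟩
    | succ n ih =>
      obtain ⟨M', hM'⟩ := ih
      refine ⟨max M (‖P δ‖ * M'), fun t ht => ?_⟩
      rcases le_total t δ with h | h
      · exact (hM t h).trans (le_max_left _ _)
      · refine le_trans ?_ (le_max_right _ _)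
        rw [← add_tsub_cancel_of_le h, hP.add]
        refine (ContinuousLinearMap.opNorm_comp_le _ _).trans ?_
        gcongr
        refine hM' _ (tsub_le_iff_right.2 (ht.trans_eq ?_))
        push_cast; ring
  obtain ⟨n, hn⟩ := exists_nat_gt (T / δ)
  obtain ⟨M', hM'⟩ := key n
  refine ⟨M', (norm_nonneg _).trans (hM' 0 zero_le), fun t ht => hM' t (ht.trans ?_)⟩
  exact ((div_lt_iff₀ hδ).1 hn).le

theorem continuous (hP : IsC0Semigroup P) (f : H) : Continuous fun t => P t f := by
  rw [continuous_iff_continuousAt]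
  intro t
  obtain ⟨M, hM0, hM⟩ := hP.exists_norm_le (t + 1)
  -- Subtraction on `ℝ≥0` is truncated, so this sum is `|s - t|`.
  have hd : Tendsto (fun s : ℝ≥0 => (s - t) + (t - s)) (𝓝 t) (𝓝 0) := by
    have : Continuous fun s : ℝ≥0 => (s - t) + (t - s) := by fun_prop
    simpa using this.tendsto t
  have hb : Tendsto (fun s => M * ‖P ((s - t) + (t - s)) f - f‖) (𝓝 t) (𝓝 0) := by
    have := ((hP.tendsto_zero f).comp hd).sub_const f
    simpa using (this.norm).const_mul M
  rw [ContinuousAt, tendsto_iff_norm_sub_tendsto_zero]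
  refine squeeze_zero' (Eventually.of_forall fun s => norm_nonneg _) ?_ hb
  filter_upwards [Iio_mem_nhds (lt_add_one t)] with s hs
  rcases le_total s t with h | h
  · rw [tsub_eq_zero_of_le h, zero_add, norm_sub_rev, norm_sub_rev _ f]
    have : P t f = P s (P (t - s) f) := by
      rw [← ContinuousLinearMap.comp_apply, ← hP.add, add_tsub_cancel_of_le h]
    rw [this, ← map_sub, norm_sub_rev f]
    exact (P s).le_of_opNorm_le (hM s (le_of_lt hs)) _
  · rw [tsub_eq_zero_of_le h, add_zero]
    have : P s f = P t (P (s - t) f) := by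
      rw [← ContinuousLinearMap.comp_apply, ← hP.add, add_tsub_cancel_of_le h]
    rw [this, ← map_sub]
    exact (P t).le_of_opNorm_le (hM t (le_self_add)) _

theorem continuous_toNNReal (hP : IsC0Semigroup P) (f : H) :
    Continuous fun t : ℝ => P t.toNNReal f :=
  (hP.continuous f).comp continuous_real_toNNReal

/-- The definition of the generator yields right derivatives only. The difference `P_t f - ∫₀ᵗ P_s
g` is continuous with zero right derivative, hence constant; the integral formula then upgrades to
two-sided derivatives. -/
theorem eq_add_integral (hP : IsC0Semigroup P) {f g : H}
    (h : HasInfinitesimalGenerator P f g) {t : ℝ} (ht : 0 ≤ t) :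
    P t.toNNReal f = f + ∫ s in (0 : ℝ)..t, P s.toNNReal g := by
  have hc := hP.continuous_toNNReal g
  have hd : ∀ x, HasDerivAt (fun t : ℝ => ∫ s in (0 : ℝ)..t, P s.toNNReal g) (P x.toNNReal g) x :=
    fun x => (hc.integral_hasStrictDerivAt 0 x).hasDerivAt
  have := constant_of_has_deriv_right_zero (a := 0) (b := t)
    (f := fun t : ℝ => P t.toNNReal f - ∫ s in (0 : ℝ)..t, P s.toNNReal g)
    (((hP.continuous_toNNReal f).sub
      (continuous_iff_continuousAt.2 fun x => (hd x).continuousAt)).continuousOn)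
    (fun x hx => by
      simpa using (hP.hasDerivWithinAt_Ici h hx.1).fun_sub (hd x).hasDerivWithinAt)
    t ⟨ht, le_rfl⟩
  simp only [intervalIntegral.integral_same, Real.toNNReal_zero, hP.zero, sub_zero,
    ContinuousLinearMap.id_apply] at this
  exact sub_eq_iff_eq_add.1 this

theorem hasDerivAt (hP : IsC0Semigroup P) {f g : H}
    (h : HasInfinitesimalGenerator P f g) {t : ℝ} (ht : 0 < t) :
    HasDerivAt (fun s : ℝ => P s.toNNReal f) (P t.toNNReal g) t := by
  have hd := (((hP.continuous_toNNReal g).integral_hasStrictDerivAt 0 t).hasDerivAt).const_add f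
  refine hd.congr_of_eventuallyEq ?_
  filter_upwards [lt_mem_nhds ht] with s hs
  exact hP.eq_add_integral h hs.le

end IsC0Semigroup

/-! ### Exponentials of bounded dissipative operators. -/

section DissipativeExp

variable {H : Type*} [NormedAddCommGroup H] [InnerProductSpace ℝ H] [CompleteSpace H]

theorem hasDerivAt_exp_smul_apply (A : H →L[ℝ] H) (f : H) (t : ℝ) :
    HasDerivAt (fun s : ℝ => NormedSpace.exp (s • A) f) (A (NormedSpace.exp (t • A) f)) t := by
  have h := (hasDerivAt_exp_smul_const' (𝕂 := ℝ) A t)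
  simpa using h.clm_apply (hasDerivAt_const t f)

/-- The derivative of `‖e^{sA} f‖²` is `2⟨A e^{sA} f, e^{sA} f⟩ ≤ 0`. -/
theorem norm_exp_smul_le_one {A : H →L[ℝ] H} (hA : ∀ f, inner ℝ (A f) f ≤ 0) {t : ℝ}
    (ht : 0 ≤ t) : ‖NormedSpace.exp (t • A)‖ ≤ 1 := by
  refine ContinuousLinearMap.opNorm_le_bound _ zero_le_one fun f => ?_
  have hd := fun s => (hasDerivAt_exp_smul_apply A f s).norm_sq
  have hanti : Antitone fun s : ℝ => ‖NormedSpace.exp (s • A) f‖ ^ 2 := by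
    refine antitone_of_deriv_nonpos (fun s => (hd s).differentiableAt) fun s => ?_
    rw [(hd s).deriv, real_inner_comm]
    have := hA (NormedSpace.exp (s • A) f)
    linarith
  have := hanti ht
  simp only [zero_smul, NormedSpace.exp_zero, one_apply_eq_self] at this
  rw [one_mul]
  exact (sq_le_sq₀ (norm_nonneg _) (norm_nonneg _)).1 this

/-- Duhamel: `F(s) = e^{(t-s)B} e^{sA} f` runs from `e^{tB} f` to `e^{tA} f`, and commutation turns
`F'(s)` into two contractions applied to `A f - B f`. -/
theorem norm_exp_smul_sub_exp_smul_le {A B : H →L[ℝ] H} (hA : ∀ f, inner ℝ (A f) f ≤ 0)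
    (hB : ∀ f, inner ℝ (B f) f ≤ 0) (hAB : Commute A B) {t : ℝ} (ht : 0 ≤ t) (f : H) :
    ‖NormedSpace.exp (t • A) f - NormedSpace.exp (t • B) f‖ ≤ t * ‖A f - B f‖ := by
  set F : ℝ → H := fun s => NormedSpace.exp ((t - s) • B) (NormedSpace.exp (s • A) f)
  have hd : ∀ s, HasDerivAt F
      (NormedSpace.exp ((t - s) • B) (NormedSpace.exp (s • A) (A f - B f))) s := by
    intro s
    have h1 := (hasDerivAt_exp_smul_const' (𝕂 := ℝ) B (t - s)).scomp s
      ((hasDerivAt_id s).const_sub t)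
    have h2 := h1.clm_apply (hasDerivAt_exp_smul_apply A f s)
    refine h2.congr_deriv ?_
    have c1 : B * NormedSpace.exp ((t - s) • B) = NormedSpace.exp ((t - s) • B) * B :=
      (((Commute.refl B).smul_right (t - s)).exp_right).eq
    have c2 : A * NormedSpace.exp (s • A) = NormedSpace.exp (s • A) * A :=
      (((Commute.refl A).smul_right s).exp_right).eq
    have c3 : B * NormedSpace.exp (s • A) = NormedSpace.exp (s • A) * B :=
      ((hAB.symm.smul_right s).exp_right).eq
    have e2 : A (NormedSpace.exp (s • A) f) = NormedSpace.exp (s • A) (A f) :=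
      congrArg (fun T : H →L[ℝ] H => T f) c2
    have e3 : B (NormedSpace.exp (s • A) f) = NormedSpace.exp (s • A) (B f) :=
      congrArg (fun T : H →L[ℝ] H => T f) c3
    simp only [neg_smul, one_smul, c1, neg_apply, mul_apply_eq_comp,
      map_sub, e2, e3, Function.comp]
    abel
  have hb := norm_image_sub_le_of_norm_deriv_le_segment' (a := 0) (b := t)
    (C := ‖A f - B f‖) (fun s _ => (hd s).hasDerivWithinAt) (fun s hs => by
      have h1 := norm_exp_smul_le_one hB (sub_nonneg.2 hs.2.le)
      have h2 := norm_exp_smul_le_one hA hs.1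
      refine (ContinuousLinearMap.le_of_opNorm_le _ h1 _).trans ?_
      rw [one_mul]
      exact (ContinuousLinearMap.le_of_opNorm_le _ h2 _).trans_eq (one_mul _)) t ⟨ht, le_rfl⟩
  simpa [F, mul_comm] using hb

end DissipativeExp

/-! ### The Hille–Yosida theorem for m-dissipative relations. -/

/-- A dissipative linear relation on a real Hilbert space, given by its graph, all of whose
resolvent equations `f - r g = h`, `0 < r ≤ 1`, are solvable, and whose domain is dense. -/
structure IsMDissipative {H : Type*} [NormedAddCommGroup H] [InnerProductSpace ℝ H]
    (L : Submodule ℝ (H × H)) : Prop where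
  inner_le : ∀ p ∈ L, inner ℝ p.2 p.1 ≤ 0
  exists_sub_smul : ∀ r : ℝ, 0 < r → r ≤ 1 → ∀ h, ∃ p ∈ L, p.1 - r • p.2 = h
  dense : Dense (Prod.fst '' (L : Set (H × H)))

namespace IsMDissipative

variable {H : Type*} [NormedAddCommGroup H] [InnerProductSpace ℝ H]
  {L : Submodule ℝ (H × H)}

/-- In the expanded square the cross term `-2r⟨g, f⟩` is non-negative. This makes resolvent
equations uniquely solvable and the resolvent a contraction. -/
theorem norm_fst_le (hL : IsMDissipative L) {r : ℝ} (hr : 0 ≤ r) {p : H × H} (hp : p ∈ L) :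
    ‖p.1‖ ≤ ‖p.1 - r • p.2‖ := by
  have h1 := hL.inner_le p hp
  have h2 := norm_sub_sq_real p.1 (r • p.2)
  rw [real_inner_smul_right, real_inner_comm] at h2
  refine (sq_le_sq₀ (norm_nonneg _) (norm_nonneg _)).1 ?_
  nlinarith [sq_nonneg ‖r • p.2‖, mul_nonpos_of_nonneg_of_nonpos hr h1]

theorem exists_resolvent (hL : IsMDissipative L) {r : ℝ} (hr : 0 < r) (hr1 : r ≤ 1) :
    ∃ R : H →L[ℝ] H, ‖R‖ ≤ 1 ∧ (∀ h, (R h, r⁻¹ • (R h - h)) ∈ L) ∧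
      ∀ f g, (f, g) ∈ L → R (f - r • g) = f := by
  choose p hpL hp using hL.exists_sub_smul r hr hr1
  have huniq : ∀ q ∈ L, ∀ h, q.1 - r • q.2 = h → q.1 = (p h).1 := by
    intro q hq h hqh
    have := hL.norm_fst_le hr.le (L.sub_mem hq (hpL h))
    have h0 : (q - p h).1 - r • (q - p h).2 = 0 := by
      have : (q - p h).1 - r • (q - p h).2 = (q.1 - r • q.2) - ((p h).1 - r • (p h).2) := by
        simp only [Prod.fst_sub, Prod.snd_sub, smul_sub]; abel
      rw [this, hqh, hp, sub_self]
    rw [h0, norm_zero, norm_le_zero_iff] at this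
    exact sub_eq_zero.1 this
  have hsnd : ∀ h, r⁻¹ • ((p h).1 - h) = (p h).2 := fun h => by
    have : (p h).1 - h = r • (p h).2 := by
      nth_rw 2 [← hp h]; abel
    rw [this, inv_smul_smul₀ hr.ne']
  let R₀ : H →ₗ[ℝ] H :=
    { toFun := fun h => (p h).1
      map_add' := fun a b => by
        refine (huniq _ (L.add_mem (hpL a) (hpL b)) _ ?_).symm
        nth_rw 3 [← hp a]; nth_rw 3 [← hp b]
        simp only [Prod.fst_add, Prod.snd_add, smul_add]; abel
      map_smul' := fun c a => by
        refine (huniq _ (L.smul_mem c (hpL a)) _ ?_).symm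
        nth_rw 3 [← hp a]
        simp only [Prod.smul_fst, Prod.smul_snd, smul_sub, smul_comm r c] }
  have hb : ∀ h, ‖R₀ h‖ ≤ 1 * ‖h‖ := fun h => by
    have := hL.norm_fst_le hr.le (hpL h)
    rw [hp] at this
    rwa [one_mul]
  refine ⟨R₀.mkContinuous 1 hb, LinearMap.mkContinuous_norm_le _ zero_le_one _, fun h => ?_,
    fun f g hfg => ?_⟩
  · have : (R₀.mkContinuous 1 hb) h = (p h).1 := rfl
    rw [this, hsnd]
    exact hpL h
  · exact (huniq _ hfg _ rfl).symm

/-- `R` maps the graph `L` into itself. The image under `R` of the pair `(S f, s⁻¹(S f - f)) ∈ L`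
solves the resolvent equation of `S` with right-hand side `R f`, whence `S R f = R S f`. -/
theorem commute_resolvent {r s : ℝ} (hr : 0 < r) {R S : H →L[ℝ] H}
    (hR : ∀ h, (R h, r⁻¹ • (R h - h)) ∈ L) (hR' : ∀ f g, (f, g) ∈ L → R (f - r • g) = f)
    (hs : 0 < s) (hS : ∀ h, (S h, s⁻¹ • (S h - h)) ∈ L)
    (hS' : ∀ f g, (f, g) ∈ L → S (f - s • g) = f) : Commute R S := by
  have hRmem : ∀ f g, (f, g) ∈ L → (R f, R g) ∈ L := by
    intro f g hfg
    have h1 := hR f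
    have h2 : R f - f = r • R g := by
      have := hR' f g hfg
      rw [map_sub, map_smul, sub_eq_iff_eq_add] at this
      rw [this]; abel
    rwa [h2, inv_smul_smul₀ hr.ne'] at h1
  have : ∀ f, R (S f) = S (R f) := by
    intro f
    have := hS' _ _ (hRmem _ _ (hS f))
    have e : R (S f) - s • R (s⁻¹ • (S f - f)) = R f := by
      rw [map_smul, map_sub, smul_inv_smul₀ hs.ne', sub_sub_cancel]
    rw [e] at this
    exact this.symm
  exact ContinuousLinearMap.ext this

/-- The Yosida approximations of an m-dissipative relation. -/
theorem exists_yosida (hL : IsMDissipative L) :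
    ∃ A : ℕ → H →L[ℝ] H, (∀ n f, inner ℝ (A n f) f ≤ 0) ∧ (∀ m n, Commute (A m) (A n)) ∧
      ∀ f g, (f, g) ∈ L → Tendsto (fun n => A n f) atTop (𝓝 g) := by
  have hr : ∀ n : ℕ, (0 : ℝ) < 1 / (n + 1) := fun n => by positivity
  have hr1 : ∀ n : ℕ, (1 : ℝ) / (n + 1) ≤ 1 := fun n => by
    rw [div_le_one (by positivity)]; linarith [(Nat.cast_nonneg n : (0 : ℝ) ≤ n)]
  choose R hR1 hRL hRinv using fun n : ℕ => hL.exists_resolvent (hr n) (hr1 n)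
  set r : ℕ → ℝ := fun n => 1 / ((n : ℝ) + 1) with hrdef
  have hr0 : Tendsto r atTop (𝓝 0) := tendsto_one_div_add_atTop_nhds_zero_nat
  have hle : ∀ n f, ‖R n f‖ ≤ ‖f‖ := fun n f =>
    ((R n).le_of_opNorm_le (hR1 n) f).trans_eq (one_mul _)
  have hAL : ∀ n f g, (f, g) ∈ L → (r n)⁻¹ • (R n f - f) = R n g := by
    intro n f g hfg
    have h := hRinv n f g hfg
    rw [map_sub, map_smul, sub_eq_iff_eq_add] at h
    have h2 : R n f - f = r n • R n g := by rw [h, add_sub_cancel_left]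
    rw [h2, inv_smul_smul₀ (hr n).ne']
  have hRid : ∀ g, Tendsto (fun n => R n g) atTop (𝓝 g) := by
    refine fun g => tendsto_apply_of_dense (S := ContinuousLinearMap.id ℝ H) hR1
      ContinuousLinearMap.norm_id_le hL.dense ?_ g
    rintro f ⟨⟨f, g⟩, hfg, rfl⟩
    rw [tendsto_iff_norm_sub_tendsto_zero]
    refine squeeze_zero (fun _ => norm_nonneg _) (fun n => ?_)
      (by simpa using hr0.mul_const ‖g‖ : Tendsto (fun n => r n * ‖g‖) atTop (𝓝 0))
    have : R n f - f = r n • R n g := by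
      rw [← hAL n f g hfg, smul_inv_smul₀ (hr n).ne']
    simp only [ContinuousLinearMap.id_apply]
    rw [this, norm_smul, Real.norm_of_nonneg (hr n).le]
    exact mul_le_mul_of_nonneg_left (hle n g) (hr n).le
  refine ⟨fun n => (r n)⁻¹ • (R n - 1), fun n f => ?_, fun m n => ?_, fun f g hfg => ?_⟩
  · simp only [smul_apply, sub_apply, one_apply_eq_self, inner_smul_left, inner_sub_left]
    have h1 : inner ℝ (R n f) f ≤ ‖f‖ * ‖f‖ :=
      (real_inner_le_norm _ _).trans (mul_le_mul_of_nonneg_right (hle n f) (norm_nonneg _))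
    rw [real_inner_self_eq_norm_mul_norm]
    exact mul_nonpos_of_nonneg_of_nonpos (inv_nonneg.2 (hr n).le) (sub_nonpos.2 h1)
  · have hc : Commute (R m) (R n) :=
      commute_resolvent (hr m) (hRL m) (hRinv m) (hr n) (hRL n) (hRinv n)
    exact (((hc.sub_left (Commute.one_left _)).sub_right (Commute.one_right _)).smul_left
      _).smul_right _
  · refine (hRid g).congr fun n => ?_
    simpa using (hAL n f g hfg).symm

variable [CompleteSpace H]

/-- The **Hille–Yosida theorem** on real Hilbert spaces. -/
theorem exists_semigroup (hL : IsMDissipative L) :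
    ∃ P : ℝ≥0 → H →L[ℝ] H, IsC0Semigroup P ∧
      ∀ f g, HasInfinitesimalGenerator P f g ↔ (f, g) ∈ L := by
  obtain ⟨A, hA, hcomm, hAt⟩ := hL.exists_yosida
  set E : ℕ → ℝ≥0 → H →L[ℝ] H := fun n t => NormedSpace.exp ((t : ℝ) • A n) with hE
  have hE1 : ∀ n t, ‖E n t‖ ≤ 1 := fun n t => norm_exp_smul_le_one (hA n) t.2
  have hdiff : ∀ m n t f, ‖E m t f - E n t f‖ ≤ t * ‖A m f - A n f‖ := fun m n t f =>
    norm_exp_smul_sub_exp_smul_le (hA m) (hA n) (hcomm m n) t.2 f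
  have hdiff0 : ∀ n t f, ‖E n t f - f‖ ≤ t * ‖A n f‖ := fun n t f => by
    simpa using norm_exp_smul_sub_exp_smul_le (B := 0) (hA n) (by simp) (Commute.zero_right _) t.2 f
  have hcau : ∀ t f, CauchySeq fun n => E n t f := by
    refine fun t f => cauchySeq_apply_of_dense (fun n => hE1 n t) hL.dense ?_ f
    rintro f ⟨⟨f, g⟩, hfg, rfl⟩
    rw [Metric.cauchySeq_iff]
    intro ε hε
    obtain ⟨N, hN⟩ := Metric.cauchySeq_iff.1 (hAt f g hfg).cauchySeq (ε / (t + 1)) (by positivity)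
    refine ⟨N, fun m hm n hn => ?_⟩
    have h1 := hN m hm n hn
    rw [dist_eq_norm, lt_div_iff₀ (by positivity)] at h1
    rw [dist_eq_norm]
    nlinarith [hdiff m n t f, norm_nonneg (A m f - A n f)]
  choose p hp using fun t f => cauchySeq_tendsto_of_complete (hcau t f)
  have hple : ∀ t f, ‖p t f‖ ≤ 1 * ‖f‖ := fun t f =>
    le_of_tendsto (hp t f).norm (Eventually.of_forall fun n => (E n t).le_of_opNorm_le (hE1 n t) f)
  let P : ℝ≥0 → H →L[ℝ] H := fun t =>
    LinearMap.mkContinuous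
      { toFun := p t
        map_add' := fun f g => tendsto_nhds_unique (hp t (f + g))
          (((hp t f).add (hp t g)).congr fun n => (map_add _ _ _).symm)
        map_smul' := fun c f => tendsto_nhds_unique (hp t (c • f))
          (((hp t f).const_smul c).congr fun n => (map_smul _ _ _).symm) } 1 (hple t)
  have hPt : ∀ t f, Tendsto (fun n => E n t f) atTop (𝓝 (P t f)) := hp
  have hP1 : ∀ t, ‖P t‖ ≤ 1 := fun t => LinearMap.mkContinuous_norm_le _ zero_le_one _
  have hPE : ∀ n t f g, (f, g) ∈ L → ‖P t f - E n t f‖ ≤ t * ‖g - A n f‖ := by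
    intro n t f g hfg
    exact le_of_tendsto_of_tendsto ((hPt t f).sub_const _).norm
      ((((hAt f g hfg).sub_const _).norm).const_mul _) (Eventually.of_forall fun m => hdiff m n t f)
  have hP0 : ∀ t f g, (f, g) ∈ L → ‖P t f - f‖ ≤ t * ‖g‖ := by
    intro t f g hfg
    exact le_of_tendsto_of_tendsto ((hPt t f).sub_const _).norm
      (((hAt f g hfg).norm).const_mul _) (Eventually.of_forall fun m => hdiff0 m t f)
  have hsemi : IsC0Semigroup P := by
    refine ⟨?_, fun s t => ?_, fun f => ?_⟩
    · ext1 f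
      refine tendsto_nhds_unique (hPt 0 f) ?_
      simp [hE]
    · ext1 f
      refine tendsto_nhds_unique (hPt (s + t) f) ?_
      have hadd : ∀ n, E n (s + t) f = E n s (E n t f) := fun n => by
        have : ((s + t : ℝ≥0) : ℝ) • A n = (s : ℝ) • A n + (t : ℝ) • A n := by
          push_cast; rw [add_smul]
        let _ : NormedAlgebra ℚ (H →L[ℝ] H) := NormedAlgebra.restrictScalars ℚ ℝ _
        simp only [hE, this]
        rw [NormedSpace.exp_add_of_commute
          (((Commute.refl (A n)).smul_left _).smul_right _), mul_apply_eq_comp]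
      simp only [hadd, ContinuousLinearMap.comp_apply]
      rw [tendsto_iff_norm_sub_tendsto_zero]
      have h1 : Tendsto (fun n => ‖E n t f - P t f‖ + ‖E n s (P t f) - P s (P t f)‖) atTop (𝓝 0) := by
        simpa using (tendsto_iff_norm_sub_tendsto_zero.1 (hPt t f)).add
          (tendsto_iff_norm_sub_tendsto_zero.1 (hPt s (P t f)))
      refine squeeze_zero (fun _ => norm_nonneg _) (fun n => ?_) h1
      have h2 : ‖E n s (E n t f) - E n s (P t f)‖ ≤ ‖E n t f - P t f‖ := by
        rw [← map_sub]
        exact ((E n s).le_of_opNorm_le (hE1 n s) _).trans_eq (one_mul _)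
      have := norm_sub_le_norm_sub_add_norm_sub (E n s (E n t f)) (E n s (P t f)) (P s (P t f))
      linarith
    · refine tendsto_apply_of_dense (S := ContinuousLinearMap.id ℝ H) hP1
        ContinuousLinearMap.norm_id_le hL.dense ?_ f
      rintro f ⟨⟨f, g⟩, hfg, rfl⟩
      rw [tendsto_iff_norm_sub_tendsto_zero]
      have hc : Tendsto (fun t : ℝ≥0 => (t : ℝ) * ‖g‖) (𝓝 0) (𝓝 0) := by
        have : Continuous fun t : ℝ≥0 => (t : ℝ) * ‖g‖ := by fun_prop
        simpa using this.tendsto 0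
      exact squeeze_zero (fun _ => norm_nonneg _) (fun t => hP0 t f g hfg) hc
  have hext : ∀ f g, (f, g) ∈ L → HasInfinitesimalGenerator P f g := by
    intro f g hfg
    rw [HasInfinitesimalGenerator, Metric.tendsto_nhds]
    intro ε hε
    -- The difference quotients of `P` and `E n` differ by at most `‖g - A n f‖`, uniformly in `t`;
    -- so `n` is fixed before `t → 0`.
    obtain ⟨n, hn⟩ := ((tendsto_iff_norm_sub_tendsto_zero.1 (hAt f g hfg)).eventually
      (gt_mem_nhds (by positivity : 0 < ε / 3))).exists
    have hd : Tendsto (fun t : ℝ≥0 => (t : ℝ)⁻¹ • (E n t f - f)) (𝓝[>] 0) (𝓝 (A n f)) := by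
      have h0 := (hasDerivAt_exp_smul_apply (A n) f 0).hasDerivWithinAt (s := Set.Ici 0)
      rw [hasDerivWithinAt_iff_tendsto_slope, Set.Ici_sdiff_left] at h0
      have hc : Tendsto (fun t : ℝ≥0 => (t : ℝ)) (𝓝[>] 0) (𝓝[>] 0) := by
        refine tendsto_nhdsWithin_iff.2 ⟨?_, ?_⟩
        · exact (NNReal.continuous_coe.tendsto 0).mono_left nhdsWithin_le_nhds
        · filter_upwards [self_mem_nhdsWithin] with s hs
          exact_mod_cast hs
      have := h0.comp hc
      simpa [slope, hE, Function.comp_def] using this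
    filter_upwards [Metric.tendsto_nhds.1 hd (ε / 3) (by positivity), self_mem_nhdsWithin]
      with t ht ht0
    have ht0' : (0 : ℝ) < t := by exact_mod_cast ht0
    have h1 : dist ((t : ℝ)⁻¹ • (P t f - f)) ((t : ℝ)⁻¹ • (E n t f - f)) ≤ ‖A n f - g‖ := by
      rw [dist_eq_norm, ← smul_sub, sub_sub_sub_cancel_right, norm_smul, norm_inv,
        Real.norm_of_nonneg ht0'.le, inv_mul_le_iff₀ ht0', norm_sub_rev (A n f)]
      exact hPE n t f g hfg
    have h2 : dist (A n f) g = ‖A n f - g‖ := dist_eq_norm _ _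
    have := dist_triangle4 ((t : ℝ)⁻¹ • (P t f - f)) ((t : ℝ)⁻¹ • (E n t f - f)) (A n f) g
    linarith
  refine ⟨P, hsemi, fun f g => ⟨fun hfg => ?_, hext f g⟩⟩
  -- Maximality: with `f' - g' = f - g`, the generator sends `f - f'` to itself, and since `P` is
  -- contractive its generator is dissipative, which forces `f = f'`.
  obtain ⟨⟨f', g'⟩, hL', he⟩ := hL.exists_sub_smul 1 one_pos le_rfl (f - g)
  simp only [one_smul] at he
  have hsub : Tendsto (fun t : ℝ≥0 => (t : ℝ)⁻¹ • (P t (f - f') - (f - f'))) (𝓝[>] 0)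
      (𝓝 (g - g')) := by
    refine (Tendsto.sub hfg (hext f' g' hL')).congr fun t => ?_
    rw [← smul_sub, map_sub]; congr 1; abel
  have hle : inner ℝ (g - g') (f - f') ≤ 0 := by
    refine le_of_tendsto (hsub.inner tendsto_const_nhds) (Eventually.of_forall fun t => ?_)
    rw [real_inner_smul_left, inner_sub_left, real_inner_self_eq_norm_mul_norm]
    refine mul_nonpos_of_nonneg_of_nonpos (by positivity) (sub_nonpos.2 ?_)
    refine (real_inner_le_norm _ _).trans (mul_le_mul_of_nonneg_right ?_ (norm_nonneg _))
    exact ((P t).le_of_opNorm_le (hP1 t) _).trans_eq (one_mul _)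
  have heq : g - g' = f - f' := by
    rw [sub_eq_sub_iff_add_eq_add] at he ⊢
    rw [add_comm g, he]
  rw [heq, real_inner_self_nonpos, sub_eq_zero] at hle
  rw [hle, sub_self, sub_eq_zero] at heq
  rw [hle, heq]
  exact hL'

end IsMDissipative

namespace WeightedGraph

variable {V : Type*} (G : WeightedGraph V)

/-! ### Pointwise calculus of `Δ` and `Γ`. -/

section PointwiseCalculus

theorem mem_nbrs {x y : V} : y ∈ G.nbrs x ↔ G.graph.Adj x y := by simp [nbrs]

theorem mem_nbrs_comm {x y : V} : y ∈ G.nbrs x ↔ x ∈ G.nbrs y := by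
  rw [mem_nbrs, mem_nbrs, SimpleGraph.adj_comm]

theorem μ_nonneg (x y : V) : 0 ≤ G.μ x y := by
  by_cases h : G.graph.Adj x y
  · exact (G.μ_pos x y h).le
  · exact (G.μ_eq_zero x y h).ge

theorem μ_eq_zero_of_notMem {x y : V} (h : y ∉ G.nbrs x) : G.μ x y = 0 :=
  G.μ_eq_zero x y (by rwa [mem_nbrs] at h)

theorem m_mul_laplacian (f : V → ℝ) (x : V) :
    G.m x * G.laplacian f x = ∑ y ∈ G.nbrs x, G.μ x y * (f y - f x) := by
  rw [laplacian, ← mul_assoc, mul_one_div_cancel (G.m_pos x).ne', one_mul]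

theorem laplacian_add (f g : V → ℝ) : G.laplacian (f + g) = G.laplacian f + G.laplacian g := by
  funext x
  simp only [laplacian, Pi.add_apply, ← mul_add, ← Finset.sum_add_distrib]
  congr 1
  exact Finset.sum_congr rfl fun y _ => by ring

theorem laplacian_smul (c : ℝ) (f : V → ℝ) : G.laplacian (c • f) = c • G.laplacian f := by
  funext x
  simp only [laplacian, Pi.smul_apply, smul_eq_mul, Finset.mul_sum]
  exact Finset.sum_congr rfl fun y _ => by ring

theorem Gamma_apply (f g : V → ℝ) (x : V) :
    G.Gamma f g x = 1 / (2 * G.m x) * ∑ y ∈ G.nbrs x, G.μ x y * ((f y - f x) * (g y - g x)) := by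
  simp only [Gamma, laplacian, Pi.mul_apply, Finset.mul_sum, ← Finset.sum_sub_distrib]
  exact Finset.sum_congr rfl fun y _ => by
    have := (G.m_pos x).ne'
    field_simp
    ring

theorem two_mul_m_mul_Gamma (f g : V → ℝ) (x : V) :
    2 * G.m x * G.Gamma f g x = ∑ y ∈ G.nbrs x, G.μ x y * ((f y - f x) * (g y - g x)) := by
  rw [Gamma_apply, ← mul_assoc, mul_one_div_cancel, one_mul]
  exact mul_ne_zero two_ne_zero (G.m_pos x).ne'

theorem Gamma_self_nonneg (f : V → ℝ) (x : V) : 0 ≤ G.Gamma f f x := by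
  rw [Gamma_apply]
  have := G.m_pos x
  exact mul_nonneg (by positivity)
    (Finset.sum_nonneg fun y _ => mul_nonneg (G.μ_nonneg x y) (mul_self_nonneg _))

theorem neg_two_mul_Gamma_le (f g : V → ℝ) (x : V) :
    -(2 * G.Gamma f g x) ≤ G.Gamma f f x + G.Gamma g g x := by
  have := G.m_pos x
  have h : G.Gamma f f x + G.Gamma g g x + 2 * G.Gamma f g x =
      1 / (2 * G.m x) * ∑ y ∈ G.nbrs x, G.μ x y * ((f y - f x) + (g y - g x)) ^ 2 := by
    simp only [Gamma_apply, Finset.mul_sum, ← Finset.sum_add_distrib]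
    exact Finset.sum_congr rfl fun y _ => by ring
  have h2 : 0 ≤ G.Gamma f f x + G.Gamma g g x + 2 * G.Gamma f g x := by
    rw [h]
    exact mul_nonneg (by positivity)
      (Finset.sum_nonneg fun y _ => mul_nonneg (G.μ_nonneg x y) (sq_nonneg _))
  linarith

theorem laplacian_mul (f g : V → ℝ) (x : V) :
    G.laplacian (f * g) x = f x * G.laplacian g x + g x * G.laplacian f x + 2 * G.Gamma f g x := by
  rw [Gamma]; ring

theorem laplacian_congr {f g : V → ℝ} {x : V} (hx : f x = g x) (h : ∀ y ∈ G.nbrs x, f y = g y) :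
    G.laplacian f x = G.laplacian g x := by
  rw [laplacian, laplacian, hx]
  congr 1
  exact Finset.sum_congr rfl fun y hy => by rw [h y hy]

theorem Gamma_congr {f f' g g' : V → ℝ} {x : V} (hx : f x = f' x) (hx' : g x = g' x)
    (h : ∀ y ∈ G.nbrs x, f y = f' y) (h' : ∀ y ∈ G.nbrs x, g y = g' y) :
    G.Gamma f g x = G.Gamma f' g' x := by
  rw [Gamma_apply, Gamma_apply, hx, hx']
  congr 1
  exact Finset.sum_congr rfl fun y hy => by rw [h y hy, h' y hy]

theorem finite_support_laplacian {f : V → ℝ} (hf : f.support.Finite) :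
    (G.laplacian f).support.Finite := by
  refine (hf.union (hf.biUnion fun y _ => G.locallyFinite y)).subset fun x hx => ?_
  by_contra h
  simp only [Set.mem_union, Set.mem_iUnion, not_or, not_exists] at h
  have hx0 : f x = 0 := by simpa using h.1
  refine hx ?_
  rw [laplacian, Finset.sum_eq_zero, mul_zero]
  intro y hy
  have hy0 : f y = 0 := by
    by_contra hne
    exact h.2 y hne ((G.mem_nbrs.1 hy).symm)
  simp [hx0, hy0]

end PointwiseCalculus

/-! ### Finite double sums and Green's formula. -/

section FiniteSums

/-- The sum of `μ_{xy} F(x, y)` over all pairs of vertices of a finite set. -/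
noncomputable def pairSum (S : Finset V) (F : V → V → ℝ) : ℝ :=
  ∑ x ∈ S, ∑ y ∈ S, G.μ x y * F x y

variable {G}

theorem pairSum_mono (S : Finset V) {F F' : V → V → ℝ} (h : ∀ x y, F x y ≤ F' x y) :
    G.pairSum S F ≤ G.pairSum S F' :=
  Finset.sum_le_sum fun x _ => Finset.sum_le_sum fun y _ =>
    mul_le_mul_of_nonneg_left (h x y) (G.μ_nonneg x y)

theorem pairSum_add (S : Finset V) (F F' : V → V → ℝ) :
    G.pairSum S (fun x y => F x y + F' x y) = G.pairSum S F + G.pairSum S F' := by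
  simp only [pairSum, mul_add, Finset.sum_add_distrib]

theorem pairSum_const_mul (S : Finset V) (c : ℝ) (F : V → V → ℝ) :
    G.pairSum S (fun x y => c * F x y) = c * G.pairSum S F := by
  simp only [pairSum, Finset.mul_sum]
  exact Finset.sum_congr rfl fun x _ => Finset.sum_congr rfl fun y _ => by ring

theorem pairSum_sub (S : Finset V) (F F' : V → V → ℝ) :
    G.pairSum S (fun x y => F x y - F' x y) = G.pairSum S F - G.pairSum S F' := by
  simp only [pairSum, mul_sub, Finset.sum_sub_distrib]

theorem pairSum_swap (S : Finset V) (F : V → V → ℝ) :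
    G.pairSum S (fun x y => F y x) = G.pairSum S F := by
  rw [pairSum, Finset.sum_comm, pairSum]
  exact Finset.sum_congr rfl fun x _ => Finset.sum_congr rfl fun y _ => by rw [G.μ_symm]

theorem pairSum_symmetrize (S : Finset V) (a : V → ℝ) (F : V → V → ℝ)
    (hF : ∀ x y, F x y = F y x) :
    G.pairSum S (fun x y => (a x + a y) * F x y) = 2 * G.pairSum S fun x y => a x * F x y := by
  have h := pairSum_swap (G := G) S fun x y => a x * F x y
  rw [two_mul]
  nth_rw 2 [← h]
  rw [← pairSum_add]
  congr 1; funext x y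
  rw [hF y x]; ring

/-- Symmetrizing in `x` and `y`. No boundary terms occur because both sums stay inside `S`. -/
theorem sum_mul_sum_sub (S : Finset V) (a b : V → ℝ) :
    ∑ x ∈ S, a x * ∑ y ∈ S, G.μ x y * (b y - b x) =
      -(1 / 2) * G.pairSum S fun x y => (a y - a x) * (b y - b x) := by
  have h1 : ∑ x ∈ S, a x * ∑ y ∈ S, G.μ x y * (b y - b x) =
      G.pairSum S fun x y => a x * (b y - b x) := by
    rw [pairSum]
    refine Finset.sum_congr rfl fun x _ => ?_
    rw [Finset.mul_sum]
    exact Finset.sum_congr rfl fun y _ => by ring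
  have h2 := pairSum_swap (G := G) S fun x y => a x * (b y - b x)
  have h3 : (G.pairSum S fun x y => (a y - a x) * (b y - b x)) =
      -(G.pairSum S fun x y => a x * (b y - b x)) - G.pairSum S fun x y => a y * (b x - b y) := by
    rw [← neg_one_mul, ← pairSum_const_mul, ← pairSum_sub]
    congr 1; funext x y; ring
  rw [h1, h3, h2]; ring

variable (G) in
/-- The finite set `S` contains the support of `p` and all its neighbors. -/
def Covers (S : Finset V) (p : V → ℝ) : Prop := ∀ x, p x ≠ 0 → x ∈ S ∧ G.nbrs x ⊆ S

open Classical in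
variable (G) in
theorem exists_covers {p : V → ℝ} (hp : p.support.Finite) : ∃ S : Finset V, G.Covers S p :=
  ⟨hp.toFinset ∪ hp.toFinset.biUnion G.nbrs, fun x hx =>
    ⟨Finset.mem_union_left _ (by simpa using hx), fun y hy => Finset.mem_union_right _
      (Finset.mem_biUnion.2 ⟨x, by simpa using hx, hy⟩)⟩⟩

theorem Covers.of_eq_zero {S : Finset V} {p q : V → ℝ} (h : G.Covers S p)
    (hq : ∀ x, p x = 0 → q x = 0) : G.Covers S q :=
  fun x hx => h x fun h0 => hx (hq x h0)

theorem Covers.mono {S T : Finset V} {p : V → ℝ} (h : G.Covers S p) (hST : S ⊆ T) :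
    G.Covers T p :=
  fun x hx => ⟨hST (h x hx).1, (h x hx).2.trans hST⟩

theorem Covers.eq_zero {S : Finset V} {p : V → ℝ} (h : G.Covers S p) {x : V} (hx : x ∉ S) :
    p x = 0 := by
  by_contra h0
  exact hx (h x h0).1

theorem Covers.eq_zero_of_mem_nbrs {S : Finset V} {p : V → ℝ} (h : G.Covers S p) {x y : V}
    (hx : x ∉ S) (hy : y ∈ G.nbrs x) : p y = 0 := by
  by_contra h0
  exact hx ((h y h0).2 (G.mem_nbrs_comm.1 hy))

open Classical in
theorem sum_nbrs_eq (x : V) (S : Finset V) (F : V → ℝ)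
    (h : ∀ y ∈ G.nbrs x, y ∉ S → F y = 0) :
    ∑ y ∈ G.nbrs x, G.μ x y * F y = ∑ y ∈ S, G.μ x y * F y := by
  refine (Finset.sum_subset (Finset.subset_union_left (s₂ := S)) fun y _ hy => ?_).trans
    (Finset.sum_subset (Finset.subset_union_right (s₁ := G.nbrs x)) fun y hy hyS => ?_).symm
  · rw [G.μ_eq_zero_of_notMem hy, zero_mul]
  · rcases Finset.mem_union.1 hy with hy | hy
    · rw [h y hy hyS, mul_zero]
    · exact absurd hy hyS

/-- **Green's formula** for a finitely supported `p`. -/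
theorem Covers.sum_mul_laplacian {S : Finset V} {p : V → ℝ} (h : G.Covers S p) (v : V → ℝ) :
    ∑ x ∈ S, G.m x * p x * G.laplacian v x =
      -(1 / 2) * G.pairSum S fun x y => (p y - p x) * (v y - v x) := by
  rw [← sum_mul_sum_sub]
  refine Finset.sum_congr rfl fun x _ => ?_
  by_cases hx : p x = 0
  · simp [hx]
  · rw [mul_right_comm, m_mul_laplacian, mul_comm, sum_nbrs_eq x S]
    exact fun y hy hyS => absurd ((h x hx).2 hy) hyS

/-- Now vertices of `S` may have neighbors outside `S`, but across such an edge `p` vanishes at both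
ends: at the outer one since `S` contains the support, at the inner one since `S` contains all
neighbors of the support. -/
theorem Covers.sum_laplacian_mul {S : Finset V} {p : V → ℝ} (h : G.Covers S p) (v : V → ℝ) :
    ∑ x ∈ S, G.m x * v x * G.laplacian p x =
      -(1 / 2) * G.pairSum S fun x y => (p y - p x) * (v y - v x) := by
  have : (fun x y => (p y - p x) * (v y - v x)) = fun x y => (v y - v x) * (p y - p x) := by
    funext x y; ring
  rw [this, ← sum_mul_sum_sub]
  refine Finset.sum_congr rfl fun x _ => ?_
  rw [mul_right_comm, m_mul_laplacian, mul_comm, sum_nbrs_eq x S]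
  intro y hy hyS
  have hpx : p x = 0 := by
    by_contra h0
    exact hyS ((h x h0).2 hy)
  rw [h.eq_zero hyS, hpx, sub_zero]

/-- Edges leaving `S` are counted on the right only, hence an inequality. -/
theorem pairSum_mul_sq_le (S : Finset V) {a : V → ℝ} (ha : ∀ x, 0 ≤ a x) (u : V → ℝ) :
    (G.pairSum S fun x y => a x * (u y - u x) ^ 2) ≤ 2 * ∑ x ∈ S, G.m x * a x * G.Gamma u u x := by
  rw [pairSum, Finset.mul_sum]
  refine Finset.sum_le_sum fun x _ => ?_
  have h1 : 2 * (G.m x * a x * G.Gamma u u x) = a x * (2 * G.m x * G.Gamma u u x) := by ring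
  rw [h1, two_mul_m_mul_Gamma, Finset.mul_sum]
  classical
  have h2 : ∑ y ∈ S, G.μ x y * (a x * (u y - u x) ^ 2) =
      ∑ y ∈ S ∩ G.nbrs x, G.μ x y * (a x * (u y - u x) ^ 2) := by
    refine (Finset.sum_subset Finset.inter_subset_left fun y hy hy' => ?_).symm
    rw [G.μ_eq_zero_of_notMem fun h => hy' (Finset.mem_inter.2 ⟨hy, h⟩), zero_mul]
  rw [h2]
  have h3 : ∀ y, G.μ x y * (a x * (u y - u x) ^ 2) =
      a x * (G.μ x y * ((u y - u x) * (u y - u x))) := fun y => by ring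
  simp only [h3]
  exact Finset.sum_le_sum_of_subset_of_nonneg Finset.inter_subset_right fun y _ _ =>
    mul_nonneg (ha x) (mul_nonneg (G.μ_nonneg x y) (mul_self_nonneg _))

theorem pairSum_sq_mul_sq_le (S : Finset V) {η : V → ℝ} (hη : ∀ x, η x ^ 2 ≤ 1) (u : V → ℝ) :
    (G.pairSum S fun x y => η x ^ 2 * (u y - u x) ^ 2) ≤ 2 * ∑ x ∈ S, G.m x * G.Gamma u u x := by
  refine (pairSum_mul_sq_le S (fun x => sq_nonneg (η x)) u).trans ?_
  gcongr with x
  · exact G.Gamma_self_nonneg u x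
  · exact mul_le_of_le_one_right (G.m_pos x).le (hη x)

theorem pairSum_sq_mul_cutoff_le (S : Finset V) {η : V → ℝ} {δ : ℝ}
    (hη : ∀ x, G.Gamma η η x ≤ δ ^ 2) (u : V → ℝ) :
    (G.pairSum S fun x y => u x ^ 2 * (η y - η x) ^ 2) ≤
      2 * δ ^ 2 * ∑ x ∈ S, G.m x * u x ^ 2 := by
  refine (pairSum_mul_sq_le S (fun x => sq_nonneg (u x)) η).trans ?_
  rw [mul_assoc, Finset.mul_sum (a := δ ^ 2)]
  refine mul_le_mul_of_nonneg_left (Finset.sum_le_sum fun x _ => ?_) zero_le_two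
  rw [mul_comm (δ ^ 2)]
  exact mul_le_mul_of_nonneg_left (hη x) (mul_nonneg (G.m_pos x).le (sq_nonneg _))

end FiniteSums

/-! ### Cut-off error estimates. -/

section CutoffEstimates

variable {G}

theorem abs_mul_mul_le {δ : ℝ} (hδ : 0 < δ) (a b : ℝ) :
    2 * |a * b| ≤ δ⁻¹ * a ^ 2 + δ * b ^ 2 := by
  have h : 0 ≤ δ⁻¹ * (|a| - δ * |b|) ^ 2 := by positivity
  have e : δ⁻¹ * (|a| - δ * |b|) ^ 2 = δ⁻¹ * a ^ 2 + δ * b ^ 2 - 2 * |a * b| := by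
    rw [abs_mul, ← sq_abs a, ← sq_abs b]; field_simp; ring
  linarith

theorem half_add_sq_le (a b : ℝ) : ((a + b) / 2) ^ 2 ≤ (a ^ 2 + b ^ 2) / 2 := by
  nlinarith [sq_nonneg (a - b)]

/-- By the discrete product rule, the two terms `(η₁² + η₂²)/2 · (v₂ - v₁)(g₂ - g₁)` cancel and
everything left contains `η₂ - η₁`. Young's inequality puts `δ⁻¹` on the squares of these
differences, because they will sum to `O(δ²)`. -/
theorem abs_commutator_le {δ : ℝ} (hδ : 0 < δ) (η₁ η₂ g₁ g₂ v₁ v₂ : ℝ) :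
    |(η₂ ^ 2 * v₂ - η₁ ^ 2 * v₁) * (g₂ - g₁) - (η₂ ^ 2 * g₂ - η₁ ^ 2 * g₁) * (v₂ - v₁)| ≤
      δ⁻¹ / 2 * ((v₁ ^ 2 + v₂ ^ 2) * (η₂ - η₁) ^ 2) + δ⁻¹ / 2 * ((g₁ ^ 2 + g₂ ^ 2) * (η₂ - η₁) ^ 2)
      + δ / 2 * ((η₁ ^ 2 + η₂ ^ 2) * (v₂ - v₁) ^ 2)
      + δ / 2 * ((η₁ ^ 2 + η₂ ^ 2) * (g₂ - g₁) ^ 2) := by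
  have e : (η₂ ^ 2 * v₂ - η₁ ^ 2 * v₁) * (g₂ - g₁) - (η₂ ^ 2 * g₂ - η₁ ^ 2 * g₁) * (v₂ - v₁) =
      2 * (((v₁ + v₂) / 2 * (η₂ - η₁)) * ((η₁ + η₂) / 2 * (g₂ - g₁))) -
      2 * (((g₁ + g₂) / 2 * (η₂ - η₁)) * ((η₁ + η₂) / 2 * (v₂ - v₁))) := by ring
  have h1 := abs_mul_mul_le hδ ((v₁ + v₂) / 2 * (η₂ - η₁)) ((η₁ + η₂) / 2 * (g₂ - g₁))
  have h2 := abs_mul_mul_le hδ ((g₁ + g₂) / 2 * (η₂ - η₁)) ((η₁ + η₂) / 2 * (v₂ - v₁))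
  have h3 : ∀ a b c : ℝ, ((a + b) / 2 * c) ^ 2 ≤ (a ^ 2 + b ^ 2) / 2 * c ^ 2 := fun a b c => by
    rw [mul_pow]; exact mul_le_mul_of_nonneg_right (half_add_sq_le a b) (sq_nonneg c)
  have h4 : 0 ≤ δ⁻¹ := by positivity
  have k1 := mul_le_mul_of_nonneg_left (h3 v₁ v₂ (η₂ - η₁)) h4
  have k2 := mul_le_mul_of_nonneg_left (h3 g₁ g₂ (η₂ - η₁)) h4
  have k3 := mul_le_mul_of_nonneg_left (h3 η₁ η₂ (v₂ - v₁)) hδ.le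
  have k4 := mul_le_mul_of_nonneg_left (h3 η₁ η₂ (g₂ - g₁)) hδ.le
  rw [e]
  refine (abs_sub _ _).trans ?_
  rw [abs_mul, abs_mul 2, abs_two]
  linarith

/-- The cut-off error in the symmetry of the Laplacian. -/
theorem abs_sum_sq_mul_laplacian_sub_le {S : Finset V} {η : V → ℝ} (hS : G.Covers S η) {δ : ℝ}
    (hδ : 0 < δ) (hη : ∀ x, G.Gamma η η x ≤ δ ^ 2) (g v : V → ℝ) :
    |∑ x ∈ S, G.m x * η x ^ 2 * (g x * G.laplacian v x - v x * G.laplacian g x)| ≤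
      δ * (∑ x ∈ S, G.m x * v x ^ 2 + ∑ x ∈ S, G.m x * g x ^ 2
        + (1 / 2) * (G.pairSum S fun x y => η x ^ 2 * (v y - v x) ^ 2)
        + (1 / 2) * G.pairSum S fun x y => η x ^ 2 * (g y - g x) ^ 2) := by
  have hg := (hS.of_eq_zero (q := fun x => η x ^ 2 * g x) fun x hx => by
    simp [hx]).sum_mul_laplacian v
  have hv := (hS.of_eq_zero (q := fun x => η x ^ 2 * v x) fun x hx => by
    simp [hx]).sum_mul_laplacian g
  have e : ∑ x ∈ S, G.m x * η x ^ 2 * (g x * G.laplacian v x - v x * G.laplacian g x) =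
      (1 / 2) * G.pairSum S fun x y =>
        (η y ^ 2 * v y - η x ^ 2 * v x) * (g y - g x) -
        (η y ^ 2 * g y - η x ^ 2 * g x) * (v y - v x) := by
    have e1 : ∑ x ∈ S, G.m x * η x ^ 2 * (g x * G.laplacian v x - v x * G.laplacian g x) =
        ∑ x ∈ S, G.m x * (η x ^ 2 * g x) * G.laplacian v x -
        ∑ x ∈ S, G.m x * (η x ^ 2 * v x) * G.laplacian g x := by
      rw [← Finset.sum_sub_distrib]
      exact Finset.sum_congr rfl fun x _ => by ring
    rw [e1, hg, hv, pairSum_sub]; ring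
  have b1 : |G.pairSum S fun x y =>
        (η y ^ 2 * v y - η x ^ 2 * v x) * (g y - g x) -
        (η y ^ 2 * g y - η x ^ 2 * g x) * (v y - v x)| ≤
      δ⁻¹ * (G.pairSum S fun x y => v x ^ 2 * (η y - η x) ^ 2) +
      δ⁻¹ * (G.pairSum S fun x y => g x ^ 2 * (η y - η x) ^ 2) +
      δ * (G.pairSum S fun x y => η x ^ 2 * (v y - v x) ^ 2) +
      δ * (G.pairSum S fun x y => η x ^ 2 * (g y - g x) ^ 2) := by
    have hsymm : ∀ w : V → ℝ, ∀ x y, (w y - w x) ^ 2 = (w x - w y) ^ 2 := fun w x y => by ring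
    have s1 := pairSum_symmetrize (G := G) S (fun x => v x ^ 2) _ (hsymm η)
    have s2 := pairSum_symmetrize (G := G) S (fun x => g x ^ 2) _ (hsymm η)
    have s3 := pairSum_symmetrize (G := G) S (fun x => η x ^ 2) _ (hsymm v)
    have s4 := pairSum_symmetrize (G := G) S (fun x => η x ^ 2) _ (hsymm g)
    have hu := fun x y => abs_commutator_le hδ (η x) (η y) (g x) (g y) (v x) (v y)
    have hup := pairSum_mono (G := G) S fun x y => (abs_le.1 (hu x y)).2
    have hlo := pairSum_mono (G := G) S fun x y => neg_le.1 (abs_le.1 (hu x y)).1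
    have hneg := pairSum_const_mul (G := G) S (-1) fun x y =>
        (η y ^ 2 * v y - η x ^ 2 * v x) * (g y - g x) -
        (η y ^ 2 * g y - η x ^ 2 * g x) * (v y - v x)
    simp only [neg_one_mul] at hneg
    rw [hneg] at hlo
    simp only [pairSum_add, pairSum_const_mul, s1, s2, s3, s4] at hup hlo
    rw [abs_le]
    constructor <;> linarith
  -- The bound `Γ(η) ≤ δ²` turns the weight `δ⁻¹` into `δ`.
  have c1 := mul_le_mul_of_nonneg_left (pairSum_sq_mul_cutoff_le S hη v) (inv_nonneg.2 hδ.le)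
  have c2 := mul_le_mul_of_nonneg_left (pairSum_sq_mul_cutoff_le S hη g) (inv_nonneg.2 hδ.le)
  have d1 : ∀ s : ℝ, δ⁻¹ * (2 * δ ^ 2 * s) = 2 * δ * s := fun s => by field_simp
  rw [d1] at c1 c2
  rw [e, abs_mul, abs_of_pos (by norm_num : (0 : ℝ) < 1 / 2)]
  nlinarith

/-- A **Caccioppoli inequality** for `Γ(u)` under non-negative curvature. -/
theorem pairSum_sq_mul_Gamma_sub_sq_le {S : Finset V} {η : V → ℝ} (hS : G.Covers S η) {δ : ℝ}
    (hη : ∀ x, G.Gamma η η x ≤ δ ^ 2) (hη1 : ∀ x, η x ^ 2 ≤ 1) {u : V → ℝ}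
    (hu : ∀ x, 0 ≤ G.Gamma2 u x) {B : ℝ} (hB : ∀ x, G.Gamma u u x ≤ B) :
    (G.pairSum S fun x y => η x ^ 2 * (G.Gamma u u y - G.Gamma u u x) ^ 2) ≤
      4 * B * (∑ x ∈ S, G.m x * G.Gamma u u x
        + ∑ x ∈ S, G.m x * G.Gamma (G.laplacian u) (G.laplacian u) x)
      + 8 * δ ^ 2 * (B * ∑ x ∈ S, G.m x * G.Gamma u u x) := by
  set g := G.Gamma u u with hg
  have hg0 : ∀ x, 0 ≤ g x := G.Gamma_self_nonneg u
  have green := (hS.of_eq_zero (q := fun x => η x ^ 2 * g x) fun x hx => by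
    simp [hx]).sum_mul_laplacian g
  have hsymm : ∀ w : V → ℝ, ∀ x y, (w y - w x) ^ 2 = (w x - w y) ^ 2 := fun w x y => by ring
  have s1 := pairSum_symmetrize (G := G) S (fun x => g x ^ 2) _ (hsymm η)
  have s2 := pairSum_symmetrize (G := G) S (fun x => η x ^ 2) _ (hsymm g)
  have hpt : ∀ x y, (1 / 4) * ((η x ^ 2 + η y ^ 2) * (g y - g x) ^ 2) -
      (g x ^ 2 + g y ^ 2) * (η y - η x) ^ 2 ≤
      (η y ^ 2 * g y - η x ^ 2 * g x) * (g y - g x) := by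
    intro x y
    have e : (η y ^ 2 * g y - η x ^ 2 * g x) * (g y - g x) =
        (η x ^ 2 + η y ^ 2) / 2 * (g y - g x) ^ 2 +
        2 * (((g x + g y) / 2 * (η y - η x)) * ((η x + η y) / 2 * (g y - g x))) := by ring
    have h3 : ∀ a b c : ℝ, ((a + b) / 2 * c) ^ 2 ≤ (a ^ 2 + b ^ 2) / 2 * c ^ 2 := fun a b c => by
      rw [mul_pow]; exact mul_le_mul_of_nonneg_right (half_add_sq_le a b) (sq_nonneg c)
    have k1 := h3 (g x) (g y) (η y - η x)
    have k2 := h3 (η x) (η y) (g y - g x)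
    rw [e]
    -- This is `2ab ≥ -2a² - b²/2`: of the leading coefficient `1/2`, the term `b²/2` uses up `1/4`.
    nlinarith [sq_nonneg (2 * ((g x + g y) / 2 * (η y - η x)) + ((η x + η y) / 2 * (g y - g x)))]
  have h1 := pairSum_mono (G := G) S hpt
  rw [pairSum_sub, pairSum_const_mul, s1, s2] at h1
  have hcut := pairSum_sq_mul_cutoff_le S hη g
  have hgg : ∑ x ∈ S, G.m x * g x ^ 2 ≤ B * ∑ x ∈ S, G.m x * g x := by
    rw [Finset.mul_sum]
    refine Finset.sum_le_sum fun x _ => ?_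
    nlinarith [mul_le_mul_of_nonneg_left (hB x) (mul_nonneg (G.m_pos x).le (hg0 x))]
  -- Curvature enters here: `-Δg ≤ -2Γ(u, Δu) ≤ Γ(u) + Γ(Δu)`, multiplied by the weight `η² g ∈ [0,
  -- B]`.
  have hcurv : -∑ x ∈ S, G.m x * (η x ^ 2 * g x) * G.laplacian g x ≤
      B * (∑ x ∈ S, G.m x * g x + ∑ x ∈ S, G.m x * G.Gamma (G.laplacian u) (G.laplacian u) x) := by
    rw [← Finset.sum_add_distrib, Finset.mul_sum, ← Finset.sum_neg_distrib]
    refine Finset.sum_le_sum fun x _ => ?_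
    have h2 := hu x
    rw [Gamma2, ← hg] at h2
    have h3 := G.neg_two_mul_Gamma_le u (G.laplacian u) x
    rw [← hg] at h3
    have h4 : -G.laplacian g x ≤ g x + G.Gamma (G.laplacian u) (G.laplacian u) x := by linarith
    have h5 : 0 ≤ g x + G.Gamma (G.laplacian u) (G.laplacian u) x :=
      add_nonneg (hg0 x) (G.Gamma_self_nonneg _ x)
    have h6 : η x ^ 2 * g x ≤ B :=
      (mul_le_of_le_one_left (hg0 x) (hη1 x)).trans (hB x)
    have h7 : 0 ≤ η x ^ 2 * g x := mul_nonneg (sq_nonneg _) (hg0 x)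
    have h8 := (mul_le_mul_of_nonneg_left h4 h7).trans (mul_le_mul_of_nonneg_right h6 h5)
    have := mul_le_mul_of_nonneg_left h8 (G.m_pos x).le
    linarith
  have hδ2 : 0 ≤ δ ^ 2 := sq_nonneg δ
  have := mul_le_mul_of_nonneg_left hgg hδ2
  linarith

/-- The cut-off error in the maximum principle. -/
theorem sum_sq_mul_posPart_mul_laplacian_le {S : Finset V} {η : V → ℝ} (hS : G.Covers S η) {δ : ℝ}
    (hδ : 0 < δ) (hη : ∀ x, G.Gamma η η x ≤ δ ^ 2) (hη1 : ∀ x, η x ^ 2 ≤ 1) (u : V → ℝ) {c : ℝ}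
    (hc : 0 ≤ c) :
    ∑ x ∈ S, G.m x * η x ^ 2 * (max (u x - c) 0 * G.laplacian u x) ≤
      δ * (∑ x ∈ S, G.m x * u x ^ 2 + ∑ x ∈ S, G.m x * G.Gamma u u x) := by
  set w : V → ℝ := fun x => max (u x - c) 0 with hw
  have green := (hS.of_eq_zero (q := fun x => η x ^ 2 * w x) fun x hx => by
    simp [hx]).sum_mul_laplacian u
  have hsymm : ∀ w : V → ℝ, ∀ x y, (w y - w x) ^ 2 = (w x - w y) ^ 2 := fun w x y => by ring
  have s1 := pairSum_symmetrize (G := G) S (fun x => u x ^ 2) _ (hsymm η)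
  have s2 := pairSum_symmetrize (G := G) S (fun x => η x ^ 2) _ (hsymm u)
  -- This needs `c ≥ 0`, and replaces the truncation by `u`, whose norm is controlled.
  have hwu : ∀ x, w x ^ 2 ≤ u x ^ 2 := by
    intro x
    simp only [hw]
    rcases max_cases (u x - c) 0 with ⟨h, h'⟩ | ⟨h, h'⟩ <;> rw [h] <;> nlinarith
  -- Truncation is monotone, so the leading term in Green's formula has the favorable sign and is
  -- dropped.
  have hmono : ∀ x y, 0 ≤ (w y - w x) * (u y - u x) := by
    intro x y
    simp only [hw]
    rcases le_total (u x) (u y) with h | h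
    · exact mul_nonneg (sub_nonneg.2 (max_le_max_right _ (by linarith))) (sub_nonneg.2 h)
    · exact mul_nonneg_of_nonpos_of_nonpos
        (sub_nonpos.2 (max_le_max_right _ (by linarith))) (sub_nonpos.2 h)
  have hpt : ∀ x y, -(δ⁻¹ / 2 * ((u x ^ 2 + u y ^ 2) * (η y - η x) ^ 2) +
      δ / 2 * ((η x ^ 2 + η y ^ 2) * (u y - u x) ^ 2)) ≤
      (η y ^ 2 * w y - η x ^ 2 * w x) * (u y - u x) := by
    intro x y
    have e : (η y ^ 2 * w y - η x ^ 2 * w x) * (u y - u x) =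
        (η x ^ 2 + η y ^ 2) / 2 * ((w y - w x) * (u y - u x)) +
        2 * (((w x + w y) / 2 * (η y - η x)) * ((η x + η y) / 2 * (u y - u x))) := by ring
    have h3 : ∀ a b c : ℝ, ((a + b) / 2 * c) ^ 2 ≤ (a ^ 2 + b ^ 2) / 2 * c ^ 2 := fun a b c => by
      rw [mul_pow]; exact mul_le_mul_of_nonneg_right (half_add_sq_le a b) (sq_nonneg c)
    have k0 := abs_mul_mul_le hδ ((w x + w y) / 2 * (η y - η x)) ((η x + η y) / 2 * (u y - u x))
    have k1 := mul_le_mul_of_nonneg_left (h3 (w x) (w y) (η y - η x)) (inv_nonneg.2 hδ.le)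
    have k2 := mul_le_mul_of_nonneg_left (h3 (η x) (η y) (u y - u x)) hδ.le
    have k3 : δ⁻¹ * ((w x ^ 2 + w y ^ 2) / 2 * (η y - η x) ^ 2) ≤
        δ⁻¹ * ((u x ^ 2 + u y ^ 2) / 2 * (η y - η x) ^ 2) := by
      have := hwu x
      have := hwu y
      gcongr
    have k4 : 0 ≤ (η x ^ 2 + η y ^ 2) / 2 * ((w y - w x) * (u y - u x)) :=
      mul_nonneg (by positivity) (hmono x y)
    have k5 := neg_abs_le
      (((w x + w y) / 2 * (η y - η x)) * ((η x + η y) / 2 * (u y - u x)))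
    rw [e]
    linarith
  have h1 := pairSum_mono (G := G) S hpt
  simp only [← neg_one_mul (_ + _ : ℝ)] at h1
  rw [pairSum_const_mul, pairSum_add, pairSum_const_mul, pairSum_const_mul, s1, s2] at h1
  have c1 := mul_le_mul_of_nonneg_left (pairSum_sq_mul_cutoff_le S hη u) (inv_nonneg.2 hδ.le)
  have c2 := mul_le_mul_of_nonneg_left (pairSum_sq_mul_sq_le (G := G) S hη1 u) hδ.le
  have d1 : ∀ s : ℝ, δ⁻¹ * (2 * δ ^ 2 * s) = 2 * δ * s := fun s => by field_simp
  rw [d1] at c1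
  have e1 : ∑ x ∈ S, G.m x * η x ^ 2 * (w x * G.laplacian u x) =
      ∑ x ∈ S, G.m x * (η x ^ 2 * w x) * G.laplacian u x :=
    Finset.sum_congr rfl fun x _ => by ring
  rw [e1, green]
  linarith

end CutoffEstimates

/-! ### The space `ℓ²(V, m)` as a space of functions. -/

section L2

variable {G}

theorem coe_add_apply (f g : G.L2) (x : V) : (f + g : G.L2) x = f x + g x :=
  (G.ae_iff _).1 (Lp.coeFn_add f g) x

theorem coe_sub_apply (f g : G.L2) (x : V) : (f - g : G.L2) x = f x - g x :=
  (G.ae_iff _).1 (Lp.coeFn_sub f g) x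

theorem coe_smul_apply (c : ℝ) (f : G.L2) (x : V) : (c • f : G.L2) x = c * f x :=
  (G.ae_iff _).1 (Lp.coeFn_smul c f) x

theorem coe_zero_apply (x : V) : (0 : G.L2) x = 0 :=
  (G.ae_iff _).1 (Lp.coeFn_zero _ _ _) x

theorem coe_zero : ((0 : G.L2) : V → ℝ) = 0 := funext coe_zero_apply

theorem coe_toLp_apply {f : V → ℝ} (hf : MemLp f 2 G.measure) (x : V) : hf.toLp f x = f x :=
  (G.ae_iff _).1 hf.coeFn_toLp x

theorem coe_toLp {f : V → ℝ} (hf : MemLp f 2 G.measure) : (hf.toLp f : V → ℝ) = f :=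
  funext (coe_toLp_apply hf)

theorem L2_ext {f g : G.L2} (h : ∀ x, f x = g x) : f = g :=
  Lp.ext ((G.ae_iff _).2 h)

theorem hasSum_inner (f g : G.L2) : HasSum (fun x => G.m x * (f x * g x)) (inner ℝ f g) := by
  let _ : MeasurableSpace V := ⊤
  have hi : Integrable (fun x => inner ℝ (f x) (g x)) G.measure := L2.integrable_inner f g
  have h := hasSum_integral_measure hi
  rw [L2.inner_def]
  refine h.congr_fun fun x => ?_
  rw [integral_smul_measure, integral_dirac, ENNReal.toReal_ofReal (G.m_pos x).le, smul_eq_mul]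
  simp [mul_comm]

theorem hasSum_norm_sq (f : G.L2) : HasSum (fun x => G.m x * f x ^ 2) (‖f‖ ^ 2) := by
  have h := hasSum_inner f f
  rw [real_inner_self_eq_norm_sq] at h
  exact h.congr_fun fun x => by rw [sq]

theorem sum_m_mul_sq_le (f : G.L2) (S : Finset V) : ∑ x ∈ S, G.m x * f x ^ 2 ≤ ‖f‖ ^ 2 :=
  sum_le_hasSum S (fun x _ => mul_nonneg (G.m_pos x).le (sq_nonneg _)) (hasSum_norm_sq f)

theorem inner_eq_sum {f g : G.L2} {S : Finset V} (h : ∀ x ∉ S, f x = 0) :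
    inner ℝ f g = ∑ x ∈ S, G.m x * (f x * g x) :=
  (hasSum_inner f g).unique (hasSum_sum_of_ne_finset_zero fun x hx => by simp [h x hx])

variable (G) in
/-- A finitely supported function as an element of `ℓ²(V, m)`. -/
noncomputable def ofFinite {f : V → ℝ} (hf : f.support.Finite) : G.L2 :=
  (G.memLp_of_finite_support hf).toLp f

theorem ofFinite_apply {f : V → ℝ} (hf : f.support.Finite) (x : V) : G.ofFinite hf x = f x :=
  coe_toLp_apply _ x

theorem finite_support_coe_ofFinite {f : V → ℝ} (hf : f.support.Finite) :
    (G.ofFinite hf : V → ℝ).support.Finite := by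
  rwa [ofFinite, coe_toLp]

open Classical in
theorem finite_support_single (x : V) (c : ℝ) : (Pi.single x c : V → ℝ).support.Finite :=
  (Set.finite_singleton x).subset Pi.support_single_subset

open Classical in
theorem inner_ofFinite_single (x : V) (c : ℝ) (f : G.L2) :
    inner ℝ (G.ofFinite (finite_support_single x c)) f = G.m x * (c * f x) := by
  rw [inner_eq_sum (S := {x}), Finset.sum_singleton, ofFinite_apply, Pi.single_eq_same]
  intro y hy
  rw [ofFinite_apply, Pi.single_eq_of_ne (by simpa using hy)]

open Classical in
variable (G) in
/-- Evaluation at a vertex as a continuous linear functional on `ℓ²(V, m)`. -/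
noncomputable def evalL (x : V) : G.L2 →L[ℝ] ℝ :=
  innerSL ℝ (G.ofFinite (finite_support_single x (G.m x)⁻¹))

@[simp]
theorem evalL_apply (x : V) (f : G.L2) : G.evalL x f = f x := by
  have := (G.m_pos x).ne'
  rw [evalL, innerSL_apply_apply, inner_ofFinite_single, mul_inv_cancel_left₀ this]

/-- A vector orthogonal to all finitely supported functions is orthogonal to every point mass, so it
vanishes at every vertex. -/
theorem dense_range_ofFinite : Dense {f : G.L2 | (f : V → ℝ).support.Finite} := by
  let D : Submodule ℝ G.L2 :=
    { carrier := {f : G.L2 | (f : V → ℝ).support.Finite}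
      add_mem' := fun {f g} hf hg => (Set.Finite.union hf hg).subset fun x hx => by
        by_contra h
        simp only [Set.mem_union, Function.mem_support, not_or, not_not] at h
        exact hx (by rw [coe_add_apply, h.1, h.2, add_zero])
      zero_mem' := by
        rw [Set.mem_ofPred_eq, coe_zero]; simp
      smul_mem' := fun c f hf => Set.Finite.subset hf fun x hx h => hx (by
        rw [coe_smul_apply, h, mul_zero]) }
  have : Dense (D : Set G.L2) := by
    rw [Submodule.dense_iff_topologicalClosure_eq_top, Submodule.topologicalClosure_eq_top_iff,
      Submodule.eq_bot_iff]
    intro f hf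
    refine L2_ext fun x => ?_
    classical
    rw [coe_zero_apply, ← evalL_apply]
    exact (Submodule.mem_orthogonal _ _).1 hf _ (finite_support_coe_ofFinite _)
  exact this

end L2

/-! ### The form domain as a closed graph in a Hilbert space. -/

section EnergySpace

/-- The Hilbert space `ℓ²(V, m) ⊕ ℓ²(V × V)`, in which `u` is paired with its differential. -/
abbrev EnergyAmbient : Type _ := WithLp 2 (G.L2 × lp (fun _ : V × V => ℝ) 2)

/-- The weighted differential of a function. -/
noncomputable def diff (u : V → ℝ) (p : V × V) : ℝ := √(G.μ p.1 p.2 / 2) * (u p.2 - u p.1)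

variable {G}

/-- The factor `√(μ/2)` is chosen so that `⟨du, dv⟩ = Q(u, v)`. -/
theorem diff_mul_diff (u v : V → ℝ) (p : V × V) :
    G.diff u p * G.diff v p = 1 / 2 * (G.μ p.1 p.2 * (u p.2 - u p.1) * (v p.2 - v p.1)) := by
  have h : √(G.μ p.1 p.2 / 2) * √(G.μ p.1 p.2 / 2) = G.μ p.1 p.2 / 2 :=
    Real.mul_self_sqrt (div_nonneg (G.μ_nonneg _ _) zero_le_two)
  calc G.diff u p * G.diff v p
      = (√(G.μ p.1 p.2 / 2) * √(G.μ p.1 p.2 / 2)) * ((u p.2 - u p.1) * (v p.2 - v p.1)) := by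
        rw [diff, diff]; ring
    _ = _ := by rw [h]; ring

theorem finite_support_diff {u : V → ℝ} (hu : u.support.Finite) : (G.diff u).support.Finite := by
  obtain ⟨S, hS⟩ := G.exists_covers hu
  refine (S ×ˢ S).finite_toSet.subset fun p hp => ?_
  have hμ : p.2 ∈ G.nbrs p.1 := by
    by_contra h
    exact hp (by simp [diff, G.μ_eq_zero_of_notMem h])
  rw [Finset.coe_product, Set.mem_prod]
  constructor <;> by_contra h
  · exact hp (by simp [diff, hS.eq_zero h, hS.eq_zero_of_mem_nbrs h hμ])
  · exact hp (by simp [diff, hS.eq_zero h, hS.eq_zero_of_mem_nbrs h (G.mem_nbrs_comm.1 hμ)])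

theorem memℓp_of_finite_support {ι : Type*} {F : ι → ℝ} (hF : F.support.Finite) :
    Memℓp F (2 : ℝ≥0∞) := by
  refine memℓp_gen (summable_of_ne_finset_zero (s := hF.toFinset) fun p hp => ?_)
  have : F p = 0 := by simpa using hp
  simp [this]

variable (G) in
/-- The pairs `(φ, dφ)` with `φ` finitely supported. -/
noncomputable def finiteEnergySpace : Submodule ℝ G.EnergyAmbient where
  carrier := {w | (w.fst : V → ℝ).support.Finite ∧ ∀ p, w.snd p = G.diff w.fst p}
  add_mem' {v w} hv hw := by
    refine ⟨(hv.1.union hw.1).subset fun x hx => ?_, fun p => ?_⟩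
    · by_contra h
      simp only [Set.mem_union, Function.mem_support, not_or, not_not] at h
      exact hx (by rw [WithLp.add_fst, coe_add_apply, h.1, h.2, add_zero])
    · rw [WithLp.add_snd, lp.coeFn_add, Pi.add_apply, hv.2, hw.2, WithLp.add_fst]
      simp only [diff, coe_add_apply]; ring
  zero_mem' := by
    have h : ((0 : G.EnergyAmbient).fst : V → ℝ) = 0 := coe_zero
    rw [Set.mem_ofPred_eq, h]
    exact ⟨by simp, fun p => by simp [diff]⟩
  smul_mem' c w hw := by
    refine ⟨hw.1.subset fun x hx h => hx (by rw [WithLp.smul_fst, coe_smul_apply, h, mul_zero]),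
      fun p => ?_⟩
    rw [WithLp.smul_snd, lp.coeFn_smul, Pi.smul_apply, hw.2, WithLp.smul_fst]
    simp only [diff, coe_smul_apply, smul_eq_mul]; ring

variable (G) in
/-- The form domain, as the closed subspace of all pairs `(u, du)`. -/
noncomputable def energySpace : Submodule ℝ G.EnergyAmbient :=
  G.finiteEnergySpace.topologicalClosure

/-- Evaluations are continuous on both components, so being a pair `(u, du)` is a closed condition
and survives the closure. -/
theorem snd_apply_of_mem_energySpace {w : G.EnergyAmbient} (hw : w ∈ G.energySpace) (p : V × V) :
    w.snd p = G.diff w.fst p := by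
  have hc : IsClosed {w : G.EnergyAmbient | w.snd p = G.diff w.fst p} := by
    have h1 : Continuous fun w : G.EnergyAmbient => w.snd p :=
      (lp.evalCLM ℝ (fun _ : V × V => ℝ) 2 p).continuous.comp (WithLp.sndL 2 ℝ G.L2 (lp (fun _ : V × V => ℝ) 2)).continuous
    have h2 : ∀ x, Continuous fun w : G.EnergyAmbient => w.fst x := fun x => by
      have := (G.evalL x).continuous.comp (WithLp.fstL 2 ℝ G.L2 (lp (fun _ : V × V => ℝ) 2)).continuous
      refine this.congr fun w => ?_
      exact evalL_apply x w.fst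
    exact isClosed_eq h1 (continuous_const.mul ((h2 _).sub (h2 _)))
  exact closure_minimal (fun w hw => hw.2 p) hc hw

theorem mem_finiteEnergySpace_of_finite_support {u : V → ℝ} (hu : u.support.Finite) :
    WithLp.toLp 2 (G.ofFinite hu, ⟨G.diff u, memℓp_of_finite_support (finite_support_diff hu)⟩) ∈
      G.finiteEnergySpace :=
  ⟨finite_support_coe_ofFinite hu, fun p => by
    simp only [WithLp.toLp_fst, WithLp.toLp_snd, ofFinite, coe_toLp]⟩

theorem ofReal_norm_sq_eq_formNormSq {w : G.EnergyAmbient} (hw : ∀ p, w.snd p = G.diff w.fst p) :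
    ENNReal.ofReal (‖w‖ ^ 2) = G.formNormSq w.fst := by
  rw [WithLp.prod_norm_sq_eq_of_L2, ENNReal.ofReal_add (sq_nonneg _) (sq_nonneg _), formNormSq]
  congr 1
  · rw [ENNReal.ofReal_pow (norm_nonneg _), ofReal_norm, Lp.enorm_def]
  · have h := lp.hasSum_norm (p := 2) (by norm_num) w.snd
    have h2 : ∀ p, ‖w.snd p‖ ^ (2 : ℝ≥0∞).toReal =
        1 / 2 * (G.μ p.1 p.2 * (w.fst p.2 - w.fst p.1) ^ 2) := fun p => by
      rw [hw p, ENNReal.toReal_ofNat, Real.rpow_two, Real.norm_eq_abs, sq_abs, sq, diff_mul_diff]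
      ring
    simp only [h2] at h
    have h0 : ∀ p : V × V, 0 ≤ G.μ p.1 p.2 * (w.fst p.2 - w.fst p.1) ^ 2 := fun p =>
      mul_nonneg (G.μ_nonneg _ _) (sq_nonneg _)
    have e : ‖w.snd‖ ^ 2 = ∑' p : V × V, 1 / 2 * (G.μ p.1 p.2 * (w.fst p.2 - w.fst p.1) ^ 2) := by
      rw [h.tsum_eq, ENNReal.toReal_ofNat, Real.rpow_two]
    rw [e, ENNReal.ofReal_tsum_of_nonneg (fun p => mul_nonneg (by norm_num) (h0 p)) h.summable,
      ← ENNReal.tsum_mul_left]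
    refine tsum_congr fun p => ?_
    rw [ENNReal.ofReal_mul (by norm_num)]
    congr 1
    rw [one_div, ENNReal.ofReal_inv_of_pos two_pos, one_div, ENNReal.ofReal_ofNat]

theorem diff_sub (u v : V → ℝ) : G.diff (u - v) = G.diff u - G.diff v := by
  funext p; simp only [diff, Pi.sub_apply]; ring

/-- Identifies the completion in the definition of `D(Q)` with a closed subspace, on which Hilbert
space methods apply. -/
theorem mem_formDomain_iff {f : G.L2} :
    f ∈ G.formDomain ↔ ∃ w ∈ G.energySpace, w.fst = f := by
  constructor
  · rintro ⟨φ, hφ, hlim⟩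
    have hmem : Memℓp (G.diff f) (2 : ℝ≥0∞) := by
      -- One approximant at finite form distance suffices: `df = d(f - φ n) + d(φ n)`, both
      -- square-summable.
      obtain ⟨n, hn⟩ := (hlim.eventually (gt_mem_nhds ENNReal.zero_lt_top)).exists
      have h1 : Memℓp (G.diff (f - φ n)) (2 : ℝ≥0∞) := by
        refine memℓp_gen ?_
        have hfin : ∑' p : V × V, ENNReal.ofReal (G.μ p.1 p.2 *
            (((f : V → ℝ) - φ n) p.2 - ((f : V → ℝ) - φ n) p.1) ^ 2) ≠ ⊤ := by
          intro htop
          rw [formNormSq, htop] at hn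
          simp [ENNReal.mul_top] at hn
        have hs := (ENNReal.summable_toReal hfin).mul_left (1 / 2)
        refine hs.congr fun p => ?_
        rw [ENNReal.toReal_ofReal (mul_nonneg (G.μ_nonneg _ _) (sq_nonneg _)),
          ENNReal.toReal_ofNat, Real.rpow_two, Real.norm_eq_abs, sq_abs, sq (G.diff _ p),
          diff_mul_diff]
        ring
      have h2 := memℓp_of_finite_support (finite_support_diff (G := G) (hφ n))
      have h3 := h1.add h2
      rwa [diff_sub, sub_add_cancel] at h3
    refine ⟨WithLp.toLp 2 (f, ⟨G.diff f, hmem⟩), ?_, rfl⟩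
    rw [energySpace, ← SetLike.mem_coe, Submodule.topologicalClosure_coe,
      mem_closure_iff_seq_limit]
    refine ⟨_, fun n => mem_finiteEnergySpace_of_finite_support (hφ n), ?_⟩
    rw [tendsto_iff_norm_sub_tendsto_zero]
    set w : G.EnergyAmbient := WithLp.toLp 2 (f, ⟨G.diff f, hmem⟩)
    set wn : ℕ → G.EnergyAmbient := fun n => WithLp.toLp 2 (G.ofFinite (hφ n),
      ⟨G.diff (φ n), memℓp_of_finite_support (finite_support_diff (hφ n))⟩)
    have hfst : ∀ n, ((w - wn n).fst : V → ℝ) = f - φ n := fun n => by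
      funext x
      rw [WithLp.sub_fst, coe_sub_apply]
      exact congrArg _ (ofFinite_apply (hφ n) x)
    have hE : ∀ n, ENNReal.ofReal (‖w - wn n‖ ^ 2) = G.formNormSq (f - φ n) := fun n => by
      rw [ofReal_norm_sq_eq_formNormSq, hfst]
      intro p
      rw [hfst, diff_sub]
      rfl
    have h1 : Tendsto (fun n => ‖w - wn n‖ ^ 2) atTop (𝓝 0) := by
      have h2 := (ENNReal.tendsto_toReal ENNReal.zero_ne_top).comp hlim
      refine h2.congr fun n => ?_
      rw [Function.comp, ← hE, ENNReal.toReal_ofReal (sq_nonneg _)]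
    have h3 := h1.sqrt
    simp only [Real.sqrt_sq (norm_nonneg _), Real.sqrt_zero] at h3
    exact h3.congr fun n => norm_sub_rev _ _
  · rintro ⟨w, hw, rfl⟩
    obtain ⟨wn, hwn, hlim⟩ := mem_closure_iff_seq_limit.1 hw
    refine ⟨fun n => (wn n).fst, fun n => (hwn n).1, ?_⟩
    have h1 : Tendsto (fun n => ‖w - wn n‖ ^ 2) atTop (𝓝 0) := by
      have := (tendsto_iff_norm_sub_tendsto_zero.1 hlim).pow 2
      rw [zero_pow two_ne_zero] at this
      exact this.congr fun n => by rw [norm_sub_rev]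
    have h2 := ENNReal.tendsto_ofReal h1
    rw [ENNReal.ofReal_zero] at h2
    refine h2.congr fun n => ?_
    have hmem : w - wn n ∈ G.energySpace :=
      Submodule.sub_mem _ hw (Submodule.le_topologicalClosure _ (hwn n))
    rw [ofReal_norm_sq_eq_formNormSq (snd_apply_of_mem_energySpace hmem)]
    congr 1
    funext x
    rw [WithLp.sub_fst, coe_sub_apply, Pi.sub_apply]

theorem form_eq_inner {v w : G.EnergyAmbient} (hv : v ∈ G.energySpace) (hw : w ∈ G.energySpace) :
    G.form v.fst w.fst = inner ℝ v.snd w.snd := by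
  rw [lp.inner_eq_tsum, form, ← tsum_mul_left]
  refine tsum_congr fun p => ?_
  rw [snd_apply_of_mem_energySpace hv, snd_apply_of_mem_energySpace hw]
  simp only [RCLike.inner_apply, conj_trivial]
  rw [mul_comm (G.diff _ p), diff_mul_diff]

theorem isFormGenerator_iff {f g : G.L2} :
    G.IsFormGenerator f g ↔ ∃ v ∈ G.energySpace, v.fst = f ∧
      ∀ w ∈ G.energySpace, inner ℝ v.snd w.snd = -inner ℝ g w.fst := by
  constructor
  · rintro ⟨hf, h⟩
    obtain ⟨v, hv, rfl⟩ := mem_formDomain_iff.1 hf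
    refine ⟨v, hv, rfl, fun w hw => ?_⟩
    rw [← form_eq_inner hv hw]
    exact h _ (mem_formDomain_iff.2 ⟨w, hw, rfl⟩)
  · rintro ⟨v, hv, rfl, h⟩
    refine ⟨mem_formDomain_iff.2 ⟨v, hv, rfl⟩, fun u hu => ?_⟩
    obtain ⟨w, hw, rfl⟩ := mem_formDomain_iff.1 hu
    rw [form_eq_inner hv hw]
    exact h w hw

end EnergySpace

/-! ### The generator: action as `Δ`, and m-dissipativity. -/

section Generator

variable {G}

theorem IsFormGenerator.inner_symm {f g f' g' : G.L2} (h : G.IsFormGenerator f g)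
    (h' : G.IsFormGenerator f' g') : inner ℝ g f' = inner ℝ f g' := by
  obtain ⟨v, hv, rfl, hg⟩ := isFormGenerator_iff.1 h
  obtain ⟨v', hv', rfl, hg'⟩ := isFormGenerator_iff.1 h'
  have h1 := hg v' hv'
  have h2 := hg' v hv
  rw [real_inner_comm] at h2
  rw [real_inner_comm g' v.fst]
  linarith

/-- The left side is the part of the series `‖dv‖²` over pairs `(x, y)` with `x ∈ S` and `y ∼ x`. -/
theorem sum_m_mul_Gamma_le {v : G.EnergyAmbient} (hv : v ∈ G.energySpace) (S : Finset V) :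
    ∑ x ∈ S, G.m x * G.Gamma v.fst v.fst x ≤ ‖v.snd‖ ^ 2 := by
  have h := lp.hasSum_inner (𝕜 := ℝ) v.snd v.snd
  rw [real_inner_self_eq_norm_sq] at h
  have h2 : ∀ p, inner ℝ (v.snd p) (v.snd p) = 1 / 2 * (G.μ p.1 p.2 *
      ((v.fst p.2 - v.fst p.1) * (v.fst p.2 - v.fst p.1))) := fun p => by
    rw [snd_apply_of_mem_energySpace hv, RCLike.inner_apply, conj_trivial, diff_mul_diff, mul_assoc]
  simp only [h2] at h
  have e : ∑ x ∈ S, G.m x * G.Gamma v.fst v.fst x =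
      ∑ p ∈ (S.sigma G.nbrs).map (Equiv.sigmaEquivProd V V).toEmbedding, 1 / 2 * (G.μ p.1 p.2 *
      ((v.fst p.2 - v.fst p.1) * (v.fst p.2 - v.fst p.1))) := by
    rw [Finset.sum_map, Finset.sum_sigma]
    refine Finset.sum_congr rfl fun x _ => ?_
    simp only [Equiv.coe_toEmbedding, Equiv.sigmaEquivProd_apply]
    rw [← Finset.mul_sum, ← two_mul_m_mul_Gamma]
    ring
  rw [e]
  exact sum_le_hasSum _ (fun p _ => mul_nonneg (by norm_num)
    (mul_nonneg (G.μ_nonneg _ _) (mul_self_nonneg _))) h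

theorem IsFormGenerator.sum_m_mul_Gamma_le {f g : G.L2} (h : G.IsFormGenerator f g)
    (S : Finset V) : ∑ x ∈ S, G.m x * G.Gamma f f x ≤ -inner ℝ g f := by
  obtain ⟨v, hv, rfl, hg⟩ := isFormGenerator_iff.1 h
  rw [← hg v hv, real_inner_self_eq_norm_sq]
  exact WeightedGraph.sum_m_mul_Gamma_le hv S

theorem isFormGenerator_ofFinite {f : V → ℝ} (hf : f.support.Finite) :
    G.IsFormGenerator (G.ofFinite hf) (G.ofFinite (G.finite_support_laplacian hf)) := by
  rw [isFormGenerator_iff]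
  refine ⟨_, Submodule.le_topologicalClosure _ (mem_finiteEnergySpace_of_finite_support hf), rfl,
    fun w hw => ?_⟩
  obtain ⟨S, hS⟩ := G.exists_covers hf
  have hlap : ∀ x ∉ S, G.laplacian f x = 0 := fun x hx => by
    rw [laplacian, Finset.sum_eq_zero, mul_zero]
    intro y hy
    rw [hS.eq_zero hx, hS.eq_zero_of_mem_nbrs hx hy, sub_zero, mul_zero]
  rw [inner_eq_sum (S := S) fun x hx => by rw [ofFinite_apply, hlap x hx]]
  have e1 : ∑ x ∈ S, G.m x * (G.ofFinite (G.finite_support_laplacian hf) x * w.fst x) =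
      ∑ x ∈ S, G.m x * w.fst x * G.laplacian f x :=
    Finset.sum_congr rfl fun x _ => by rw [ofFinite_apply]; ring
  rw [e1, hS.sum_laplacian_mul]
  refine (lp.hasSum_inner _ _).unique ?_
  have hterm : ∀ p : V × V, inner ℝ (G.diff f p) (w.snd p) =
      1 / 2 * (G.μ p.1 p.2 * ((f p.2 - f p.1) * (w.fst p.2 - w.fst p.1))) := fun p => by
    rw [snd_apply_of_mem_energySpace hw, RCLike.inner_apply, conj_trivial, mul_comm, diff_mul_diff,
      mul_assoc]
  have hs : HasSum (fun p : V × V => inner ℝ (G.diff f p) (w.snd p))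
      (∑ p ∈ S ×ˢ S, inner ℝ (G.diff f p) (w.snd p)) := by
    refine hasSum_sum_of_ne_finset_zero fun p hp => ?_
    rw [hterm]
    by_cases hμ : p.2 ∈ G.nbrs p.1
    · by_cases h1 : p.1 ∈ S
      · have h2 : p.2 ∉ S := fun h => hp (Finset.mem_product.2 ⟨h1, h⟩)
        rw [hS.eq_zero h2, hS.eq_zero_of_mem_nbrs h2 (G.mem_nbrs_comm.1 hμ)]
        ring
      · rw [hS.eq_zero h1, hS.eq_zero_of_mem_nbrs h1 hμ]
        ring
    · rw [G.μ_eq_zero_of_notMem hμ]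
      ring
  have e2 : ∑ p ∈ S ×ˢ S, inner ℝ (G.diff f p) (w.snd p) =
      -(-(1 / 2) * G.pairSum S fun x y => (f y - f x) * (w.fst y - w.fst x)) := by
    rw [Finset.sum_product, pairSum, neg_mul, neg_neg, Finset.mul_sum]
    refine Finset.sum_congr rfl fun x _ => ?_
    rw [Finset.mul_sum]
    exact Finset.sum_congr rfl fun y _ => hterm (x, y)
  rw [← e2]
  exact hs

/-- Symmetry of the generator, tested against the indicator of `x`, moves the Laplacian onto `f` by
Green's formula. -/
theorem IsFormGenerator.eq_laplacian {f g : G.L2} (h : G.IsFormGenerator f g) (x : V) :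
    g x = G.laplacian f x := by
  classical
  have hx := finite_support_single x (1 : ℝ)
  have h1 := h.inner_symm (isFormGenerator_ofFinite hx)
  rw [real_inner_comm, inner_ofFinite_single, one_mul, real_inner_comm] at h1
  obtain ⟨S, hS⟩ := G.exists_covers hx
  have hxS : x ∈ S := (hS x (by simp)).1
  have hlap : ∀ y ∉ S, G.laplacian (Pi.single x 1) y = 0 := fun y hy => by
    rw [laplacian, Finset.sum_eq_zero, mul_zero]
    intro z hz
    rw [hS.eq_zero hy, hS.eq_zero_of_mem_nbrs hy hz, sub_zero, mul_zero]
  rw [inner_eq_sum (S := S) fun y hy => by rw [ofFinite_apply, hlap y hy]] at h1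
  have e1 : ∑ y ∈ S, G.m y * (G.ofFinite (G.finite_support_laplacian hx) y * f y) =
      ∑ y ∈ S, G.m y * (Pi.single x 1 : V → ℝ) y * G.laplacian f y := by
    rw [hS.sum_mul_laplacian, ← hS.sum_laplacian_mul]
    exact Finset.sum_congr rfl fun y _ => by rw [ofFinite_apply]; ring
  rw [e1, Finset.sum_eq_single x] at h1
  · rw [Pi.single_eq_same, mul_one] at h1
    exact mul_left_cancel₀ (G.m_pos x).ne' h1
  · intro y _ hy
    rw [Pi.single_eq_of_ne hy]; ring
  · exact fun h => absurd hxS h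

/-- Lax–Milgram: the equation is the weak form of `⟨f, w⟩ + r Q(f, w) = ⟨h, w⟩` on the form domain.
-/
theorem exists_isFormGenerator_sub_smul {r : ℝ} (hr : 0 < r) (hr1 : r ≤ 1) (h : G.L2) :
    ∃ f g : G.L2, G.IsFormGenerator f g ∧ f - r • g = h := by
  let K := G.energySpace
  have : CompleteSpace K :=
    (Submodule.isClosed_topologicalClosure G.finiteEnergySpace).completeSpace_coe
  let π : K →L[ℝ] G.L2 := (WithLp.fstL 2 ℝ G.L2 (lp (fun _ : V × V => ℝ) 2)).comp K.subtypeL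
  -- The splitting `⟨f, w⟩ + r Q = r(⟨f, w⟩ + Q) + (1 - r)⟨f, w⟩` exhibits coercivity with constant
  -- `r`; this is where `r ≤ 1` is needed.
  let B : K →L[ℝ] K →L[ℝ] ℝ :=
    r • (isBoundedBilinearMap_inner (𝕜 := ℝ) (E := K)).toContinuousLinearMap +
      (1 - r) • (isBoundedBilinearMap_inner (𝕜 := ℝ)
        (E := G.L2)).toContinuousLinearMap.bilinearComp π π
  have hB : ∀ v w : K, B v w = inner ℝ (v : G.EnergyAmbient).fst (w : G.EnergyAmbient).fst +
      r * inner ℝ (v : G.EnergyAmbient).snd (w : G.EnergyAmbient).snd := by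
    intro v w
    have : B v w = r * inner ℝ v w +
      (1 - r) * inner ℝ (v : G.EnergyAmbient).fst (w : G.EnergyAmbient).fst := rfl
    rw [this, Submodule.coe_inner, WithLp.prod_inner_apply]
    change r * (inner ℝ (v : G.EnergyAmbient).fst (w : G.EnergyAmbient).fst +
      inner ℝ (v : G.EnergyAmbient).snd (w : G.EnergyAmbient).snd) + _ = _
    ring
  have hcoer : IsCoercive B := by
    refine ⟨r, hr, fun v => ?_⟩
    have : B v v = r * inner ℝ v v +
      (1 - r) * inner ℝ (v : G.EnergyAmbient).fst (v : G.EnergyAmbient).fst := rfl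
    rw [this, real_inner_self_eq_norm_mul_norm, ← mul_assoc, real_inner_self_eq_norm_sq]
    exact le_add_of_nonneg_right (mul_nonneg (sub_nonneg.2 hr1) (sq_nonneg _))
  let ℓ : StrongDual ℝ K := (innerSL ℝ h).comp π
  let v : K := hcoer.continuousLinearEquivOfBilin.symm ((InnerProductSpace.toDual ℝ K).symm ℓ)
  have hv : ∀ w : K, B v w = inner ℝ h (w : G.EnergyAmbient).fst := by
    intro w
    rw [← hcoer.continuousLinearEquivOfBilin_apply, ContinuousLinearEquiv.apply_symm_apply,
      InnerProductSpace.toDual_symm_apply]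
    rfl
  refine ⟨(v : G.EnergyAmbient).fst, r⁻¹ • ((v : G.EnergyAmbient).fst - h),
    isFormGenerator_iff.2 ⟨v, v.2, rfl, fun w hw => ?_⟩, ?_⟩
  · have h1 := hv ⟨w, hw⟩
    rw [hB] at h1
    rw [real_inner_smul_left, inner_sub_left, ← h1]
    field_simp
    ring
  · rw [smul_inv_smul₀ hr.ne', sub_sub_cancel]

variable (G) in
/-- The graph of the generator of the Dirichlet form, as a linear relation. -/
noncomputable def formGenerator : Submodule ℝ (G.L2 × G.L2) where
  carrier := {p | G.IsFormGenerator p.1 p.2}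
  add_mem' {p q} hp hq := by
    obtain ⟨v, hv, hv1, h⟩ := isFormGenerator_iff.1 hp
    obtain ⟨v', hv', hv1', h'⟩ := isFormGenerator_iff.1 hq
    refine isFormGenerator_iff.2 ⟨v + v', Submodule.add_mem _ hv hv', ?_, fun w hw => ?_⟩
    · rw [WithLp.add_fst, hv1, hv1', Prod.fst_add]
    · rw [WithLp.add_snd, inner_add_left, h w hw, h' w hw, Prod.snd_add, inner_add_left]
      ring
  zero_mem' := isFormGenerator_iff.2 ⟨0, Submodule.zero_mem _, rfl, fun w _ => by simp⟩
  smul_mem' c p hp := by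
    obtain ⟨v, hv, hv1, h⟩ := isFormGenerator_iff.1 hp
    refine isFormGenerator_iff.2 ⟨c • v, Submodule.smul_mem _ _ hv, ?_, fun w hw => ?_⟩
    · rw [WithLp.smul_fst, hv1, Prod.smul_fst]
    · rw [WithLp.smul_snd, real_inner_smul_left, h w hw, Prod.smul_snd, real_inner_smul_left]
      ring

theorem isMDissipative_formGenerator : IsMDissipative G.formGenerator where
  inner_le p hp := by
    have h : G.IsFormGenerator p.1 p.2 := hp
    -- The empty set leaves `0 ≤ -⟨𝓛 f, f⟩`.
    have := h.sum_m_mul_Gamma_le ∅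
    rw [Finset.sum_empty] at this
    linarith
  exists_sub_smul r hr hr1 h := by
    obtain ⟨f, g, hfg, e⟩ := exists_isFormGenerator_sub_smul hr hr1 h
    exact ⟨(f, g), hfg, e⟩
  dense := by
    refine dense_range_ofFinite.mono fun f hf => ?_
    refine ⟨(f, G.ofFinite (G.finite_support_laplacian hf)), ?_, rfl⟩
    have h := isFormGenerator_ofFinite (G := G) hf
    have e : G.ofFinite hf = f := L2_ext fun x => ofFinite_apply hf x
    rwa [e] at h

variable (G) in
theorem isHeatSemigroup_heatSemigroup : G.IsHeatSemigroup G.heatSemigroup := by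
  have h : ∃ P, G.IsHeatSemigroup P := isMDissipative_formGenerator.exists_semigroup
  rw [heatSemigroup, dif_pos h]
  exact h.choose_spec

end Generator

end WeightedGraph

/-! ### Two facts of one-variable calculus. -/

theorem sub_le_mul_of_hasDerivAt_le {f f' : ℝ → ℝ} {a b C : ℝ} (hab : a ≤ b)
    (hf : ContinuousOn f (Set.Icc a b)) (hf' : ∀ s ∈ Set.Ioo a b, HasDerivAt f (f' s) s)
    (hC : ∀ s ∈ Set.Ioo a b, f' s ≤ C) : f b - f a ≤ C * (b - a) := by
  refine (convex_Icc a b).image_sub_le_mul_sub_of_deriv_le hf ?_ ?_ a ⟨le_rfl, hab⟩ b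
    ⟨hab, le_rfl⟩ hab <;> rw [interior_Icc]
  · exact fun s hs => (hf' s hs).differentiableAt.differentiableWithinAt
  · exact fun s hs => (hf' s hs).deriv.trans_le (hC s hs)

/-- Squaring removes the kink: near `0` the function is `O(y²)`. -/
theorem hasDerivAt_max_zero_sq (y : ℝ) :
    HasDerivAt (fun y : ℝ => max y 0 ^ 2) (2 * max y 0) y := by
  rcases lt_trichotomy y 0 with h | rfl | h
  · rw [max_eq_right h.le, mul_zero]
    refine (hasDerivAt_const y (0 : ℝ)).congr_of_eventuallyEq ?_
    filter_upwards [gt_mem_nhds h] with z hz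
    rw [max_eq_right hz.le]; norm_num
  · rw [max_self, mul_zero, hasDerivAt_iff_hasFDerivAt]
    have hO : (fun y : ℝ => max y 0 ^ 2) =O[𝓝 0] fun y => ‖y - 0‖ ^ 2 := by
      refine Asymptotics.IsBigO.of_bound 1 (Eventually.of_forall fun z => ?_)
      rw [one_mul, sub_zero, norm_pow, norm_pow, norm_norm, Real.norm_eq_abs, Real.norm_eq_abs,
        sq_abs, sq_abs]
      rcases max_cases z 0 with ⟨h, h'⟩ | ⟨h, h'⟩ <;> rw [h]
      rw [zero_pow two_ne_zero]; exact sq_nonneg z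
    have hF := hO.hasFDerivAt one_lt_two (𝕜 := ℝ)
    exact hF.congr_fderiv (by ext; simp)
  · rw [max_eq_left h.le]
    refine ((hasDerivAt_id y).fun_pow 2).congr_of_eventuallyEq ?_ |>.congr_deriv (by simp)
    filter_upwards [lt_mem_nhds h] with z hz
    rw [max_eq_left hz.le]; rfl

namespace WeightedGraph

variable {V : Type*} (G : WeightedGraph V)

/-! ### The heat flow of finitely supported functions. -/

section HeatBasic

variable {G}

theorem isC0Semigroup_heatSemigroup : IsC0Semigroup G.heatSemigroup :=
  G.isHeatSemigroup_heatSemigroup.1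

theorem heat_eq {f : V → ℝ} (hf : f.support.Finite) (t : ℝ≥0) :
    G.heat t f = G.heatSemigroup t (G.ofFinite hf) := by
  rw [heat, dif_pos (G.memLp_of_finite_support hf)]; rfl

theorem heat_zero {f : V → ℝ} (hf : f.support.Finite) : G.heat 0 f = f := by
  rw [heat_eq hf, isC0Semigroup_heatSemigroup.zero]
  exact funext fun x => ofFinite_apply hf x

theorem hasInfinitesimalGenerator_ofFinite {f : V → ℝ} (hf : f.support.Finite) :
    HasInfinitesimalGenerator G.heatSemigroup (G.ofFinite hf)
      (G.ofFinite (G.finite_support_laplacian hf)) :=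
  (G.isHeatSemigroup_heatSemigroup.2 _ _).2 (isFormGenerator_ofFinite hf)

theorem isFormGenerator_heatSemigroup {f : V → ℝ} (hf : f.support.Finite) (t : ℝ≥0) :
    G.IsFormGenerator (G.heatSemigroup t (G.ofFinite hf))
      (G.heatSemigroup t (G.ofFinite (G.finite_support_laplacian hf))) :=
  (G.isHeatSemigroup_heatSemigroup.2 _ _).1
    (isC0Semigroup_heatSemigroup.hasInfinitesimalGenerator_apply
      (hasInfinitesimalGenerator_ofFinite hf) t)

theorem laplacian_heat {f : V → ℝ} (hf : f.support.Finite) (t : ℝ≥0) :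
    G.laplacian (G.heat t f) = G.heat t (G.laplacian f) := by
  funext x
  rw [heat_eq hf, heat_eq (G.finite_support_laplacian hf)]
  exact ((isFormGenerator_heatSemigroup hf t).eq_laplacian x).symm

theorem heat_neg {f : V → ℝ} (hf : f.support.Finite) (t : ℝ≥0) (x : V) :
    G.heat t (-f) x = -G.heat t f x := by
  have hf' : (-f).support.Finite := by rwa [Function.support_neg]
  have e : G.ofFinite hf' = (-1 : ℝ) • G.ofFinite hf := L2_ext fun x => by
    rw [coe_smul_apply, ofFinite_apply, ofFinite_apply]; simp
  rw [heat_eq hf, heat_eq hf', e, map_smul, coe_smul_apply, neg_one_mul]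

theorem continuous_heat {f : V → ℝ} (hf : f.support.Finite) (x : V) :
    Continuous fun t : ℝ => G.heat t.toNNReal f x := by
  have := (G.evalL x).continuous.comp
    (isC0Semigroup_heatSemigroup.continuous_toNNReal (G.ofFinite hf))
  refine this.congr fun t => ?_
  rw [heat_eq hf, Function.comp, evalL_apply]

theorem hasDerivAt_heat {f : V → ℝ} (hf : f.support.Finite) (x : V) {t : ℝ} (ht : 0 < t) :
    HasDerivAt (fun t : ℝ => G.heat t.toNNReal f x) (G.heat t.toNNReal (G.laplacian f) x) t := by
  have := (G.evalL x).hasFDerivAt.comp_hasDerivAt t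
    (isC0Semigroup_heatSemigroup.hasDerivAt (hasInfinitesimalGenerator_ofFinite hf) ht)
  simp only [evalL_apply] at this
  simp only [heat_eq hf, heat_eq (G.finite_support_laplacian hf)]
  exact this.congr_of_eventuallyEq (Eventually.of_forall fun s => by simp)

theorem hasDerivWithinAt_heat {f : V → ℝ} (hf : f.support.Finite) (x : V) :
    HasDerivWithinAt (fun t : ℝ => G.heat t.toNNReal f x) (G.laplacian f x) (Set.Ici 0) 0 := by
  have := (G.evalL x).hasFDerivAt.comp_hasDerivWithinAt 0
    (isC0Semigroup_heatSemigroup.hasDerivWithinAt_Ici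
      (hasInfinitesimalGenerator_ofFinite (G := G) hf) le_rfl)
  rw [Real.toNNReal_zero, isC0Semigroup_heatSemigroup.zero] at this
  simp only [evalL_apply, ContinuousLinearMap.id_apply, ofFinite_apply] at this
  simp only [heat_eq hf]
  exact this.congr (fun s _ => by simp) (by simp)

/-- Contractivity is not part of `IsHeatSemigroup`. It follows from `d/ds ‖P_s f‖² = 2⟨𝓛 P_s f, P_s
f⟩ ≤ 0`. -/
theorem norm_heatSemigroup_ofFinite_le {f : V → ℝ} (hf : f.support.Finite) (t : ℝ≥0) :
    ‖G.heatSemigroup t (G.ofFinite hf)‖ ≤ ‖G.ofFinite hf‖ := by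
  have hc := isC0Semigroup_heatSemigroup.continuous_toNNReal (G.ofFinite hf)
  have h := sub_le_mul_of_hasDerivAt_le (C := 0) t.coe_nonneg (hc.norm.pow 2).continuousOn
    (fun s hs => (isC0Semigroup_heatSemigroup.hasDerivAt
      (hasInfinitesimalGenerator_ofFinite hf) hs.1).norm_sq) fun s _ => by
    have h := (isFormGenerator_heatSemigroup (G := G) hf s.toNNReal).sum_m_mul_Gamma_le ∅
    rw [Finset.sum_empty, real_inner_comm] at h
    linarith
  simp only [Pi.pow_apply] at h
  rw [Real.toNNReal_coe, Real.toNNReal_zero, isC0Semigroup_heatSemigroup.zero, zero_mul, sub_nonpos] at h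
  exact (sq_le_sq₀ (norm_nonneg _) (norm_nonneg _)).1 h

theorem sum_m_mul_heat_sq_le {f : V → ℝ} (hf : f.support.Finite) (t : ℝ≥0) (S : Finset V) :
    ∑ x ∈ S, G.m x * G.heat t f x ^ 2 ≤ ‖G.ofFinite hf‖ ^ 2 := by
  rw [heat_eq hf]
  refine (sum_m_mul_sq_le _ S).trans ?_
  gcongr
  exact norm_heatSemigroup_ofFinite_le hf t

/-- The energy of `P_t f` is `-⟨P_t Δf, P_t f⟩`, and both factors are contracted. -/
theorem sum_m_mul_Gamma_heat_le {f : V → ℝ} (hf : f.support.Finite) (t : ℝ≥0) (S : Finset V) :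
    ∑ x ∈ S, G.m x * G.Gamma (G.heat t f) (G.heat t f) x ≤
      ‖G.ofFinite (G.finite_support_laplacian hf)‖ * ‖G.ofFinite hf‖ := by
  rw [heat_eq hf]
  refine ((isFormGenerator_heatSemigroup hf t).sum_m_mul_Gamma_le S).trans ?_
  refine (neg_le_abs _).trans ((abs_real_inner_le_norm _ _).trans ?_)
  exact mul_le_mul (norm_heatSemigroup_ofFinite_le _ t) (norm_heatSemigroup_ofFinite_le hf t)
    (norm_nonneg _) (norm_nonneg _)

/-- The function `s ↦ ⟨P_s f, P_{t-s} g⟩` has zero derivative by symmetry of the generator; compare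
its ends. -/
theorem inner_heatSemigroup_comm {f g : V → ℝ} (hf : f.support.Finite) (hg : g.support.Finite)
    (t : ℝ≥0) :
    inner ℝ (G.heatSemigroup t (G.ofFinite hf)) (G.ofFinite hg) =
      inner ℝ (G.ofFinite hf) (G.heatSemigroup t (G.ofFinite hg)) := by
  set F : ℝ → ℝ := fun s => inner ℝ (G.heatSemigroup s.toNNReal (G.ofFinite hf))
    (G.heatSemigroup ((t : ℝ) - s).toNNReal (G.ofFinite hg)) with hF
  have hc : Continuous F :=
    (isC0Semigroup_heatSemigroup.continuous_toNNReal (G.ofFinite hf)).inner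
      ((isC0Semigroup_heatSemigroup.continuous_toNNReal (G.ofFinite hg)).comp
        (continuous_const.sub continuous_id))
  have hd : ∀ s ∈ Set.Ioo (0 : ℝ) t, HasDerivAt F 0 s := by
    intro s hs
    have h1 := isC0Semigroup_heatSemigroup.hasDerivAt
      (hasInfinitesimalGenerator_ofFinite (G := G) hf) hs.1
    have h2 := (isC0Semigroup_heatSemigroup.hasDerivAt
      (hasInfinitesimalGenerator_ofFinite (G := G) hg) (sub_pos.2 hs.2)).scomp s
      ((hasDerivAt_id s).const_sub (t : ℝ))
    refine (h1.inner ℝ h2).congr_deriv ?_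
    have h3 := (isFormGenerator_heatSemigroup (G := G) hf s.toNNReal).inner_symm
      (isFormGenerator_heatSemigroup hg ((t : ℝ) - s).toNNReal)
    rw [Function.comp, h3, neg_one_smul, inner_neg_right, neg_add_cancel]
  have e1 := sub_le_mul_of_hasDerivAt_le t.coe_nonneg hc.continuousOn hd fun _ _ => le_rfl
  have e2 := sub_le_mul_of_hasDerivAt_le t.coe_nonneg hc.neg.continuousOn
    (fun s hs => (hd s hs).neg) fun _ _ => neg_zero.le
  have e3 : F t = F 0 := by
    simp only [Pi.neg_apply, zero_mul] at e1 e2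
    exact le_antisymm (by linarith [e1]) (by linarith [e2])
  simpa [hF, isC0Semigroup_heatSemigroup.zero] using e3

end HeatBasic

/-! ### Cut-off functions under either alternative of (A). -/

section Cutoffs

/-- A sequence of finitely supported cut-off functions `0 ≤ η_k ≤ 1` that converges to `1`
pointwise and has `Γ(η_k) ≤ δ_k²` with `δ_k → 0`. -/
structure IsCutoffSeq (η : ℕ → V → ℝ) (δ : ℕ → ℝ) : Prop where
  finite_support : ∀ k, (η k).support.Finite
  sq_le_one : ∀ k x, η k x ^ 2 ≤ 1
  tendsto_one : ∀ x, Tendsto (fun k => η k x) atTop (𝓝 1)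
  pos : ∀ k, 0 < δ k
  tendsto_zero : Tendsto δ atTop (𝓝 0)
  Gamma_le : ∀ k x, G.Gamma (η k) (η k) x ≤ δ k ^ 2

variable {G}

theorem Complete.exists_isCutoffSeq (h : G.Complete) : ∃ η δ, G.IsCutoffSeq η δ := by
  obtain ⟨η, hmono, hfin, hnn, hlim, hΓ⟩ := h
  refine ⟨η, fun k => √(1 / ((k : ℝ) + 1)), hfin, fun k x => ?_, hlim, fun k => ?_, ?_,
    fun k x => ?_⟩
  · have h1 : η k x ≤ 1 :=
      (show Monotone fun k => η k x from fun i j hij => hmono hij x).ge_of_tendsto (hlim x) k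
    exact pow_le_one₀ (hnn k x) h1
  · exact Real.sqrt_pos.2 (by positivity)
  · simpa using (tendsto_one_div_add_atTop_nhds_zero_nat (𝕜 := ℝ)).sqrt
  · rw [Real.sq_sqrt (by positivity)]
    exact hΓ k x

variable (G) in
theorem finite_setOf_walk_length (n : ℕ) :
    ∀ x, {y | ∃ p : G.graph.Walk x y, p.length = n}.Finite := by
  induction n with
  | zero =>
    refine fun x => (Set.finite_singleton x).subset ?_
    rintro y ⟨p, hp⟩
    exact (SimpleGraph.Walk.eq_of_length_eq_zero hp).symm
  | succ n ih =>
    intro x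
    refine ((G.nbrs x).finite_toSet.biUnion fun z _ => ih z).subset ?_
    rintro y ⟨p, hp⟩
    cases p with
    | nil => simp at hp
    | cons h p =>
      simp only [SimpleGraph.Walk.length_cons, add_left_inj] at hp
      exact Set.mem_biUnion (Finset.mem_coe.2 (G.mem_nbrs.2 h)) ⟨p, hp⟩

variable (G) in
theorem finite_setOf_dist_lt (x : V) (n : ℕ) : {y | G.graph.dist x y < n}.Finite := by
  refine ((Set.finite_lt_nat n).biUnion fun k _ => G.finite_setOf_walk_length k x).subset ?_
  intro y hy
  obtain ⟨p, hp⟩ := G.connected.exists_walk_length_eq_dist x y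
  exact Set.mem_biUnion hy ⟨p, hp⟩

theorem Gamma_self_le {f : V → ℝ} {x : V} {c : ℝ} (hf : ∀ y ∈ G.nbrs x, (f y - f x) ^ 2 ≤ c) :
    G.Gamma f f x ≤ c / 2 * (1 / G.m x * ∑ y ∈ G.nbrs x, G.μ x y) := by
  have h : G.Gamma f f x ≤ 1 / (2 * G.m x) * ∑ y ∈ G.nbrs x, G.μ x y * c := by
    rw [Gamma_apply]
    have := G.m_pos x
    refine mul_le_mul_of_nonneg_left (Finset.sum_le_sum fun y hy => ?_) (by positivity)
    rw [← sq]
    exact mul_le_mul_of_nonneg_left (hf y hy) (G.μ_nonneg x y)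
  refine h.trans_eq ?_
  have := (G.m_pos x).ne'
  rw [← Finset.sum_mul]
  field_simp

theorem BoundedLaplacian.exists_isCutoffSeq (h : G.BoundedLaplacian) :
    ∃ η δ, G.IsCutoffSeq η δ := by
  obtain ⟨D, hD⟩ := h
  have hD : ∀ x, 1 / G.m x * ∑ y ∈ G.nbrs x, G.μ x y ≤ D := fun x => hD ⟨x, rfl⟩
  have hD0 : 0 ≤ D := by
    obtain ⟨x₀⟩ := G.connected.nonempty
    refine le_trans ?_ (hD x₀)
    have := G.m_pos x₀
    exact mul_nonneg (by positivity) (Finset.sum_nonneg fun y _ => G.μ_nonneg _ _)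
  obtain ⟨x₀⟩ := G.connected.nonempty
  have hk : ∀ k : ℕ, (0 : ℝ) < k + 1 := fun k => by positivity
  -- Tents of slope `1/(k+1)` in the graph distance, with finite support by local finiteness. The `+
  -- 1` under the root keeps `δ_k` positive when `D = 0`.
  refine ⟨fun k x => max (1 - G.graph.dist x₀ x / ((k : ℝ) + 1)) 0,
    fun k => √(D + 1) / ((k : ℝ) + 1), fun k => ?_, fun k x => ?_, fun x => ?_, fun k => ?_, ?_,
    fun k x => ?_⟩
  · refine (G.finite_setOf_dist_lt x₀ (k + 1)).subset fun x hx => ?_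
    by_contra h
    refine hx (max_eq_right ?_)
    rw [sub_nonpos, one_le_div (hk k)]
    exact_mod_cast not_lt.1 h
  · refine pow_le_one₀ (le_max_right _ _) (max_le ?_ zero_le_one)
    rw [sub_le_self_iff]
    exact div_nonneg (Nat.cast_nonneg _) (hk k).le
  · have h1 : Tendsto (fun k : ℕ => (G.graph.dist x₀ x : ℝ) / ((k : ℝ) + 1)) atTop (𝓝 0) := by
      have := (tendsto_one_div_add_atTop_nhds_zero_nat (𝕜 := ℝ)).const_mul
        (G.graph.dist x₀ x : ℝ)
      simpa [div_eq_mul_inv] using this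
    have h2 := (h1.const_sub 1).max (tendsto_const_nhds (x := (0 : ℝ)))
    simpa using h2
  · exact div_pos (Real.sqrt_pos.2 (by linarith)) (hk k)
  · have := (tendsto_one_div_add_atTop_nhds_zero_nat (𝕜 := ℝ)).const_mul (√(D + 1))
    simpa [div_eq_mul_inv] using this
  · have hstep : ∀ y ∈ G.nbrs x, (max (1 - G.graph.dist x₀ y / ((k : ℝ) + 1)) 0 -
        max (1 - G.graph.dist x₀ x / ((k : ℝ) + 1)) 0) ^ 2 ≤ (1 / ((k : ℝ) + 1)) ^ 2 := by
      intro y hy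
      have hadj := G.mem_nbrs.1 hy
      have hxy : G.graph.dist x y = 1 := SimpleGraph.dist_eq_one_iff_adj.2 hadj
      have h1 : G.graph.dist x₀ y ≤ G.graph.dist x₀ x + 1 :=
        (G.connected.dist_triangle (v := x)).trans_eq (by rw [hxy])
      have h2 : G.graph.dist x₀ x ≤ G.graph.dist x₀ y + 1 :=
        (G.connected.dist_triangle (v := y)).trans_eq (by
          rw [SimpleGraph.dist_comm (u := y) (v := x), hxy])
      have h1' : (G.graph.dist x₀ y : ℝ) ≤ G.graph.dist x₀ x + 1 := by exact_mod_cast h1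
      have h2' : (G.graph.dist x₀ x : ℝ) ≤ G.graph.dist x₀ y + 1 := by exact_mod_cast h2
      rw [sq_le_sq, abs_of_pos (a := 1 / ((k : ℝ) + 1)) (one_div_pos.2 (hk k))]
      refine (abs_max_sub_max_le_abs _ _ _).trans ?_
      rw [sub_sub_sub_cancel_left, ← sub_div, abs_div, abs_of_pos (hk k)]
      refine div_le_div_of_nonneg_right ?_ (hk k).le
      rw [abs_le]
      constructor <;> linarith
    refine (Gamma_self_le hstep).trans ?_
    rw [div_pow, div_pow, Real.sq_sqrt (by linarith), one_pow, div_div, mul_comm, mul_one_div]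
    have hs := hD x
    have hk2 := hk k
    rw [div_le_div_iff₀ (by positivity) (by positivity)]
    nlinarith [sq_nonneg ((k : ℝ) + 1)]

theorem AssumptionA.exists_isCutoffSeq (h : G.AssumptionA) : ∃ η δ, G.IsCutoffSeq η δ := by
  rcases h with h | h
  · exact h.exists_isCutoffSeq
  · exact h.1.exists_isCutoffSeq

end Cutoffs

/-! ### Maximum principle and uniform bounds along the flow. -/

section MaximumPrinciple

variable {G}

theorem sq_max_sub_zero_le {a c : ℝ} (hc : a ≤ c) : max (a - c) 0 ^ 2 = 0 := by
  rw [max_eq_right (by linarith), zero_pow two_ne_zero]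

/-- The sum of `m η_k² ((P_s f - c)₊)²` vanishes at `s = 0` and has derivative at most `2 δ_k C`,
with `C` independent of `k`. As `k → ∞` the positive part must vanish. -/
theorem IsCutoffSeq.heat_le {η : ℕ → V → ℝ} {δ : ℕ → ℝ} (hη : G.IsCutoffSeq η δ) {f : V → ℝ}
    (hf : f.support.Finite) {c : ℝ} (hc : 0 ≤ c) (hfc : ∀ x, f x ≤ c) (t : ℝ≥0) (x : V) :
    G.heat t f x ≤ c := by
  set C : ℝ := ‖G.ofFinite hf‖ ^ 2 +
    ‖G.ofFinite (G.finite_support_laplacian hf)‖ * ‖G.ofFinite hf‖ with hC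
  set w : ℝ → V → ℝ := fun s y => max (G.heat s.toNNReal f y - c) 0 with hw
  have key : ∀ k, G.m x * η k x ^ 2 * w t x ^ 2 ≤ 2 * (δ k * C) * t := by
    intro k
    classical
    obtain ⟨S₀, hS₀⟩ := G.exists_covers (hη.finite_support k)
    -- Adding `x` to the set lets the single term at `x` bound the sum from below.
    have hS := hS₀.mono (Finset.subset_insert x S₀)
    set S := insert x S₀
    have hcont : Continuous fun s : ℝ => ∑ y ∈ S, G.m y * η k y ^ 2 * w s y ^ 2 := by
      refine continuous_finsetSum _ fun y _ => continuous_const.mul (Continuous.pow ?_ 2)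
      exact ((continuous_heat hf y).sub continuous_const).max continuous_const
    have hd : ∀ s ∈ Set.Ioo (0 : ℝ) t, HasDerivAt
        (fun s : ℝ => ∑ y ∈ S, G.m y * η k y ^ 2 * w s y ^ 2)
        (∑ y ∈ S, G.m y * η k y ^ 2 *
          (2 * w s y * G.laplacian (G.heat s.toNNReal f) y)) s := by
      intro s hs
      refine HasDerivAt.fun_sum fun y _ => HasDerivAt.const_mul _ ?_
      rw [laplacian_heat hf]
      have h1 := (hasDerivAt_heat (G := G) hf y hs.1).sub_const c
      exact (hasDerivAt_max_zero_sq _).comp s h1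
    have hb := sub_le_mul_of_hasDerivAt_le t.coe_nonneg hcont.continuousOn hd
      (C := 2 * (δ k * C)) fun s _ => by
        have h1 := sum_sq_mul_posPart_mul_laplacian_le hS (hη.pos k) (hη.Gamma_le k)
          (hη.sq_le_one k) (G.heat s.toNNReal f) hc
        have h2 := sum_m_mul_heat_sq_le (G := G) hf s.toNNReal S
        have h3 := sum_m_mul_Gamma_heat_le (G := G) hf s.toNNReal S
        have h4 : ∑ y ∈ S, G.m y * η k y ^ 2 *
            (2 * w s y * G.laplacian (G.heat s.toNNReal f) y) =
            2 * ∑ y ∈ S, G.m y * η k y ^ 2 *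
            (w s y * G.laplacian (G.heat s.toNNReal f) y) := by
          rw [Finset.mul_sum]
          exact Finset.sum_congr rfl fun y _ => by ring
        rw [h4]
        refine mul_le_mul_of_nonneg_left (h1.trans ?_) zero_le_two
        exact mul_le_mul_of_nonneg_left (add_le_add h2 h3) (hη.pos k).le
    have h0 : ∑ y ∈ S, G.m y * η k y ^ 2 * w 0 y ^ 2 = 0 := by
      refine Finset.sum_eq_zero fun y _ => ?_
      simp only [hw, Real.toNNReal_zero, heat_zero hf]
      rw [sq_max_sub_zero_le (hfc y), mul_zero]
    simp only [h0, sub_zero] at hb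
    refine le_trans ?_ hb
    exact Finset.single_le_sum (f := fun y => G.m y * η k y ^ 2 * w t y ^ 2)
      (fun y _ => mul_nonneg (mul_nonneg (G.m_pos y).le (sq_nonneg _)) (sq_nonneg _))
      (Finset.mem_insert_self x S₀)
  have hl : Tendsto (fun k => G.m x * η k x ^ 2 * w t x ^ 2) atTop
      (𝓝 (G.m x * 1 ^ 2 * w t x ^ 2)) :=
    (((hη.tendsto_one x).pow 2).const_mul _).mul_const _
  have hr : Tendsto (fun k => 2 * (δ k * C) * (t : ℝ)) atTop (𝓝 (2 * (0 * C) * t)) :=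
    ((hη.tendsto_zero.mul_const C).const_mul 2).mul_const _
  have h := le_of_tendsto_of_tendsto' hl hr key
  simp only [one_pow, mul_one, zero_mul, mul_zero] at h
  have hw0 : w t x ^ 2 ≤ 0 := by
    by_contra hpos
    exact absurd h (not_le.2 (mul_pos (G.m_pos x) (not_le.1 hpos)))
  have hw1 : w t x = 0 := by
    have := le_antisymm hw0 (sq_nonneg _)
    simpa using this
  have := le_max_left (G.heat (t : ℝ).toNNReal f x - c) 0
  rw [show max (G.heat (t : ℝ).toNNReal f x - c) 0 = 0 from hw1, Real.toNNReal_coe] at this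
  linarith

theorem IsCutoffSeq.heat_nonneg {η : ℕ → V → ℝ} {δ : ℕ → ℝ} (hη : G.IsCutoffSeq η δ) {f : V → ℝ}
    (hf : f.support.Finite) (hf0 : ∀ x, 0 ≤ f x) (t : ℝ≥0) (x : V) : 0 ≤ G.heat t f x := by
  have hf' : (-f).support.Finite := by rwa [Function.support_neg]
  have := hη.heat_le hf' le_rfl (fun x => by simpa using hf0 x) t x
  rw [heat_neg hf] at this
  linarith

theorem IsCutoffSeq.exists_abs_heat_le {η : ℕ → V → ℝ} {δ : ℕ → ℝ} (hη : G.IsCutoffSeq η δ)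
    {f : V → ℝ} (hf : f.support.Finite) : ∃ M, 0 ≤ M ∧ ∀ t x, |G.heat t f x| ≤ M := by
  set M := ∑ x ∈ hf.toFinset, |f x|
  have hM : ∀ x, |f x| ≤ M := by
    intro x
    by_cases hx : x ∈ hf.toFinset
    · exact Finset.single_le_sum (f := fun x => |f x|) (fun y _ => abs_nonneg _) hx
    · have : f x = 0 := by simpa using hx
      rw [this, abs_zero]
      exact Finset.sum_nonneg fun y _ => abs_nonneg _
  have hM0 : 0 ≤ M := Finset.sum_nonneg fun y _ => abs_nonneg _
  refine ⟨M, hM0, fun t x => abs_le'.2 ⟨?_, ?_⟩⟩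
  · exact hη.heat_le hf hM0 (fun x => (le_abs_self _).trans (hM x)) t x
  · have hf' : (-f).support.Finite := by rwa [Function.support_neg]
    rw [← heat_neg hf]
    exact hη.heat_le hf' hM0
      (fun x => (neg_le_abs _).trans (hM x)) t x

/-- Apart from producing cut-offs, this is what (A) is for. If `Δ` is bounded, `Γ(u)` is controlled
by `sup |u|`; if `m ≥ c`, a single vertex carries at most the total energy divided by `c`. -/
theorem AssumptionA.exists_Gamma_heat_le (h : G.AssumptionA) {f : V → ℝ}
    (hf : f.support.Finite) :
    ∃ B, 0 ≤ B ∧ ∀ t x, G.Gamma (G.heat t f) (G.heat t f) x ≤ B := by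
  obtain ⟨η, δ, hη⟩ := h.exists_isCutoffSeq
  have hnn : ∀ B : ℝ, (∀ t x, G.Gamma (G.heat t f) (G.heat t f) x ≤ B) →
      ∃ B, 0 ≤ B ∧ ∀ t x, G.Gamma (G.heat t f) (G.heat t f) x ≤ B := fun B hB =>
    ⟨max B 0, le_max_right _ _, fun t x => (hB t x).trans (le_max_left _ _)⟩
  rcases h with ⟨D, hD⟩ | ⟨-, c, hc, hm⟩
  · obtain ⟨M, hM0, hM⟩ := hη.exists_abs_heat_le hf
    refine hnn ((2 * M) ^ 2 / 2 * D) fun t x => ?_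
    refine (Gamma_self_le (c := (2 * M) ^ 2) fun y _ => ?_).trans
      (mul_le_mul_of_nonneg_left (hD ⟨x, rfl⟩) (by positivity))
    refine sq_le_sq' ?_ ?_ <;>
      linarith [(abs_le.1 (hM t x)).1, (abs_le.1 (hM t x)).2, (abs_le.1 (hM t y)).1,
        (abs_le.1 (hM t y)).2]
  · refine hnn (‖G.ofFinite (G.finite_support_laplacian hf)‖ * ‖G.ofFinite hf‖ / c) fun t x => ?_
    have h1 := sum_m_mul_Gamma_heat_le (G := G) hf t {x}
    rw [Finset.sum_singleton] at h1
    rw [le_div_iff₀ hc, mul_comm]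
    exact (mul_le_mul_of_nonneg_right (hm x) (G.Gamma_self_nonneg _ x)).trans h1

end MaximumPrinciple

/-! ### Interpolation along the heat flow, with cut-offs. -/

section Interpolation

variable {G}

theorem hasDerivWithinAt_Gamma_self {u : ℝ → V → ℝ} {u' : V → ℝ} {s : ℝ} {A : Set ℝ}
    (hu : ∀ y, HasDerivWithinAt (fun s => u s y) (u' y) A s) (x : V) :
    HasDerivWithinAt (fun s => G.Gamma (u s) (u s) x) (2 * G.Gamma (u s) u' x) A s := by
  simp only [Gamma_apply]
  have h : HasDerivWithinAt
      (fun s => ∑ y ∈ G.nbrs x, G.μ x y * ((u s y - u s x) * (u s y - u s x)))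
      (∑ y ∈ G.nbrs x, G.μ x y * ((u' y - u' x) * (u s y - u s x) +
        (u s y - u s x) * (u' y - u' x))) A s := by
    refine HasDerivWithinAt.fun_sum fun y _ => HasDerivWithinAt.const_mul _ ?_
    exact ((hu y).fun_sub (hu x)).fun_mul ((hu y).fun_sub (hu x))
  refine (h.const_mul _).congr_deriv ?_
  simp only [Finset.mul_sum]
  exact Finset.sum_congr rfl fun y _ => by ring

theorem hasDerivAt_Gamma_self {u : ℝ → V → ℝ} {u' : V → ℝ} {s : ℝ}
    (hu : ∀ y, HasDerivAt (fun s => u s y) (u' y) s) (x : V) :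
    HasDerivAt (fun s => G.Gamma (u s) (u s) x) (2 * G.Gamma (u s) u' x) s := by
  simp only [← hasDerivWithinAt_univ] at hu ⊢
  exact hasDerivWithinAt_Gamma_self hu x

theorem continuous_Gamma_self {u : ℝ → V → ℝ} (hu : ∀ y, Continuous fun s => u s y) (x : V) :
    Continuous fun s => G.Gamma (u s) (u s) x := by
  simp only [Gamma_apply]
  exact continuous_const.mul (continuous_finsetSum _ fun y _ => continuous_const.mul
    (((hu y).sub (hu x)).mul ((hu y).sub (hu x))))

theorem Gamma_neg_right (f g : V → ℝ) (x : V) : G.Gamma f (-g) x = -G.Gamma f g x := by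
  simp only [Gamma_apply, Finset.mul_sum, ← Finset.sum_neg_distrib, Pi.neg_apply]
  exact Finset.sum_congr rfl fun y _ => by ring

theorem hasDerivAt_heat_sub {f : V → ℝ} (hf : f.support.Finite) (x : V) {t s : ℝ} (hs : s < t) :
    HasDerivAt (fun s : ℝ => G.heat (t - s).toNNReal f x)
      (-G.laplacian (G.heat (t - s).toNNReal f) x) s := by
  have h := (hasDerivAt_heat (G := G) hf x (sub_pos.2 hs)).comp s ((hasDerivAt_id s).const_sub t)
  rw [laplacian_heat hf]
  exact h.congr_deriv (mul_neg_one _)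

theorem continuous_heat_sub {f : V → ℝ} (hf : f.support.Finite) (x : V) (t : ℝ) :
    Continuous fun s : ℝ => G.heat (t - s).toNNReal f x :=
  (continuous_heat hf x).comp (continuous_const.sub continuous_id)

theorem CD.Gamma2_nonneg (h : G.CD 0 ⊤) (f : V → ℝ) (x : V) : 0 ≤ G.Gamma2 f x := by
  simpa using h f x

/-- Uniform bounds, along the heat flow from `f` and `ψ`, on everything that enters the
cut-off errors. -/
structure HeatBounds (f ψ : V → ℝ) (C B M : ℝ) : Prop where
  sum_sq_le : ∀ t S, ∑ x ∈ S, G.m x * G.heat t ψ x ^ 2 ≤ C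
  sum_Gamma_le : ∀ t S, ∑ x ∈ S, G.m x * G.Gamma (G.heat t ψ) (G.heat t ψ) x ≤ C
  sum_sq_le' : ∀ t S, ∑ x ∈ S, G.m x * G.heat t f x ^ 2 ≤ C
  sum_Gamma_le' : ∀ t S, ∑ x ∈ S, G.m x * G.Gamma (G.heat t f) (G.heat t f) x ≤ C
  sum_Gamma_laplacian_le' : ∀ t S, ∑ x ∈ S, G.m x *
    G.Gamma (G.laplacian (G.heat t f)) (G.laplacian (G.heat t f)) x ≤ C
  Gamma_le : ∀ t x, G.Gamma (G.heat t f) (G.heat t f) x ≤ B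
  abs_le : ∀ t x, |G.heat t f x| ≤ M
  nonneg : 0 ≤ C
  nonneg' : 0 ≤ B
  nonneg'' : 0 ≤ M

theorem AssumptionA.exists_heatBounds (h : G.AssumptionA) {f ψ : V → ℝ} (hf : f.support.Finite)
    (hψ : ψ.support.Finite) : ∃ C B M, HeatBounds (G := G) f ψ C B M := by
  obtain ⟨η, δ, hη⟩ := h.exists_isCutoffSeq
  obtain ⟨B, hB0, hB⟩ := h.exists_Gamma_heat_le hf
  obtain ⟨M, hM0, hM⟩ := hη.exists_abs_heat_le hf
  have hf' := G.finite_support_laplacian hf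
  set c₁ := ‖G.ofFinite hψ‖ ^ 2
  set c₂ := ‖G.ofFinite (G.finite_support_laplacian hψ)‖ * ‖G.ofFinite hψ‖
  set c₃ := ‖G.ofFinite hf‖ ^ 2
  set c₄ := ‖G.ofFinite hf'‖ * ‖G.ofFinite hf‖
  set c₅ := ‖G.ofFinite (G.finite_support_laplacian hf')‖ * ‖G.ofFinite hf'‖
  have h1 : 0 ≤ c₁ := sq_nonneg _
  have h2 : 0 ≤ c₂ := mul_nonneg (norm_nonneg _) (norm_nonneg _)
  have h3 : 0 ≤ c₃ := sq_nonneg _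
  have h4 : 0 ≤ c₄ := mul_nonneg (norm_nonneg _) (norm_nonneg _)
  have h5 : 0 ≤ c₅ := mul_nonneg (norm_nonneg _) (norm_nonneg _)
  refine ⟨c₁ + c₂ + c₃ + c₄ + c₅, B, M, fun t S => ?_, fun t S => ?_, fun t S => ?_,
    fun t S => ?_, fun t S => ?_, hB, hM, by linarith, hB0, hM0⟩
  · exact (sum_m_mul_heat_sq_le hψ t S).trans (by linarith)
  · exact (sum_m_mul_Gamma_heat_le hψ t S).trans (by linarith)
  · exact (sum_m_mul_heat_sq_le hf t S).trans (by linarith)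
  · exact (sum_m_mul_Gamma_heat_le hf t S).trans (by linarith)
  · rw [laplacian_heat hf]
    exact (sum_m_mul_Gamma_heat_le hf' t S).trans (by linarith)

/-- The cut-off version of `s ↦ ⟨Γ(P_{t-s} f), P_s ψ⟩` is almost non-decreasing under
non-negative curvature. -/
theorem cutoff_Gamma_le_add (hCD : G.CD 0 ⊤) {f ψ : V → ℝ} (hf : f.support.Finite)
    (hψ : ψ.support.Finite) {C B M : ℝ} (hb : HeatBounds (G := G) f ψ C B M)
    (hψ0 : ∀ t x, 0 ≤ G.heat t ψ x) {η : V → ℝ} {S : Finset V} (hS : G.Covers S η) {δ : ℝ}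
    (hδ : 0 < δ) (hη : ∀ x, G.Gamma η η x ≤ δ ^ 2) (hη1 : ∀ x, η x ^ 2 ≤ 1) {t a b : ℝ}
    (ha : 0 ≤ a) (hab : a ≤ b) (hbt : b ≤ t) :
    ∑ x ∈ S, G.m x * η x ^ 2 * (G.heat a.toNNReal ψ x *
      G.Gamma (G.heat (t - a).toNNReal f) (G.heat (t - a).toNNReal f) x) ≤
    ∑ x ∈ S, G.m x * η x ^ 2 * (G.heat b.toNNReal ψ x *
      G.Gamma (G.heat (t - b).toNNReal f) (G.heat (t - b).toNNReal f) x) +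
      δ * (2 * C + 5 * B * C + 4 * δ ^ 2 * (B * C)) * t := by
  set v : ℝ → V → ℝ := fun s => G.heat s.toNNReal ψ with hv
  set u : ℝ → V → ℝ := fun s => G.heat (t - s).toNNReal f with hu
  set ε := δ * (2 * C + 5 * B * C + 4 * δ ^ 2 * (B * C)) with hε
  have hε0 : 0 ≤ ε := by
    have := hb.nonneg
    have := hb.nonneg'
    positivity
  -- The sign is reversed because `sub_le_mul_of_hasDerivAt_le` bounds increments from above.
  have hcont : Continuous fun s => -∑ x ∈ S, G.m x * η x ^ 2 * (v s x * G.Gamma (u s) (u s) x) :=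
    (continuous_finsetSum _ fun x _ => continuous_const.mul ((continuous_heat hψ x).mul
      (continuous_Gamma_self (fun y => continuous_heat_sub hf y t) x))).neg
  have hd : ∀ s ∈ Set.Ioo a b, HasDerivAt
      (fun s => -∑ x ∈ S, G.m x * η x ^ 2 * (v s x * G.Gamma (u s) (u s) x))
      (-∑ x ∈ S, G.m x * η x ^ 2 * (G.laplacian (v s) x * G.Gamma (u s) (u s) x +
        v s x * (2 * G.Gamma (u s) (-G.laplacian (u s)) x))) s := by
    intro s hs
    refine (HasDerivAt.fun_sum fun x _ => HasDerivAt.const_mul _ ?_).neg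
    refine HasDerivAt.fun_mul ?_ (hasDerivAt_Gamma_self
      (fun y => hasDerivAt_heat_sub hf y (hs.2.trans_le hbt)) x)
    simp only [hv]
    rw [laplacian_heat hψ]
    exact hasDerivAt_heat hψ x (ha.trans_lt hs.1)
  have hle := sub_le_mul_of_hasDerivAt_le hab hcont.continuousOn hd (C := ε) fun s _ => by
    have hE := (abs_le.1 (abs_sum_sq_mul_laplacian_sub_le hS hδ hη (G.Gamma (u s) (u s)) (v s))).1
    have hcurv : 0 ≤ ∑ x ∈ S, G.m x * η x ^ 2 * (v s x * (2 * G.Gamma2 (u s) x)) :=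
      Finset.sum_nonneg fun x _ => mul_nonneg (mul_nonneg (G.m_pos x).le (sq_nonneg _))
        (mul_nonneg (hψ0 _ x) (mul_nonneg zero_le_two (hCD.Gamma2_nonneg _ x)))
    -- The derivative is the symmetry defect of `Δ` between `Γ(u)` and `v`, plus the curvature term
    -- `2 v Γ₂(u)`.
    have e : ∑ x ∈ S, G.m x * η x ^ 2 * (G.laplacian (v s) x * G.Gamma (u s) (u s) x +
        v s x * (2 * G.Gamma (u s) (-G.laplacian (u s)) x)) =
        ∑ x ∈ S, G.m x * η x ^ 2 * (G.Gamma (u s) (u s) x * G.laplacian (v s) x -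
          v s x * G.laplacian (G.Gamma (u s) (u s)) x) +
        ∑ x ∈ S, G.m x * η x ^ 2 * (v s x * (2 * G.Gamma2 (u s) x)) := by
      rw [← Finset.sum_add_distrib]
      refine Finset.sum_congr rfl fun x _ => ?_
      rw [Gamma_neg_right, Gamma2]; ring
    have b1 := hb.sum_sq_le s.toNNReal S
    have b2 : ∑ x ∈ S, G.m x * G.Gamma (u s) (u s) x ^ 2 ≤ B * C := by
      calc ∑ x ∈ S, G.m x * G.Gamma (u s) (u s) x ^ 2
          ≤ ∑ x ∈ S, B * (G.m x * G.Gamma (u s) (u s) x) := by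
            refine Finset.sum_le_sum fun x _ => ?_
            have := mul_le_mul_of_nonneg_left (hb.Gamma_le (t - s).toNNReal x)
              (mul_nonneg (G.m_pos x).le (G.Gamma_self_nonneg (u s) x))
            simp only [hu] at this ⊢
            linarith
        _ ≤ B * C := by
            rw [← Finset.mul_sum]
            exact mul_le_mul_of_nonneg_left (hb.sum_Gamma_le' _ S) hb.nonneg'
    have b3 := (pairSum_sq_mul_sq_le (G := G) S hη1 (v s)).trans
      (mul_le_mul_of_nonneg_left (hb.sum_Gamma_le s.toNNReal S) zero_le_two)
    -- No form-domain bound is available for `Γ(u)`; its weighted energy is controlled by the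
    -- Caccioppoli inequality.
    have b4 := pairSum_sq_mul_Gamma_sub_sq_le hS hη hη1 (hCD.Gamma2_nonneg (u s))
      (hb.Gamma_le (t - s).toNNReal)
    have b5 := hb.sum_Gamma_le' (t - s).toNNReal S
    have b6 := hb.sum_Gamma_laplacian_le' (t - s).toNNReal S
    have b7 : (G.pairSum S fun x y => η x ^ 2 *
        (G.Gamma (u s) (u s) y - G.Gamma (u s) (u s) x) ^ 2) ≤
        4 * B * (C + C) + 8 * δ ^ 2 * (B * C) := by
      refine b4.trans (add_le_add ?_ ?_)
      · exact mul_le_mul_of_nonneg_left (add_le_add b5 b6) (by linarith [hb.nonneg'])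
      · exact mul_le_mul_of_nonneg_left (mul_le_mul_of_nonneg_left b5 hb.nonneg') (by positivity)
    have b8 : ∑ x ∈ S, G.m x * v s x ^ 2 + ∑ x ∈ S, G.m x * G.Gamma (u s) (u s) x ^ 2
        + (1 / 2) * (G.pairSum S fun x y => η x ^ 2 * (v s y - v s x) ^ 2)
        + (1 / 2) * (G.pairSum S fun x y => η x ^ 2 *
          (G.Gamma (u s) (u s) y - G.Gamma (u s) (u s) x) ^ 2) ≤
        2 * C + 5 * B * C + 4 * δ ^ 2 * (B * C) := by linarith
    have b9 := mul_le_mul_of_nonneg_left b8 hδ.le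
    rw [e]
    linarith
  have hfin : ε * (b - a) ≤ ε * t := mul_le_mul_of_nonneg_left (by linarith) hε0
  linarith

theorem laplacian_sq (f : V → ℝ) (x : V) :
    G.laplacian (fun y => f y ^ 2) x = 2 * (f x * G.laplacian f x) + 2 * G.Gamma f f x := by
  have : (fun y => f y ^ 2) = f * f := by funext y; rw [Pi.mul_apply, sq]
  rw [this, laplacian_mul]; ring

/-- The derivative of the cut-off version of `s ↦ ⟨(P_{t-s} f)², P_s ψ⟩`, up to the
cut-off error. -/
theorem exists_hasDerivAt_cutoff_sq {f ψ : V → ℝ} (hf : f.support.Finite)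
    (hψ : ψ.support.Finite) {C B M : ℝ} (hb : HeatBounds (G := G) f ψ C B M)
    {η : V → ℝ} {S : Finset V} (hS : G.Covers S η) {δ : ℝ}
    (hδ : 0 < δ) (hη : ∀ x, G.Gamma η η x ≤ δ ^ 2) (hη1 : ∀ x, η x ^ 2 ≤ 1) {t s : ℝ}
    (hs0 : 0 < s) (hst : s < t) :
    ∃ d, HasDerivAt (fun s : ℝ => ∑ x ∈ S, G.m x * η x ^ 2 * (G.heat s.toNNReal ψ x *
        G.heat (t - s).toNNReal f x ^ 2)) d s ∧
      |d - 2 * ∑ x ∈ S, G.m x * η x ^ 2 * (G.heat s.toNNReal ψ x *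
        G.Gamma (G.heat (t - s).toNNReal f) (G.heat (t - s).toNNReal f) x)| ≤
        δ * (2 * C + 5 * M ^ 2 * C) := by
  set v : ℝ → V → ℝ := fun s => G.heat s.toNNReal ψ with hv
  set u : ℝ → V → ℝ := fun s => G.heat (t - s).toNNReal f with hu
  refine ⟨∑ x ∈ S, G.m x * η x ^ 2 * (G.laplacian (v s) x * u s x ^ 2 +
    v s x * (2 * u s x * -G.laplacian (u s) x)), ?_, ?_⟩
  · refine HasDerivAt.fun_sum fun x _ => HasDerivAt.const_mul _ ?_
    refine HasDerivAt.fun_mul ?_ (((hasDerivAt_heat_sub hf x hst).fun_pow 2).congr_deriv ?_)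
    · simp only [hv]
      rw [laplacian_heat hψ]
      exact hasDerivAt_heat hψ x hs0
    · simp [hu]
  · set g : V → ℝ := fun y => u s y ^ 2 with hg
    have hE := abs_sum_sq_mul_laplacian_sub_le hS hδ hη g (v s)
    -- Since `Δ(u²) = 2uΔu + 2Γ(u)`, only the symmetry defect of `Δ` between `u²` and `v` remains;
    -- no curvature enters.
    have e : ∑ x ∈ S, G.m x * η x ^ 2 * (G.laplacian (v s) x * u s x ^ 2 +
          v s x * (2 * u s x * -G.laplacian (u s) x)) -
        2 * ∑ x ∈ S, G.m x * η x ^ 2 * (v s x * G.Gamma (u s) (u s) x) =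
        ∑ x ∈ S, G.m x * η x ^ 2 * (g x * G.laplacian (v s) x - v s x * G.laplacian g x) := by
      rw [Finset.mul_sum, ← Finset.sum_sub_distrib]
      refine Finset.sum_congr rfl fun x _ => ?_
      rw [hg, laplacian_sq]; ring
    have hM : ∀ x, u s x ^ 2 ≤ M ^ 2 := fun x => by
      rw [← sq_abs]
      exact pow_le_pow_left₀ (abs_nonneg _) (hb.abs_le _ x) 2
    have b1 := hb.sum_sq_le s.toNNReal S
    have b2 : ∑ x ∈ S, G.m x * g x ^ 2 ≤ M ^ 2 * C := by
      calc ∑ x ∈ S, G.m x * g x ^ 2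
          ≤ ∑ x ∈ S, M ^ 2 * (G.m x * u s x ^ 2) := by
            refine Finset.sum_le_sum fun x _ => ?_
            have := mul_le_mul_of_nonneg_left (hM x)
              (mul_nonneg (G.m_pos x).le (sq_nonneg (u s x)))
            simp only [hg]
            linarith
        _ ≤ M ^ 2 * C := by
            rw [← Finset.mul_sum]
            exact mul_le_mul_of_nonneg_left (hb.sum_sq_le' _ S) (sq_nonneg _)
    have b3 := (pairSum_sq_mul_sq_le (G := G) S hη1 (v s)).trans
      (mul_le_mul_of_nonneg_left (hb.sum_Gamma_le s.toNNReal S) zero_le_two)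
    have b4 : (G.pairSum S fun x y => η x ^ 2 * (g y - g x) ^ 2) ≤
        4 * M ^ 2 * G.pairSum S fun x y => η x ^ 2 * (u s y - u s x) ^ 2 := by
      rw [← pairSum_const_mul]
      refine pairSum_mono S fun x y => ?_
      have h1 : (u s y + u s x) ^ 2 ≤ 4 * M ^ 2 := by
        nlinarith [hM x, hM y, sq_nonneg (u s y - u s x)]
      have h2 := mul_le_mul_of_nonneg_left h1
        (mul_nonneg (sq_nonneg (η x)) (sq_nonneg (u s y - u s x)))
      have h3 : η x ^ 2 * (g y - g x) ^ 2 =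
          η x ^ 2 * (u s y - u s x) ^ 2 * (u s y + u s x) ^ 2 := by
        simp only [hg]; ring
      linarith
    have b5 := (pairSum_sq_mul_sq_le (G := G) S hη1 (u s)).trans
      (mul_le_mul_of_nonneg_left (hb.sum_Gamma_le' (t - s).toNNReal S) zero_le_two)
    have b6 := mul_le_mul_of_nonneg_left b5 (by positivity : 0 ≤ 4 * M ^ 2)
    have b8 : ∑ x ∈ S, G.m x * v s x ^ 2 + ∑ x ∈ S, G.m x * g x ^ 2
        + (1 / 2) * (G.pairSum S fun x y => η x ^ 2 * (v s y - v s x) ^ 2)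
        + (1 / 2) * (G.pairSum S fun x y => η x ^ 2 * (g y - g x) ^ 2) ≤
        2 * C + 5 * M ^ 2 * C := by linarith
    rw [e]
    exact hE.trans (mul_le_mul_of_nonneg_left b8 hδ.le)

end Interpolation

/-! ### From curvature to the three semigroup inequalities. -/

section CurvatureImplies

variable {G}

-- Self-adjointness writes `P_t h(x)` as `⟨P_t ψ, h⟩` with `ψ = δ_x / m(x)`.
open Classical in
theorem heat_apply_eq_sum {h : V → ℝ} (hh : h.support.Finite) (t : ℝ≥0) (x : V) {T : Finset V}
    (hT : ∀ y ∉ T, h y = 0) :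
    G.heat t h x = ∑ y ∈ T, G.m y * (G.heat t (Pi.single x (G.m x)⁻¹) y * h y) := by
  rw [heat_eq hh, heat_eq (finite_support_single x (G.m x)⁻¹), ← evalL_apply, evalL,
    innerSL_apply_apply, ← inner_heatSemigroup_comm, real_inner_comm,
    inner_eq_sum (S := T) fun y hy => by rw [ofFinite_apply, hT y hy]]
  exact Finset.sum_congr rfl fun y _ => by rw [ofFinite_apply]; ring

open Classical in
theorem sum_cutoff_single {η : V → ℝ} {S : Finset V} {x : V} (hx : x ∈ S) (h : V → ℝ) :
    ∑ y ∈ S, G.m y * η y ^ 2 * ((Pi.single x (G.m x)⁻¹ : V → ℝ) y * h y) = η x ^ 2 * h x := by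
  rw [Finset.sum_eq_single x]
  · rw [Pi.single_eq_same]
    have := (G.m_pos x).ne'
    field_simp
  · intro y _ hy
    rw [Pi.single_eq_of_ne hy]; ring
  · exact fun h => absurd hx h

-- Identifies the endpoint `s = t`: `h` has finite support, so the limit in `k` is taken in a fixed
-- finite sum.
open Classical in
theorem IsCutoffSeq.tendsto_sum {η : ℕ → V → ℝ} {δ : ℕ → ℝ} (hη : G.IsCutoffSeq η δ)
    {h : V → ℝ} (hh : h.support.Finite) (t : ℝ≥0) (x : V) {S : ℕ → Finset V}
    (hS : ∀ k, hh.toFinset ⊆ S k) :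
    Tendsto (fun k => ∑ y ∈ S k, G.m y * η k y ^ 2 *
      (G.heat t (Pi.single x (G.m x)⁻¹) y * h y)) atTop (𝓝 (G.heat t h x)) := by
  have h0 : ∀ y ∉ hh.toFinset, h y = 0 := fun y hy => by simpa using hy
  rw [heat_apply_eq_sum hh t x h0]
  have hlim : Tendsto (fun k => ∑ y ∈ hh.toFinset, G.m y * η k y ^ 2 *
      (G.heat t (Pi.single x (G.m x)⁻¹) y * h y)) atTop
      (𝓝 (∑ y ∈ hh.toFinset, G.m y * 1 ^ 2 *
      (G.heat t (Pi.single x (G.m x)⁻¹) y * h y))) :=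
    tendsto_finsetSum _ fun y _ => (((hη.tendsto_one y).pow 2).const_mul _).mul_const _
  simp only [one_pow, mul_one] at hlim
  refine hlim.congr fun k => Finset.sum_subset (hS k) fun y _ hy => ?_
  rw [h0 y hy, mul_zero, mul_zero]

theorem finite_support_sq {f : V → ℝ} (hf : f.support.Finite) :
    (fun y => f y ^ 2).support.Finite :=
  hf.subset fun x hx h => hx (by simp [h])

/-- Up to errors vanishing as `k → ∞`, `φ k` is non-decreasing and `(χ k)' = 2 φ k`. Compare `φ k`
with its values at `0` and `t`, integrate, and let `k → ∞`. -/
theorem AssumptionA.heat_inequalities (hA : G.AssumptionA) (hCD : G.CD 0 ⊤) {f : V → ℝ}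
    (hf : f.support.Finite) (t : ℝ≥0) (x : V) :
    G.Gamma (G.heat t f) (G.heat t f) x ≤ G.heat t (G.Gamma f f) x ∧
    G.heat t (fun y => f y ^ 2) x - G.heat t f x ^ 2 ≤ 2 * t * G.heat t (G.Gamma f f) x ∧
    2 * t * G.Gamma (G.heat t f) (G.heat t f) x ≤
      G.heat t (fun y => f y ^ 2) x - G.heat t f x ^ 2 := by
  classical
  obtain ⟨η, δ, hη⟩ := hA.exists_isCutoffSeq
  set ψ : V → ℝ := Pi.single x (G.m x)⁻¹ with hψdef
  have hψ : ψ.support.Finite := finite_support_single x _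
  have hψnn : ∀ y, 0 ≤ ψ y := fun y => by
    by_cases h : y = x
    · subst h
      rw [hψdef, Pi.single_eq_same]
      exact inv_nonneg.2 (G.m_pos y).le
    · rw [hψdef, Pi.single_eq_of_ne h]
  have hψ0 : ∀ t x, 0 ≤ G.heat t ψ x := fun t x => hη.heat_nonneg hψ hψnn t x
  obtain ⟨C, B, M, hb⟩ := hA.exists_heatBounds hf hψ
  have hΓ := G.finite_support_Gamma hf
  have hsq := finite_support_sq hf
  choose S₀ hS₀ using fun k => G.exists_covers (hη.finite_support k)
  -- Besides covering `η k`, the set holds `x` for the limit at `s = 0`, and the supports of `Γ(f)`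
  -- and `f²` for the limits at `s = t`.
  set S : ℕ → Finset V := fun k => S₀ k ∪ (insert x (hΓ.toFinset ∪ hsq.toFinset)) with hSdef
  have hS : ∀ k, G.Covers (S k) (η k) := fun k => (hS₀ k).mono Finset.subset_union_left
  have hxS : ∀ k, x ∈ S k := fun k =>
    Finset.mem_union_right _ (Finset.mem_insert_self _ _)
  have hΓS : ∀ k, hΓ.toFinset ⊆ S k := fun k =>
    (Finset.subset_union_left.trans (Finset.subset_insert _ _)).trans Finset.subset_union_right
  have hsqS : ∀ k, hsq.toFinset ⊆ S k := fun k =>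
    (Finset.subset_union_right.trans (Finset.subset_insert _ _)).trans Finset.subset_union_right
  set φ : ℕ → ℝ → ℝ := fun k s => ∑ y ∈ S k, G.m y * η k y ^ 2 * (G.heat s.toNNReal ψ y *
    G.Gamma (G.heat (t - s).toNNReal f) (G.heat (t - s).toNNReal f) y) with hφ
  set χ : ℕ → ℝ → ℝ := fun k s => ∑ y ∈ S k, G.m y * η k y ^ 2 * (G.heat s.toNNReal ψ y *
    G.heat (t - s).toNNReal f y ^ 2) with hχ
  set ε : ℕ → ℝ := fun k => δ k * (2 * C + 5 * B * C + 4 * δ k ^ 2 * (B * C)) * t with hε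
  set ε' : ℕ → ℝ := fun k => δ k * (2 * C + 5 * M ^ 2 * C) with hε'
  have hφle : ∀ k (a b : ℝ), 0 ≤ a → a ≤ b → b ≤ t → φ k a ≤ φ k b + ε k := fun k a b ha hab hbt =>
    cutoff_Gamma_le_add hCD hf hψ hb hψ0 (hS k) (hη.pos k) (hη.Gamma_le k) (hη.sq_le_one k)
      ha hab hbt
  have hχc : ∀ k, Continuous (χ k) := fun k =>
    continuous_finsetSum _ fun y _ => continuous_const.mul ((continuous_heat hψ y).mul
      ((continuous_heat_sub hf y t).pow 2))
  have hχd : ∀ k, ∃ d : ℝ → ℝ, ∀ s ∈ Set.Ioo (0 : ℝ) t, HasDerivAt (χ k) (d s) s ∧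
      |d s - 2 * φ k s| ≤ ε' k := by
    intro k
    choose! d hd using fun (s : ℝ) (hs : s ∈ Set.Ioo (0 : ℝ) t) =>
      exists_hasDerivAt_cutoff_sq hf hψ hb (hS k) (hη.pos k) (hη.Gamma_le k) (hη.sq_le_one k)
        hs.1 hs.2
    exact ⟨d, hd⟩
  have hχle : ∀ k, χ k t - χ k 0 ≤ (2 * φ k t + 2 * ε k + ε' k) * t := by
    intro k
    obtain ⟨d, hd⟩ := hχd k
    have := sub_le_mul_of_hasDerivAt_le t.coe_nonneg (hχc k).continuousOn
      (fun s hs => (hd s hs).1) (C := 2 * φ k t + 2 * ε k + ε' k) fun s hs => by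
        have h1 := (abs_le.1 (hd s hs).2).2
        have h2 := hφle k s t hs.1.le hs.2.le le_rfl
        linarith
    rwa [sub_zero] at this
  have hleχ : ∀ k, (2 * φ k 0 - 2 * ε k - ε' k) * t ≤ χ k t - χ k 0 := by
    intro k
    obtain ⟨d, hd⟩ := hχd k
    have := sub_le_mul_of_hasDerivAt_le t.coe_nonneg (hχc k).neg.continuousOn
      (fun s hs => (hd s hs).1.neg) (C := -(2 * φ k 0 - 2 * ε k - ε' k)) fun s hs => by
        have h1 := (abs_le.1 (hd s hs).2).1
        have h2 := hφle k 0 s le_rfl hs.1.le hs.2.le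
        linarith
    simp only [Pi.neg_apply] at this
    linarith
  have hη2 : Tendsto (fun k => η k x ^ 2) atTop (𝓝 1) := by
    simpa using (hη.tendsto_one x).pow 2
  have lφ0 : Tendsto (fun k => φ k 0) atTop (𝓝 (G.Gamma (G.heat t f) (G.heat t f) x)) := by
    have e : ∀ k, φ k 0 = η k x ^ 2 * G.Gamma (G.heat t f) (G.heat t f) x := fun k => by
      simp only [hφ, Real.toNNReal_zero, heat_zero hψ, sub_zero, Real.toNNReal_coe]
      exact sum_cutoff_single (hxS k) _
    simp only [e]
    simpa using hη2.mul_const (G.Gamma (G.heat t f) (G.heat t f) x)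
  have lχ0 : Tendsto (fun k => χ k 0) atTop (𝓝 (G.heat t f x ^ 2)) := by
    have e : ∀ k, χ k 0 = η k x ^ 2 * G.heat t f x ^ 2 := fun k => by
      simp only [hχ, Real.toNNReal_zero, heat_zero hψ, sub_zero, Real.toNNReal_coe]
      exact sum_cutoff_single (hxS k) fun y => G.heat t f y ^ 2
    simp only [e]
    simpa using hη2.mul_const (G.heat t f x ^ 2)
  have lφt : Tendsto (fun k => φ k t) atTop (𝓝 (G.heat t (G.Gamma f f) x)) := by
    simp only [hφ, sub_self, Real.toNNReal_zero, heat_zero hf, Real.toNNReal_coe]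
    exact hη.tendsto_sum hΓ t x hΓS
  have lχt : Tendsto (fun k => χ k t) atTop (𝓝 (G.heat t (fun y => f y ^ 2) x)) := by
    simp only [hχ, sub_self, Real.toNNReal_zero, heat_zero hf, Real.toNNReal_coe]
    exact hη.tendsto_sum hsq t x hsqS
  have lε : Tendsto ε atTop (𝓝 0) := by
    have := (hη.tendsto_zero.mul ((((hη.tendsto_zero.pow 2).const_mul 4).mul_const
      (B * C)).const_add (2 * C + 5 * B * C))).mul_const (t : ℝ)
    simpa using this
  have lε' : Tendsto ε' atTop (𝓝 0) := by
    simpa using hη.tendsto_zero.mul_const (2 * C + 5 * M ^ 2 * C)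
  refine ⟨?_, ?_, ?_⟩
  · have h := le_of_tendsto_of_tendsto' lφ0 (lφt.add lε)
      fun k => hφle k 0 t le_rfl t.coe_nonneg le_rfl
    rwa [add_zero] at h
  · have h := le_of_tendsto_of_tendsto' (lχt.sub lχ0)
      ((((lφt.const_mul 2).add (lε.const_mul 2)).add lε').mul_const (t : ℝ)) hχle
    refine h.trans_eq ?_
    ring
  · have h := le_of_tendsto_of_tendsto'
      ((((lφ0.const_mul 2).sub (lε.const_mul 2)).sub lε').mul_const (t : ℝ)) (lχt.sub lχ0) hleχ
    refine le_trans (le_of_eq ?_) h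
    ring

end CurvatureImplies

/-! ### From each semigroup inequality back to curvature. -/

section ImpliesCurvature

variable {G}

/-- `Γ₂(f)(x)` depends only on the values of `f` within distance two of `x`, so `f` may be cut off
there. -/
theorem CD_zero_top_of_finite_support
    (h : ∀ f : V → ℝ, f.support.Finite → ∀ x, 0 ≤ G.Gamma2 f x) : G.CD 0 ⊤ := by
  classical
  intro f x
  simp only [ENNReal.inv_top, ENNReal.toReal_zero, zero_mul, add_zero]
  set A : Finset V := insert x (G.nbrs x ∪ (G.nbrs x).biUnion G.nbrs) with hA
  set f' : V → ℝ := fun y => if y ∈ A then f y else 0 with hf'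
  have hfin : f'.support.Finite := A.finite_toSet.subset fun y hy => by
    by_contra hy'
    exact hy (if_neg hy')
  have hx : f' x = f x := if_pos (Finset.mem_insert_self _ _)
  have hn : ∀ y ∈ G.nbrs x, f' y = f y := fun y hy =>
    if_pos (Finset.mem_insert_of_mem (Finset.mem_union_left _ hy))
  have hnn : ∀ y ∈ G.nbrs x, ∀ z ∈ G.nbrs y, f' z = f z := fun y hy z hz =>
    if_pos (Finset.mem_insert_of_mem (Finset.mem_union_right _ (Finset.mem_biUnion.2 ⟨y, hy, hz⟩)))
  have e : G.Gamma2 f' x = G.Gamma2 f x := by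
    rw [Gamma2, Gamma2]
    congr 1
    · congr 1
      exact G.laplacian_congr (G.Gamma_congr hx hx hn hn) fun y hy =>
        G.Gamma_congr (hn y hy) (hn y hy) (hnn y hy) (hnn y hy)
    · exact G.Gamma_congr hx (G.laplacian_congr hx hn) hn fun y hy =>
        G.laplacian_congr (hn y hy) (hnn y hy)
  rw [← e]
  exact h f' hfin x

theorem nonneg_of_hasDerivWithinAt_of_nonneg {h : ℝ → ℝ} {c : ℝ}
    (hd : HasDerivWithinAt h c (Set.Ici 0) 0) (h0 : h 0 = 0) (hnn : ∀ s, 0 < s → 0 ≤ h s) :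
    0 ≤ c := by
  rw [hasDerivWithinAt_iff_tendsto_slope, Set.Ici_sdiff_left] at hd
  refine ge_of_tendsto hd ?_
  filter_upwards [self_mem_nhdsWithin] with s hs
  have hs' : (0 : ℝ) < s := hs
  rw [slope_def_field, h0, sub_zero, sub_zero]
  exact div_nonneg (hnn s hs') hs'.le

/-- If `c < 0`, then `h' s < (c/2) s < 0` for small `s > 0`, and `h` drops below `h 0 = 0`. -/
theorem nonneg_of_second_hasDerivWithinAt_of_nonneg {h h' : ℝ → ℝ} {c : ℝ}
    (hcont : Continuous h) (hd : ∀ s, 0 < s → HasDerivAt h (h' s) s)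
    (hd' : HasDerivWithinAt h' c (Set.Ici 0) 0) (h0 : h 0 = 0) (h0' : h' 0 = 0)
    (hnn : ∀ s, 0 < s → 0 ≤ h s) : 0 ≤ c := by
  by_contra! hc
  rw [hasDerivWithinAt_iff_tendsto_slope, Set.Ici_sdiff_left] at hd'
  have hev := hd'.eventually (gt_mem_nhds (by linarith : c < c / 2))
  obtain ⟨r, hr, hr'⟩ := (mem_nhdsGT_iff_exists_Ioo_subset).1 hev
  have hr0 : (0 : ℝ) < r := hr
  have hneg : ∀ s ∈ Set.Ioo 0 r, h' s < c / 2 * s := by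
    intro s hs
    have := hr' hs
    rw [Set.mem_ofPred_eq, slope_def_field, h0', sub_zero, sub_zero, div_lt_iff₀ hs.1] at this
    exact this
  have hlt : h (r / 2) < h 0 := by
    refine strictAntiOn_of_deriv_neg (convex_Icc 0 (r / 2)) hcont.continuousOn (fun s hs => ?_)
      ⟨le_rfl, by linarith⟩ ⟨by linarith, le_rfl⟩ (by linarith)
    rw [interior_Icc] at hs
    rw [(hd s hs.1).deriv]
    have := hneg s ⟨hs.1, by linarith [hs.2]⟩
    nlinarith [hs.1]
  have := hnn (r / 2) (by linarith)
  linarith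

theorem laplacian_mul_eq (f g : V → ℝ) :
    G.laplacian (f * g) = f * G.laplacian g + g * G.laplacian f + (2 : ℝ) • G.Gamma f g := by
  funext x
  simp [laplacian_mul]

theorem laplacian_laplacian_mul_self (f : V → ℝ) (x : V) :
    G.laplacian (G.laplacian (f * f)) x =
      2 * f x * G.laplacian (G.laplacian f) x + 2 * G.laplacian f x ^ 2 +
      4 * G.Gamma f (G.laplacian f) x + 2 * G.laplacian (G.Gamma f f) x := by
  rw [laplacian_mul_eq, laplacian_add, laplacian_add, laplacian_smul]
  simp only [Pi.add_apply, Pi.smul_apply, smul_eq_mul, laplacian_mul]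
  ring

/-- The right derivative of `P_s Γ(f) - Γ(P_s f)` at `0` is `ΔΓ(f) - 2Γ(f, Δf) = 2Γ₂(f)`. -/
theorem CD_of_Gamma_heat_le (h : ∀ f : V → ℝ, f.support.Finite → ∀ t : ℝ≥0, 0 < t → ∀ x : V,
    G.Gamma (G.heat t f) (G.heat t f) x ≤ G.heat t (G.Gamma f f) x) : G.CD 0 ⊤ := by
  refine CD_zero_top_of_finite_support fun f hf x => ?_
  have hΓ := G.finite_support_Gamma hf
  have hd := (hasDerivWithinAt_heat (G := G) hΓ x).sub
    (hasDerivWithinAt_Gamma_self (G := G) (fun y => hasDerivWithinAt_heat (G := G) hf y) x)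
  have := nonneg_of_hasDerivWithinAt_of_nonneg hd
    (by simp [heat_zero hΓ, heat_zero hf]) fun s hs =>
      sub_nonneg.2 (h f hf s.toNNReal (Real.toNNReal_pos.2 hs) x)
  rw [Real.toNNReal_zero, heat_zero hf] at this
  rw [Gamma2]
  linarith

/-- The difference of the two sides vanishes to first order at `0` because `Δ(f²) = 2fΔf + 2Γ(f)`.
Its second derivative there is `4ΔΓ(f) - ΔΔ(f²) + 2(Δf)² + 2fΔΔf = 4Γ₂(f)`. -/
theorem CD_of_heat_sq_sub_le (h : ∀ f : V → ℝ, f.support.Finite → ∀ t : ℝ≥0, 0 < t → ∀ x : V,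
    G.heat t (f ^ 2) x - G.heat t f x ^ 2 ≤ 2 * (t : ℝ) * G.heat t (G.Gamma f f) x) :
    G.CD 0 ⊤ := by
  refine CD_zero_top_of_finite_support fun f hf x => ?_
  have hΓ := G.finite_support_Gamma hf
  have hΔ := G.finite_support_laplacian hf
  have hff : (f * f).support.Finite := hf.subset fun x hx h => hx (by
    simp [show f x = 0 from h])
  have hΔff := G.finite_support_laplacian hff
  have hΔΓ := G.finite_support_laplacian hΓ
  have hd : ∀ s : ℝ, 0 < s → HasDerivAt (fun s : ℝ => 2 * s * G.heat s.toNNReal (G.Gamma f f) x -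
      (G.heat s.toNNReal (f * f) x - G.heat s.toNNReal f x * G.heat s.toNNReal f x))
      (2 * G.heat s.toNNReal (G.Gamma f f) x +
        2 * s * G.heat s.toNNReal (G.laplacian (G.Gamma f f)) x -
      (G.heat s.toNNReal (G.laplacian (f * f)) x -
        (G.heat s.toNNReal (G.laplacian f) x * G.heat s.toNNReal f x +
          G.heat s.toNNReal f x * G.heat s.toNNReal (G.laplacian f) x))) s := fun s hs =>
    ((((hasDerivAt_id s).const_mul 2).fun_mul (hasDerivAt_heat hΓ x hs)).fun_sub
      ((hasDerivAt_heat hff x hs).fun_sub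
        ((hasDerivAt_heat hf x hs).fun_mul (hasDerivAt_heat hf x hs)))).congr_deriv (by simp)
  have w := fun {g : V → ℝ} (hg : g.support.Finite) => hasDerivWithinAt_heat (G := G) hg x
  have hd' := (((w hΓ).const_mul 2).fun_add
    ((((hasDerivWithinAt_id (0 : ℝ) (Set.Ici 0)).const_mul 2)).fun_mul (w hΔΓ))).fun_sub
    ((w hΔff).fun_sub (((w hΔ).fun_mul (w hf)).fun_add ((w hf).fun_mul (w hΔ))))
  have hc : Continuous (fun s : ℝ => 2 * s * G.heat s.toNNReal (G.Gamma f f) x -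
      (G.heat s.toNNReal (f * f) x - G.heat s.toNNReal f x * G.heat s.toNNReal f x)) :=
    ((continuous_const.mul continuous_id).mul (continuous_heat hΓ x)).sub
      ((continuous_heat hff x).sub ((continuous_heat hf x).mul (continuous_heat hf x)))
  have key := nonneg_of_second_hasDerivWithinAt_of_nonneg hc hd hd'
    (by simp [heat_zero hff, heat_zero hf])
    (by
      simp only [Real.toNNReal_zero, heat_zero hΓ, heat_zero hf, heat_zero hΔ, heat_zero hΔff,
        heat_zero hΔΓ, laplacian_mul]
      ring)
    fun s hs => by
      have := h f hf s.toNNReal (Real.toNNReal_pos.2 hs) x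
      rw [Real.coe_toNNReal _ hs.le] at this
      rw [sq f, sq (G.heat _ _ _)] at this
      linarith
  simp only [id, Real.toNNReal_zero, heat_zero hf, heat_zero hΔ, heat_zero hΔΓ,
    laplacian_laplacian_mul_self] at key
  rw [Gamma2]
  linarith

/-- Again first order cancels. The second derivative at `0` is `ΔΔ(f²) - 2(Δf)² - 2fΔΔf - 8Γ(f, Δf)
= 4Γ₂(f)`. -/
theorem CD_of_Gamma_heat_le_heat_sq_sub (h : ∀ f : V → ℝ, f.support.Finite → ∀ t : ℝ≥0, 0 < t →
    ∀ x : V, 2 * (t : ℝ) * G.Gamma (G.heat t f) (G.heat t f) x ≤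
      G.heat t (f ^ 2) x - G.heat t f x ^ 2) : G.CD 0 ⊤ := by
  refine CD_zero_top_of_finite_support fun f hf x => ?_
  have hΔ := G.finite_support_laplacian hf
  have hff : (f * f).support.Finite := hf.subset fun x hx h => hx (by
    simp [show f x = 0 from h])
  have hΔff := G.finite_support_laplacian hff
  have hdΓ : ∀ s : ℝ, 0 < s → HasDerivAt
      (fun s : ℝ => G.Gamma (G.heat s.toNNReal f) (G.heat s.toNNReal f) x)
      (2 * G.Gamma (G.heat s.toNNReal f) (G.heat s.toNNReal (G.laplacian f)) x) s := fun s hs =>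
    hasDerivAt_Gamma_self (fun y => hasDerivAt_heat hf y hs) x
  have hd : ∀ s : ℝ, 0 < s → HasDerivAt (fun s : ℝ =>
      G.heat s.toNNReal (f * f) x - G.heat s.toNNReal f x * G.heat s.toNNReal f x -
      2 * s * G.Gamma (G.heat s.toNNReal f) (G.heat s.toNNReal f) x)
      (G.heat s.toNNReal (G.laplacian (f * f)) x -
        (G.heat s.toNNReal (G.laplacian f) x * G.heat s.toNNReal f x +
          G.heat s.toNNReal f x * G.heat s.toNNReal (G.laplacian f) x) -
        (2 * G.Gamma (G.heat s.toNNReal f) (G.heat s.toNNReal f) x + s * (2 * (2 *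
          G.Gamma (G.heat s.toNNReal f) (G.heat s.toNNReal (G.laplacian f)) x)))) s :=
    fun s hs => (((hasDerivAt_heat hff x hs).fun_sub
      ((hasDerivAt_heat hf x hs).fun_mul (hasDerivAt_heat hf x hs))).fun_sub
      (((hasDerivAt_id s).const_mul 2).fun_mul (hdΓ s hs))).congr_deriv (by simp; ring)
  have w := fun {g : V → ℝ} (hg : g.support.Finite) => hasDerivWithinAt_heat (G := G) hg x
  have wΓ := hasDerivWithinAt_Gamma_self (G := G) (fun y => hasDerivWithinAt_heat (G := G) hf y) x
  -- A product `s · k(s)` has right derivative `k(0)` at `0` as soon as `k` is continuous, so `k` is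
  -- not differentiated.
  have wΓ' : HasDerivWithinAt (fun s : ℝ => s * (2 * (2 *
      G.Gamma (G.heat s.toNNReal f) (G.heat s.toNNReal (G.laplacian f)) x)))
      (2 * (2 * G.Gamma f (G.laplacian f) x)) (Set.Ici 0) 0 := by
    have hcΓ : Continuous fun s : ℝ => 2 * (2 *
        G.Gamma (G.heat s.toNNReal f) (G.heat s.toNNReal (G.laplacian f)) x) := by
      simp only [Gamma_apply]
      exact continuous_const.mul (continuous_const.mul (continuous_const.mul
        (continuous_finsetSum _ fun y _ => continuous_const.mul
          (((continuous_heat hf y).sub (continuous_heat hf x)).mul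
            ((continuous_heat hΔ y).sub (continuous_heat hΔ x))))))
    rw [hasDerivWithinAt_iff_tendsto_slope, Set.Ici_sdiff_left]
    have h1 := (hcΓ.tendsto 0).mono_left (nhdsWithin_le_nhds (s := Set.Ioi 0))
    rw [Real.toNNReal_zero, heat_zero hf, heat_zero hΔ] at h1
    refine h1.congr' ?_
    filter_upwards [self_mem_nhdsWithin] with s hs
    have hs' : s ≠ 0 := ne_of_gt hs
    rw [slope_def_field, zero_mul, sub_zero, sub_zero, mul_div_cancel_left₀ _ hs']
  have hd' := ((w hΔff).fun_sub (((w hΔ).fun_mul (w hf)).fun_add ((w hf).fun_mul (w hΔ)))).fun_sub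
    ((wΓ.const_mul 2).fun_add wΓ')
  have hc : Continuous (fun s : ℝ =>
      G.heat s.toNNReal (f * f) x - G.heat s.toNNReal f x * G.heat s.toNNReal f x -
      2 * s * G.Gamma (G.heat s.toNNReal f) (G.heat s.toNNReal f) x) :=
    ((continuous_heat hff x).sub ((continuous_heat hf x).mul (continuous_heat hf x))).sub
      ((continuous_const.mul continuous_id).mul
        (continuous_Gamma_self (fun y => continuous_heat hf y) x))
  have key := nonneg_of_second_hasDerivWithinAt_of_nonneg hc hd hd'
    (by simp [heat_zero hff, heat_zero hf])
    (by
      simp only [Real.toNNReal_zero, heat_zero hf, heat_zero hΔ, heat_zero hΔff, laplacian_mul]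
      ring)
    fun s hs => by
      have := h f hf s.toNNReal (Real.toNNReal_pos.2 hs) x
      rw [Real.coe_toNNReal _ hs.le] at this
      rw [sq f, sq (G.heat _ _ _)] at this
      linarith
  simp only [Real.toNNReal_zero, heat_zero hf, heat_zero hΔ,
    laplacian_laplacian_mul_self] at key
  rw [Gamma2]
  linarith

end ImpliesCurvature

end WeightedGraph

theorem theorem2 {V : Type*} (G : WeightedGraph V) (hA : G.AssumptionA) :
    G.IsHeatSemigroup G.heatSemigroup ∧
    List.TFAE [
      G.CD 0 ⊤,
      ∀ f : V → ℝ, f.support.Finite → ∀ t : ℝ≥0, 0 < t → ∀ x : V,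
        G.Gamma (G.heat t f) (G.heat t f) x ≤ G.heat t (G.Gamma f f) x,
      ∀ f : V → ℝ, f.support.Finite → ∀ t : ℝ≥0, 0 < t → ∀ x : V,
        G.heat t (f ^ 2) x - G.heat t f x ^ 2 ≤ 2 * (t : ℝ) * G.heat t (G.Gamma f f) x,
      ∀ f : V → ℝ, f.support.Finite → ∀ t : ℝ≥0, 0 < t → ∀ x : V,
        2 * (t : ℝ) * G.Gamma (G.heat t f) (G.heat t f) x ≤
          G.heat t (f ^ 2) x - G.heat t f x ^ 2] := by
  refine ⟨G.isHeatSemigroup_heatSemigroup, ?_⟩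
  tfae_have 1 → 2 := fun h f hf t _ x => (hA.heat_inequalities h hf t x).1
  tfae_have 1 → 3 := fun h f hf t _ x => (hA.heat_inequalities h hf t x).2.1
  tfae_have 1 → 4 := fun h f hf t _ x => (hA.heat_inequalities h hf t x).2.2
  tfae_have 2 → 1 := WeightedGraph.CD_of_Gamma_heat_le
  tfae_have 3 → 1 := WeightedGraph.CD_of_heat_sq_sub_le
  tfae_have 4 → 1 := WeightedGraph.CD_of_Gamma_heat_le_heat_sq_sub
  tfae_finish
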